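/- Let $m\ge 1$ and let $(M,\mathbf p)$ be a smooth (Hausdorff, second countable) projective manifold of dimension $n+1=4m+3\ge 7$, i.e. $\mathbf p$ is a class of torsion-free affine connections on $M$ any two of which are related by $\widehat\nabla_a\xi^b=\nabla_a\xi^b+\Upsilon_a\xi^b+\delta^b{}_a\Upsilon_c\xi^c$ for some $1$-form $\Upsilon_a$. Let $\mathcal E(w)=\big((\Lambda^{n+1}TM)^{\otimes 2}\big)^{w/(2n+4)}$ be the density bundles, let $\mathcal T=(J^1\mathcal E(1))^*$ be the standard tractor bundle with its normal tractor connection $\nabla^{\mathcal T}$, given in the splitting $\mathcal T\cong TM(-1)\oplus\mathcal E(-1)$ determined by $\nabla\in\mathbf p$ by $\nabla^{\mathcal T}_a(\nu^b,\rho)=(\nabla_a\nu^b+\rho\,\delta^b{}_a,\ \nabla_a\rho-\mathsf P_{ab}\nu^b)$, where $\mathsf P_{ab}=\frac1{n(n+2)}[(n+1)\mathrm{Ric}_{ab}+\mathrm{Ric}_{ba}]$. Let $\Pi:\mathrm{End}\,\mathcal T\to TM$ be the natural projection, which sends an endomorphism $\begin{pmatrix}\phi^a{}_b&\xi^a\\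 \nu_b&\psi\end{pmatrix}$ to $\xi^a$ (this does not depend on the splitting). Let $(\mathbb I,\mathbb J,\mathbb K)$ be a $\nabla^{\mathcal T}$-parallel hypercomplex structure on $\mathcal T$, i.e. parallel sections of $\mathrm{End}\,\mathcal T$ with $\mathbb I^2=\mathbb J^2=\mathbb K^2=\mathbb I\mathbb J\mathbb K=-\mathrm{id}_{\mathcal T}$, and put $i:=\Pi(\mathbb I)$, $j:=\Pi(\mathbb J)$, $k:=\Pi(\mathbb K)$. (Neither connectedness nor an orientation of $M$ is needed; in particular the statement covers connected oriented $M$ with a parallel hypercomplex structure that induces the same orientation on $\mathcal T$ as the parallel tractor volume form.) A connection $\nabla$ on an open set $U\subseteq M$ that belongs to $\mathbf p|_U$ is called a scale on $U$ if it preserves a nowhere-vanishing section of $\mathcal E(w)|_U$ for some $w\neq 0$, and an $(i,j,k)$-adapted scale on $U$ if moreover $\nabla_ai^a=\nabla_aj^a=\nabla_ak^a=0$ on $U$. Then: (a) The vector fields $i,j,k$ are linearly independent at every point, so $D=\operatorname{span}\{i,j,k\}\subset TM$ has rank $3$; the distribution $D$ is integrable (around every point there are local coordinates $x_1,\dots,x_{4m+3}$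 in which $D=\bigcap_{l>3}\ker dx_l$); and $[i,j]=-2k$, $[j,k]=-2i$, $[k,i]=-2j$. (b) Every point of $M$ has an open neighbourhood on which there exists an $(i,j,k)$-adapted scale. If $\nabla$ is an $(i,j,k)$-adapted scale on an open set $U$, then the $(i,j,k)$-adapted scales on $U$ are exactly the connections $\widehat\nabla_a\xi^b=\nabla_a\xi^b+\Upsilon_a\xi^b+\delta^b{}_a\Upsilon_c\xi^c$ where $\Upsilon=df$ for a smooth function $f$ on $U$ and $\Upsilon_ai^a=\Upsilon_aj^a=\Upsilon_ak^a=0$. (c) On every open set $U$ and for every $(i,j,k)$-adapted scale $\nabla$ on $U$, the vector fields $i,j,k$ are affine symmetries of $\nabla$, i.e. $\mathcal L_i\nabla=\mathcal L_j\nabla=\mathcal L_k\nabla=0$ on $U$. Moreover $i,j,k$ are projective symmetries of $(M,\mathbf p)$: for every $\nabla\in\mathbf p$ the trace-free parts of $\mathcal L_i\nabla$, $\mathcal L_j\nabla$, $\mathcal L_k\nabla$ vanish. -/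

import Mathlib

open scoped Manifold ContDiff Topology

noncomputable section

namespace ProjTractor

section Basics

variable {N : ℕ} {M : Type*} [TopologicalSpace M]
  [ChartedSpace (EuclideanSpace ℝ (Fin N)) M]

/-- (Not necessarily continuous) vector fields on an `N`-dimensional manifold `M`. -/
abbrev VField (N : ℕ) (M : Type*) [TopologicalSpace M]
    [ChartedSpace (EuclideanSpace ℝ (Fin N)) M] : Type _ :=
  (x : M) → TangentSpace (𝓡 N) x

/-- The raw type of affine connections on (open subsets of) `M`; as in Mathlib, `nabla ξ x v`
is `(∇_v ξ)(x)`. -/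
abbrev ConnOp (N : ℕ) (M : Type*) [TopologicalSpace M]
    [ChartedSpace (EuclideanSpace ℝ (Fin N)) M] : Type _ :=
  VField N M → (x : M) → TangentSpace (𝓡 N) x →L[ℝ] TangentSpace (𝓡 N) x

/-- The vector field `X` is smooth (`C^∞`) on `U`. -/
def SmoothFieldOn [IsManifold (𝓡 N) ∞ M] (X : VField N M) (U : Set M) : Prop :=
  ContMDiffOn (𝓡 N) ((𝓡 N).prod 𝓘(ℝ, EuclideanSpace ℝ (Fin N))) ∞
    (fun x ↦ Bundle.TotalSpace.mk' (EuclideanSpace ℝ (Fin N)) x (X x)) U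

/-- The vector field `X` is differentiable at `x`. -/
def DiffFieldAt [IsManifold (𝓡 N) ∞ M] (X : VField N M) (x : M) : Prop :=
  MDifferentiableAt (𝓡 N) ((𝓡 N).prod 𝓘(ℝ, EuclideanSpace ℝ (Fin N)))
    (fun y ↦ Bundle.TotalSpace.mk' (EuclideanSpace ℝ (Fin N)) y (X y)) x

/-- The function `f` is smooth (`C^∞`) on `U`. -/
def SmoothFunOn (f : M → ℝ) (U : Set M) : Prop :=
  ContMDiffOn (𝓡 N) 𝓘(ℝ, ℝ) ∞ f U

/-- `1`-forms on `M`. -/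
abbrev OneForm (N : ℕ) (M : Type*) [TopologicalSpace M]
    [ChartedSpace (EuclideanSpace ℝ (Fin N)) M] : Type _ :=
  (x : M) → TangentSpace (𝓡 N) x →L[ℝ] ℝ

/-- The differential of a function, as a `1`-form. -/
def dForm (f : M → ℝ) : OneForm N M := fun x ↦ mvfderiv (𝓡 N) f x

/-- The `1`-form `Υ` is smooth on the open set `U`: it maps smooth vector fields on `U` to smooth
functions on `U`. -/
def SmoothFormOn [IsManifold (𝓡 N) ∞ M] (Υ : OneForm N M) (U : Set M) : Prop :=
  ∀ X : VField N M, SmoothFieldOn X U → SmoothFunOn (N := N) (fun x ↦ Υ x (X x)) U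

/-! ### Torsion-free affine connections and projective structures -/

/-- `nabla` is a smooth torsion-free affine connection on the open set `U ⊆ M`. -/
structure IsTorsionFreeConnOn [IsManifold (𝓡 N) ∞ M] (nabla : ConnOp N M) (U : Set M) :
    Prop where
  isCov : IsCovariantDerivativeOn (EuclideanSpace ℝ (Fin N)) nabla U
  smooth : ContMDiffCovariantDerivativeOn (EuclideanSpace ℝ (Fin N)) ∞ nabla U
  torsionFree : ∀ (X Y : VField N M), ∀ x ∈ U, DiffFieldAt X x → DiffFieldAt Y x →
    nabla Y x (X x) - nabla X x (Y x) = VectorField.mlieBracket (𝓡 N) X Y x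

/-- On `U` the connections `nabla` and `nabla'` are related by the projective change
`∇'_a ξ^b = ∇_a ξ^b + Υ_a ξ^b + δ^b_a Υ_c ξ^c`. -/
def IsProjChangeOn [IsManifold (𝓡 N) ∞ M] (nabla nabla' : ConnOp N M) (Υ : OneForm N M) (U : Set M) : Prop :=
  ∀ x ∈ U, ∀ ξ : VField N M, DiffFieldAt ξ x → ∀ v : TangentSpace (𝓡 N) x,
    nabla' ξ x v = nabla ξ x v + Υ x v • ξ x + Υ x (ξ x) • v

/-- Projective equivalence on the open set `U` (of torsion-free connections). -/
def ProjEquivOn [IsManifold (𝓡 N) ∞ M] (nabla nabla' : ConnOp N M) (U : Set M) : Prop :=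
  ∃ Υ : OneForm N M, SmoothFormOn Υ U ∧ IsProjChangeOn nabla nabla' Υ U

/-- A projective structure on `M`: a projective equivalence class of torsion-free affine
connections on `M`. -/
structure ProjStructure (N : ℕ) (M : Type*) [TopologicalSpace M]
    [ChartedSpace (EuclideanSpace ℝ (Fin N)) M] [IsManifold (𝓡 N) ∞ M] where
  conns : Set (ConnOp N M)
  nonempty : conns.Nonempty
  torsionFree : ∀ nabla ∈ conns, IsTorsionFreeConnOn nabla Set.univ
  mem_iff : ∀ nabla ∈ conns, ∀ nabla' : ConnOp N M,
    nabla' ∈ conns ↔ IsTorsionFreeConnOn nabla' Set.univ ∧ ProjEquivOn nabla nabla' Set.univ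

/-- `nabla` is a connection on the open set `U` that belongs to the restriction of the projective
structure `p` to `U`. -/
def ProjStructure.MemOn [IsManifold (𝓡 N) ∞ M] (p : ProjStructure N M) (nabla : ConnOp N M)
    (U : Set M) : Prop :=
  IsTorsionFreeConnOn nabla U ∧ ∃ nabla₀ ∈ p.conns, ProjEquivOn nabla₀ nabla U

/-- The divergence `∇_a ξ^a` at `x`. -/
def divergence (nabla : ConnOp N M) (ξ : VField N M) (x : M) : ℝ :=
  LinearMap.trace ℝ (TangentSpace (𝓡 N) x) (nabla ξ x : _ →ₗ[ℝ] _)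

/-! ### Curvature -/

/-- The curvature `R_{ab}{}^c{}_d u^a v^b w^d` of a connection at `x`, that is,
`∇_u ∇_v w - ∇_v ∇_u w - ∇_{[u,v]} w` computed with (arbitrary, here: Mathlib's preferred) local
smooth extensions of the tangent vectors `u`, `v`, `w` at `x` to vector fields. -/
def curvature [IsManifold (𝓡 N) ∞ M] (nabla : ConnOp N M) (x : M)
    (u v w : TangentSpace (𝓡 N) x) : TangentSpace (𝓡 N) x :=
  let U : VField N M := FiberBundle.extend (EuclideanSpace ℝ (Fin N)) u
  let V : VField N M := FiberBundle.extend (EuclideanSpace ℝ (Fin N)) v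
  let W : VField N M := FiberBundle.extend (EuclideanSpace ℝ (Fin N)) w
  nabla (fun y ↦ nabla W y (V y)) x u - nabla (fun y ↦ nabla W y (U y)) x v
    - nabla W x (VectorField.mlieBracket (𝓡 N) U V x)

/-- The Ricci tensor `Ric_{bd} v^b w^d = R_{cb}{}^c{}_d v^b w^d`; the trace is computed in the
standard basis of the model space. -/
def ricci [IsManifold (𝓡 N) ∞ M] (nabla : ConnOp N M) (x : M)
    (v w : TangentSpace (𝓡 N) x) : ℝ :=
  let b : Module.Basis (Fin N) ℝ (TangentSpace (𝓡 N) x) :=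
    (EuclideanSpace.basisFun (Fin N) ℝ).toBasis
  ∑ c : Fin N, b.coord c (curvature nabla x (b c) v w)

/-- The projective Schouten tensor
`P_{ab} = 1/(n(n+2)) * ((n+1) Ric_{ab} + Ric_{ba})`, where `n + 1 = N` is the dimension. -/
def schouten [IsManifold (𝓡 N) ∞ M] (nabla : ConnOp N M) (x : M)
    (u v : TangentSpace (𝓡 N) x) : ℝ :=
  1 / (((N : ℝ) - 1) * ((N : ℝ) + 1)) * ((N : ℝ) * ricci nabla x u v + ricci nabla x v u)

/-! ### Density bundles and scales -/

/-- `s` is a smooth section over `U` of the density bundle `ℰ(w) = ((Λ^N TM)^{⊗2})^{w/(2(N+1))}`.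
A frame `b` of `T_x M` gives the positive element `((b_1 ∧ ⋯ ∧ b_N)^{⊗2})^{w/(2(N+1))}` of the line
`ℰ(w)_x`; the number `s x b` is the component of the section with respect to it. -/
structure IsDensityOn [IsManifold (𝓡 N) ∞ M] (w : ℝ)
    (s : (x : M) → (Fin N → TangentSpace (𝓡 N) x) → ℝ) (U : Set M) : Prop where
  equivariant : ∀ x ∈ U, ∀ b : Fin N → TangentSpace (𝓡 N) x, LinearIndependent ℝ b →
    ∀ A : TangentSpace (𝓡 N) x ≃ₗ[ℝ] TangentSpace (𝓡 N) x,
      s x (fun l ↦ A (b l)) =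
        |LinearMap.det (A : TangentSpace (𝓡 N) x →ₗ[ℝ] TangentSpace (𝓡 N) x)|
          ^ (-w / ((N : ℝ) + 1)) * s x b
  smooth : ∀ V : Set M, IsOpen V → V ⊆ U → ∀ X : Fin N → VField N M,
    IsLocalFrameOn (𝓡 N) (EuclideanSpace ℝ (Fin N)) ∞ X V →
      SmoothFunOn (N := N) (fun x ↦ s x (fun l ↦ X l x)) V

/-- The section `s` of `ℰ(w)` is parallel over `U` for the connection induced by `nabla`: if
`∇_u X_l = ω_l^h(u) X_h` in a local frame `X`, then
`d (s(X)) (u) + w/(N+1) * ω_l^l(u) * s(X) = 0`. -/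
def IsParallelDensityOn [IsManifold (𝓡 N) ∞ M] (nabla : ConnOp N M) (w : ℝ)
    (s : (x : M) → (Fin N → TangentSpace (𝓡 N) x) → ℝ) (U : Set M) : Prop :=
  ∀ V : Set M, IsOpen V → V ⊆ U → ∀ X : Fin N → VField N M,
    ∀ hX : IsLocalFrameOn (𝓡 N) (EuclideanSpace ℝ (Fin N)) ∞ X V,
      ∀ x ∈ V, ∀ u : TangentSpace (𝓡 N) x,
        dForm (N := N) (fun y ↦ s y (fun l ↦ X l y)) x u
          + w / ((N : ℝ) + 1) * (∑ l, hX.coeff l x (nabla (X l) x u)) * s x (fun l ↦ X l x) = 0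

/-- `nabla` is a scale of the projective structure `p` over the open set `U`: it belongs to `p`
over `U`, and it is the connection determined by some nowhere-vanishing section of some `ℰ(w)`,
`w ≠ 0`, over `U`. -/
def ProjStructure.IsScaleOn [IsManifold (𝓡 N) ∞ M] (p : ProjStructure N M)
    (nabla : ConnOp N M) (U : Set M) : Prop :=
  p.MemOn nabla U ∧
    ∃ w : ℝ, w ≠ 0 ∧ ∃ s : (x : M) → (Fin N → TangentSpace (𝓡 N) x) → ℝ,
      IsDensityOn w s U ∧
      (∀ x ∈ U, ∀ b : Fin N → TangentSpace (𝓡 N) x, LinearIndependent ℝ b → s x b ≠ 0) ∧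
      IsParallelDensityOn nabla w s U

/-! ### Symmetries and distributions -/

/-- The Lie derivative of a connection:
`(ℒ_ξ ∇)(Y, η) = [ξ, ∇_Y η] - ∇_{[ξ, Y]} η - ∇_Y [ξ, η]`. -/
def lieConn (nabla : ConnOp N M) (ξ Y η : VField N M) : VField N M := fun x ↦
  VectorField.mlieBracket (𝓡 N) ξ (fun y ↦ nabla η y (Y y)) x
    - nabla η x (VectorField.mlieBracket (𝓡 N) ξ Y x)
    - nabla (VectorField.mlieBracket (𝓡 N) ξ η) x (Y x)

/-- `ξ` is an affine symmetry over `U` of the connection `nabla`, that is, `ℒ_ξ ∇ = 0`. -/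
def IsAffineSymmetryOn [IsManifold (𝓡 N) ∞ M] (nabla : ConnOp N M) (ξ : VField N M)
    (U : Set M) : Prop :=
  ∀ Y η : VField N M, SmoothFieldOn Y U → SmoothFieldOn η U →
    ∀ x ∈ U, lieConn nabla ξ Y η x = 0

/-- `ξ` is a projective symmetry over `U` of the torsion-free connection `nabla`: the trace-free
part of the section `ℒ_ξ ∇` of `S²T*M ⊗ TM` vanishes, that is, `ℒ_ξ ∇` is at every point of the
form `(Y, η) ↦ β(Y) η + β(η) Y`. -/
def IsProjSymmetryOn [IsManifold (𝓡 N) ∞ M] (nabla : ConnOp N M) (ξ : VField N M)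
    (U : Set M) : Prop :=
  ∀ x ∈ U, ∃ β : TangentSpace (𝓡 N) x →L[ℝ] ℝ,
    ∀ Y η : VField N M, SmoothFieldOn Y U → SmoothFieldOn η U →
      lieConn nabla ξ Y η x = β (Y x) • η x + β (η x) • Y x

/-- A rank `r` distribution is integrable: around every point there are smooth coordinates
`(x_0, …, x_{N-1})` in which it is the common kernel of the differentials `dx_l`, `l ≥ r`; so the
slices on which the `x_l`, `l ≥ r`, are constant are `r`-dimensional integral submanifolds. -/
def IsIntegrable [IsManifold (𝓡 N) ∞ M] (r : ℕ)
    (D : (x : M) → Submodule ℝ (TangentSpace (𝓡 N) x)) : Prop :=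
  (∀ x : M, Module.finrank ℝ (D x) = r) ∧
  ∀ x : M, ∃ e ∈ IsManifold.maximalAtlas (𝓡 N) ∞ M, x ∈ e.source ∧
    ∀ y ∈ e.source, ∀ v : TangentSpace (𝓡 N) y,
      v ∈ D y ↔ ∀ l : Fin N, r ≤ (l : ℕ) →
        EuclideanSpace.proj (𝕜 := ℝ) l (mfderiv (𝓡 N) (𝓡 N) e y v) = 0

end Basics

/-! ### The endomorphism bundle of the tractor bundle -/

section Tractors

variable {N : ℕ} {M : Type*} [TopologicalSpace M]
  [ChartedSpace (EuclideanSpace ℝ (Fin N)) M] [IsManifold (𝓡 N) ∞ M]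

/-- Smooth sections of `End 𝒯`, where `𝒯 = (J¹ℰ(1))^*` is the standard tractor bundle of `p`.

A connection `∇ ∈ p` splits `𝒯 ≅ TM(-1) ⊕ ℰ(-1)`, `t = (v, ρ)`. For the connection
`∇' = ∇ + Υ` of `p` the same tractor is `(v, ρ - Υ(v))`, since the cotractor `j¹σ = (∇σ, σ)`,
`σ ∈ ℰ(1)`, becomes `(∇σ + Υσ, σ)`. As `End 𝒯 = End (𝒯 ⊗ ℰ(1))` canonically, the weights
cancel: in the splitting given by `∇` a section of `End 𝒯` is a field of endomorphisms of
`TM ⊕ ℝ`, and the fields for different members of `p` correspond under the above change of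
splitting. -/
structure TractorEnd (p : ProjStructure N M) where
  toFun : p.conns → (x : M) → Module.End ℝ (TangentSpace (𝓡 N) x × ℝ)
  smooth : ∀ (nabla : p.conns) (X : VField N M) (f : M → ℝ),
    SmoothFieldOn X Set.univ → SmoothFunOn (N := N) f Set.univ →
      SmoothFieldOn (fun x ↦ (toFun nabla x (X x, f x)).1) Set.univ ∧
      SmoothFunOn (N := N) (fun x ↦ (toFun nabla x (X x, f x)).2) Set.univ
  transform : ∀ (nabla nabla' : p.conns) (Υ : OneForm N M),
    IsProjChangeOn nabla.1 nabla'.1 Υ Set.univ →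
      ∀ (x : M) (v : TangentSpace (𝓡 N) x) (ρ : ℝ),
        toFun nabla' x (v, ρ - Υ x v) =
          ((toFun nabla x (v, ρ)).1,
            (toFun nabla x (v, ρ)).2 - Υ x (toFun nabla x (v, ρ)).1)

/-- The normal tractor connection in the splitting given by `nabla`:
`∇^𝒯_u (X, f) = (∇_u X + f u, ∇_u f - P(u, X))`. This is the connection dual to
`∇^𝒯_a (μ_b, σ) = (∇_a μ_b + P_{ab} σ, ∇_a σ - μ_a)` on `𝒯^*`, written for sections
`(X, f)` of `𝒯 ⊗ ℰ(1) ≅ TM ⊕ ℝ` by means of the connection induced by `nabla` on `ℰ(1)`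
(which does not affect the induced connection on `End 𝒯`). -/
def tractorConn (nabla : ConnOp N M) (X : VField N M) (f : M → ℝ) (x : M)
    (u : TangentSpace (𝓡 N) x) : TangentSpace (𝓡 N) x × ℝ :=
  (nabla X x u + f x • u, dForm f x u - schouten nabla x u (X x))

namespace TractorEnd

variable {p : ProjStructure N M}

/-- `A` is parallel for the normal tractor connection:
`∇^𝒯 (A t) = A (∇^𝒯 t)` for all sections `t`. -/
def IsParallel (A : TractorEnd p) : Prop :=
  ∀ (nabla : p.conns) (X : VField N M) (f : M → ℝ),
    SmoothFieldOn X Set.univ → SmoothFunOn (N := N) f Set.univ →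
      ∀ (x : M) (u : TangentSpace (𝓡 N) x),
        tractorConn nabla.1 (fun y ↦ (A.toFun nabla y (X y, f y)).1)
            (fun y ↦ (A.toFun nabla y (X y, f y)).2) x u =
          A.toFun nabla x (tractorConn nabla.1 X f x u)

/-- The projection `Π : End 𝒯 → TM`, the upper right block `ξ^a` of an endomorphism in any
splitting. -/
def proj (A : TractorEnd p) : VField N M := fun x ↦
  (A.toFun ⟨p.nonempty.some, p.nonempty.some_mem⟩ x (0, 1)).1

/-- The projection `Π` does not depend on the splitting. -/
theorem proj_eq (A : TractorEnd p) (nabla : p.conns) (x : M) :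
    A.proj x = (A.toFun nabla x (0, 1)).1 := by
  obtain ⟨Υ, -, h⟩ := ((p.mem_iff _ nabla.2 _).1 p.nonempty.some_mem).2
  have := A.transform nabla ⟨p.nonempty.some, p.nonempty.some_mem⟩ Υ h x 0 1
  simp only [map_zero, sub_zero] at this
  simp only [proj, this]

end TractorEnd

/-- `(I, J, K)` is a hypercomplex structure on the tractor bundle: fibrewise
`I² = J² = K² = -id` and `I J K = -id`. -/
structure IsHypercomplex {p : ProjStructure N M} (I J K : TractorEnd p) : Prop where
  sq_I : ∀ nabla x, I.toFun nabla x * I.toFun nabla x = -1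
  sq_J : ∀ nabla x, J.toFun nabla x * J.toFun nabla x = -1
  sq_K : ∀ nabla x, K.toFun nabla x * K.toFun nabla x = -1
  mul_IJK : ∀ nabla x, I.toFun nabla x * J.toFun nabla x * K.toFun nabla x = -1

/-- `nabla` is an `(i, j, k)`-adapted scale of `p` over the open set `U`. -/
def IsAdaptedScaleOn (p : ProjStructure N M) (i j k : VField N M) (nabla : ConnOp N M)
    (U : Set M) : Prop :=
  p.IsScaleOn nabla U ∧
    ∀ x ∈ U, divergence nabla i x = 0 ∧ divergence nabla j x = 0 ∧ divergence nabla k x = 0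

end Tractors

end ProjTractor

end

/-! Everything rests on two properties of a parallel section `C` of `End 𝒯` with `ξ = Π(C)`: its
first derivative is algebraic, `∇_u ξ = (C(u,0)).1 - (C(0,1)).2 u`, and `C` commutes with the
tractor curvature `F`.

(a) A combination `A` of `𝕀, 𝕁, 𝕂` with real coefficients `g` squares to `-|g|²`. If `Π(A) = 0`,
then the vector `(0,1)` is an eigenvector of `A` with a real eigenvalue, so `g = 0`
(`linearIndependent_fst_of_quaternion`). Torsion-freeness and the formula for `∇ξ` give `[Π(A),
Π(B)] = Π(BA - AB)` (`mlieBracket_proj`), hence the brackets. The fields thus span a Lie algebra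
with constant structure constants, and Frobenius applies (`exists_straightening`).

(c) By torsion-freeness `F(u,v)` kills `(0,1)`. It commutes with `C`, so it also kills `C(0,1)` and
therefore `(ξ,0)`. The Bianchi identity `tractorCurv_cyclic` then makes `S(t,t') = F(ξ, t.1) t'`
symmetric. `S` is linear in `t'` over both `𝕀` and `𝕁`, by symmetry also in `t`, and these
anticommute, so `S = 0` (`eq_zero_of_symm_of_anticomm`). This says that the Weyl tensor vanishes on
`ξ` (`curv_proj`). Since `ℒ_ξ∇(u,v) = ∇_u∇_v ξ + R(ξ,u)v`, and the Hessian of `ξ` is known from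
parallelism, all that remains of `ℒ_ξ∇` is a trace `β(u)v + β(v)u` (`lieForm_proj`): `ξ` is a
projective symmetry. For a scale in which `ξ` is divergence-free, the trace of `ℒ_ξ∇` is `(N+1)β` on
one side and `d(div ξ) = 0` on the other, because the connection on densities is flat. Hence `β = 0`
(`lieForm_eq_zero`).

(b) A projective change by `Υ` adds `(N+1)Υ(ξ)` to `div ξ`. Suitable powers of the densities of two
scales have a function as quotient, so two scales differ by an exact form (`exists_potential`); the
freedom in adapted scales follows. For existence, a function `f` is needed whose derivatives along
`i, j, k` are `-1/(N+1)` times their coordinate divergences. Divergences satisfy the cocycle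
identity for brackets (`divergence_cocycle`), which is precisely the integrability condition of this
system. Frobenius and this system are solved together, by lifting the fields to `𝔼 × ℝ` with the
prescribed derivatives as last component.

The straightening map is the time-one flow of linear combinations of the fields. Its smooth
dependence on the parameters comes from the implicit function theorem for the integral equation on
the Banach space of curves `[0,1] → F` (`exists_flow`). -/

open scoped Manifold ContDiff Topology

noncomputable section

namespace ProjTractor

set_option linter.unusedSectionVars false

/-! ### Fields, brackets and connections read in a chart; cut-off fields -/

section Coordinates

open Bundle Set Filter

variable {N : ℕ} {M : Type*} [TopologicalSpace M]
  [ChartedSpace (EuclideanSpace ℝ (Fin N)) M] [IsManifold (𝓡 N) ∞ M]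

local notation "𝔼" => EuclideanSpace ℝ (Fin N)

/-- Coordinates of tangent vectors in the chart at `x₀`. -/
def tcoord (x₀ y : M) : TangentSpace (𝓡 N) y →L[ℝ] EuclideanSpace ℝ (Fin N) :=
  (trivializationAt (EuclideanSpace ℝ (Fin N)) (TangentSpace (𝓡 N)) x₀).continuousLinearMapAt ℝ y

/-- The tangent vector with given coordinates in the chart at `x₀`. -/
def tvec (x₀ y : M) : EuclideanSpace ℝ (Fin N) →L[ℝ] TangentSpace (𝓡 N) y :=
  (trivializationAt (EuclideanSpace ℝ (Fin N)) (TangentSpace (𝓡 N)) x₀).symmL ℝ y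

variable (x₀ : M)

lemma tvec_tcoord {y : M} (hy : y ∈ (chartAt 𝔼 x₀).source) (v : TangentSpace (𝓡 N) y) :
    tvec x₀ y (tcoord x₀ y v) = v :=
  (trivializationAt 𝔼 (TangentSpace (𝓡 N)) x₀).symmL_continuousLinearMapAt
    (by simpa using hy) v

lemma tcoord_tvec {y : M} (hy : y ∈ (chartAt 𝔼 x₀).source) (v : 𝔼) :
    tcoord x₀ y (tvec x₀ y v) = v :=
  (trivializationAt 𝔼 (TangentSpace (𝓡 N)) x₀).continuousLinearMapAt_symmL
    (by simpa using hy) v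

lemma tcoord_eq_snd {y : M} (hy : y ∈ (chartAt 𝔼 x₀).source) (v : TangentSpace (𝓡 N) y) :
    tcoord x₀ y v = (trivializationAt 𝔼 (TangentSpace (𝓡 N)) x₀ ⟨y, v⟩).2 := by
  rw [tcoord, Trivialization.continuousLinearMapAt_apply,
    Trivialization.linearMapAt_apply, if_pos (by simpa using hy)]

lemma tcoord_eq_mfderiv {y : M} (hy : y ∈ (chartAt 𝔼 x₀).source) :
    tcoord x₀ y = mfderiv (𝓡 N) (𝓡 N) (chartAt 𝔼 x₀) y := by
  have := TangentBundle.continuousLinearMapAt_trivializationAt (I := 𝓡 N) hy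
  rw [tcoord, this]
  rfl

/-- A vector field, read in the chart at `x₀`. -/
def rep (X : VField N M) (z : EuclideanSpace ℝ (Fin N)) : EuclideanSpace ℝ (Fin N) :=
  tcoord x₀ ((chartAt (EuclideanSpace ℝ (Fin N)) x₀).symm z)
    (X ((chartAt (EuclideanSpace ℝ (Fin N)) x₀).symm z))

/-- The vector field with constant coordinates in the chart at `x₀`. -/
def cfield (v : EuclideanSpace ℝ (Fin N)) : VField N M := fun y ↦ tvec x₀ y v

lemma rep_chart {X : VField N M} {y : M} (hy : y ∈ (chartAt 𝔼 x₀).source) :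
    rep x₀ X (chartAt 𝔼 x₀ y) = tcoord x₀ y (X y) := by
  rw [rep, (chartAt 𝔼 x₀).left_inv hy]

/-! ### Functions -/

lemma contMDiffAt_iff_chart {F : Type*} [NormedAddCommGroup F] [NormedSpace ℝ F]
    {f : M → F} {y : M} (hy : y ∈ (chartAt 𝔼 x₀).source) :
    ContMDiffAt (𝓡 N) 𝓘(ℝ, F) ∞ f y ↔
      ContDiffAt ℝ ∞ (f ∘ (chartAt 𝔼 x₀).symm) (chartAt 𝔼 x₀ y) := by
  rw [contMDiffAt_iff_source_of_mem_source (x := x₀) hy, ← contMDiffAt_iff_contDiffAt]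
  simp [contMDiffWithinAt_univ]

lemma mdifferentiableAt_iff_chart {F : Type*} [NormedAddCommGroup F] [NormedSpace ℝ F]
    {f : M → F} {y : M} (hy : y ∈ (chartAt 𝔼 x₀).source) :
    MDifferentiableAt (𝓡 N) 𝓘(ℝ, F) f y ↔
      DifferentiableAt ℝ (f ∘ (chartAt 𝔼 x₀).symm) (chartAt 𝔼 x₀ y) := by
  have h1 : MDifferentiableAt (𝓡 N) (𝓡 N) (chartAt 𝔼 x₀) y :=
    mdifferentiableAt_atlas (chart_mem_atlas _ _) hy
  have h2 : MDifferentiableAt (𝓡 N) (𝓡 N) (chartAt 𝔼 x₀).symm (chartAt 𝔼 x₀ y) :=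
    mdifferentiableAt_atlas_symm (chart_mem_atlas _ _) ((chartAt 𝔼 x₀).map_source hy)
  rw [← mdifferentiableAt_iff_differentiableAt]
  constructor
  · intro h
    refine MDifferentiableAt.comp _ ?_ h2
    rwa [(chartAt 𝔼 x₀).left_inv hy]
  · intro h
    have := MDifferentiableAt.comp y h h1
    refine this.congr_of_eventuallyEq ?_
    filter_upwards [(chartAt 𝔼 x₀).open_source.mem_nhds hy] with y' hy'
    simp [(chartAt 𝔼 x₀).left_inv hy']

lemma dForm_apply {f : M → ℝ} {y : M} (hy : y ∈ (chartAt 𝔼 x₀).source)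
    (hf : MDifferentiableAt (𝓡 N) 𝓘(ℝ, ℝ) f y) (u : TangentSpace (𝓡 N) y) :
    dForm (N := N) f y u =
      fderiv ℝ (f ∘ (chartAt 𝔼 x₀).symm) (chartAt 𝔼 x₀ y) (tcoord x₀ y u) := by
  have h1 : MDifferentiableAt (𝓡 N) (𝓡 N) (chartAt 𝔼 x₀) y :=
    mdifferentiableAt_atlas (chart_mem_atlas _ _) hy
  have h2 : MDifferentiableAt (𝓡 N) 𝓘(ℝ, ℝ) (f ∘ (chartAt 𝔼 x₀).symm) (chartAt 𝔼 x₀ y) :=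
    ((mdifferentiableAt_iff_chart x₀ hy).1 hf).mdifferentiableAt
  have h3 : f =ᶠ[𝓝 y] (f ∘ (chartAt 𝔼 x₀).symm) ∘ chartAt 𝔼 x₀ := by
    filter_upwards [(chartAt 𝔼 x₀).open_source.mem_nhds hy] with y' hy'
    simp [(chartAt 𝔼 x₀).left_inv hy']
  have h4 := h3.mfderiv_eq (I := 𝓡 N) (I' := 𝓘(ℝ, ℝ))
  rw [mfderiv_comp y h2 h1, mfderiv_eq_fderiv, ← tcoord_eq_mfderiv x₀ hy] at h4
  simp only [dForm, mvfderiv]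
  change mfderiv (𝓡 N) 𝓘(ℝ, ℝ) f y u = _
  rw [h4]
  rfl

/-! ### Vector fields -/

lemma contMDiffAt_iff_rep {X : VField N M} {y : M} (hy : y ∈ (chartAt 𝔼 x₀).source) :
    ContMDiffAt (𝓡 N) ((𝓡 N).prod 𝓘(ℝ, 𝔼)) ∞ (fun x ↦ TotalSpace.mk' 𝔼 x (X x)) y ↔
      ContDiffAt ℝ ∞ (rep x₀ X) (chartAt 𝔼 x₀ y) := by
  rw [(trivializationAt 𝔼 (TangentSpace (𝓡 N)) x₀).contMDiffAt_section_iff (by simpa using hy),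
    contMDiffAt_iff_chart x₀ hy]
  have key : rep x₀ X =ᶠ[𝓝 (chartAt 𝔼 x₀ y)]
      (fun x ↦ (trivializationAt 𝔼 (TangentSpace (𝓡 N)) x₀ ⟨x, X x⟩).2) ∘
        (chartAt 𝔼 x₀).symm := by
    filter_upwards [(chartAt 𝔼 x₀).open_target.mem_nhds ((chartAt 𝔼 x₀).map_source hy)] with z hz
    rw [rep, tcoord_eq_snd x₀ ((chartAt 𝔼 x₀).map_target hz)]
    rfl
  exact ⟨fun h ↦ h.congr_of_eventuallyEq key, fun h ↦ h.congr_of_eventuallyEq key.symm⟩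

lemma diffFieldAt_iff_rep {X : VField N M} {y : M} (hy : y ∈ (chartAt 𝔼 x₀).source) :
    DiffFieldAt X y ↔ DifferentiableAt ℝ (rep x₀ X) (chartAt 𝔼 x₀ y) := by
  rw [DiffFieldAt, (trivializationAt 𝔼 (TangentSpace (𝓡 N)) x₀).mdifferentiableAt_section_iff
    (𝓡 N) X (by simpa using hy), mdifferentiableAt_iff_chart x₀ hy]
  refine Filter.EventuallyEq.differentiableAt_iff ?_
  filter_upwards [(chartAt 𝔼 x₀).open_target.mem_nhds ((chartAt 𝔼 x₀).map_source hy)] with z hz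
  rw [rep, tcoord_eq_snd x₀ ((chartAt 𝔼 x₀).map_target hz)]
  rfl

lemma smoothFieldOn_iff {X : VField N M} {U : Set M} (hU : IsOpen U) :
    SmoothFieldOn X U ↔ ∀ y ∈ U, ContMDiffAt (𝓡 N) ((𝓡 N).prod 𝓘(ℝ, 𝔼)) ∞
      (fun x ↦ TotalSpace.mk' 𝔼 x (X x)) y :=
  ⟨fun h y hy ↦ (h y hy).contMDiffAt (hU.mem_nhds hy), fun h y hy ↦ (h y hy).contMDiffWithinAt⟩

lemma smoothFunOn_iff {f : M → ℝ} {U : Set M} (hU : IsOpen U) :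
    SmoothFunOn (N := N) f U ↔ ∀ y ∈ U, ContMDiffAt (𝓡 N) 𝓘(ℝ, ℝ) ∞ f y :=
  ⟨fun h y hy ↦ (h y hy).contMDiffAt (hU.mem_nhds hy), fun h y hy ↦ (h y hy).contMDiffWithinAt⟩

lemma SmoothFieldOn.contDiffAt_rep {X : VField N M} {U : Set M} (hX : SmoothFieldOn X U)
    (hU : IsOpen U) {y : M} (hyU : y ∈ U) (hy : y ∈ (chartAt 𝔼 x₀).source) :
    ContDiffAt ℝ ∞ (rep x₀ X) (chartAt 𝔼 x₀ y) :=
  (contMDiffAt_iff_rep x₀ hy).1 ((smoothFieldOn_iff hU).1 hX y hyU)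

lemma SmoothFieldOn.diffFieldAt {X : VField N M} {U : Set M} (hX : SmoothFieldOn X U)
    (hU : IsOpen U) {y : M} (hyU : y ∈ U) : DiffFieldAt X y :=
  ((smoothFieldOn_iff hU).1 hX y hyU).mdifferentiableAt (by simp)

lemma SmoothFunOn.contDiffAt_chart {f : M → ℝ} {U : Set M} (hf : SmoothFunOn (N := N) f U)
    (hU : IsOpen U) {y : M} (hyU : y ∈ U) (hy : y ∈ (chartAt 𝔼 x₀).source) :
    ContDiffAt ℝ ∞ (f ∘ (chartAt 𝔼 x₀).symm) (chartAt 𝔼 x₀ y) :=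
  (contMDiffAt_iff_chart x₀ hy).1 ((smoothFunOn_iff hU).1 hf y hyU)

lemma rep_cfield (v : 𝔼) {z : 𝔼} (hz : z ∈ (chartAt 𝔼 x₀).target) :
    rep x₀ (cfield x₀ v) z = v :=
  tcoord_tvec x₀ ((chartAt 𝔼 x₀).map_target hz) v

lemma rep_congr {X Y : VField N M} {y : M} (hy : y ∈ (chartAt 𝔼 x₀).source)
    (h : ∀ᶠ y' in 𝓝 y, X y' = Y y') :
    rep x₀ X =ᶠ[𝓝 (chartAt 𝔼 x₀ y)] rep x₀ Y := by
  have h1 : Tendsto (chartAt 𝔼 x₀).symm (𝓝 (chartAt 𝔼 x₀ y)) (𝓝 y) := by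
    have := (chartAt 𝔼 x₀).continuousAt_symm ((chartAt 𝔼 x₀).map_source hy)
    rwa [ContinuousAt, (chartAt 𝔼 x₀).left_inv hy] at this
  filter_upwards [h1.eventually h] with z hz
  rw [rep, rep, hz]

lemma contMDiffAt_cfield (v : 𝔼) {y : M} (hy : y ∈ (chartAt 𝔼 x₀).source) :
    ContMDiffAt (𝓡 N) ((𝓡 N).prod 𝓘(ℝ, 𝔼)) ∞
      (fun x ↦ TotalSpace.mk' 𝔼 x (cfield x₀ v x)) y := by
  rw [contMDiffAt_iff_rep x₀ hy]
  refine (contDiffAt_const (c := v)).congr_of_eventuallyEq ?_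
  filter_upwards [(chartAt 𝔼 x₀).open_target.mem_nhds ((chartAt 𝔼 x₀).map_source hy)] with z hz
  exact rep_cfield x₀ v hz

lemma diffFieldAt_cfield (v : 𝔼) {y : M} (hy : y ∈ (chartAt 𝔼 x₀).source) :
    DiffFieldAt (cfield x₀ v) y :=
  (contMDiffAt_cfield x₀ v hy).mdifferentiableAt (by simp)

/-- Coordinate vector fields commute. -/
lemma mlieBracket_cfield (v w : 𝔼) {y : M} (hy : y ∈ (chartAt 𝔼 x₀).source) :
    VectorField.mlieBracket (𝓡 N) (cfield x₀ v) (cfield x₀ w) y = 0 := by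
  have : IsManifold (𝓡 N) (minSmoothness ℝ 2) M := by
    simp only [minSmoothness_of_isRCLikeNormedField]
    exact IsManifold.of_le (n := ∞) ENat.LEInfty.out
  let c (v : 𝔼) : VField N 𝔼 := fun _ ↦ v
  have hc (v : 𝔼) (z : 𝔼) : MDifferentiableAt (𝓡 N) ((𝓡 N).prod 𝓘(ℝ, 𝔼))
      (fun x ↦ TotalSpace.mk' 𝔼 x (c v x)) z := by
    rw [(trivializationAt 𝔼 (TangentSpace (𝓡 N)) z).mdifferentiableAt_section_iff
      (𝓡 N) _ (by simp)]
    simpa [c] using mdifferentiableAt_const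
  -- Coordinate fields are pullbacks of constant fields under the chart, and pullback respects
  -- brackets.
  have key (v : 𝔼) : cfield x₀ v =ᶠ[𝓝 y]
      VectorField.mpullback (𝓡 N) (𝓡 N) (chartAt 𝔼 x₀) (c v) := by
    filter_upwards [(chartAt 𝔼 x₀).open_source.mem_nhds hy] with y' hy'
    rw [VectorField.mpullback_apply, ← tcoord_eq_mfderiv x₀ hy']
    have : (tcoord x₀ y').inverse = tvec x₀ y' :=
      ContinuousLinearMap.inverse_eq (ContinuousLinearMap.ext fun v ↦ tcoord_tvec x₀ hy' v)
        (ContinuousLinearMap.ext fun v ↦ tvec_tcoord x₀ hy' v)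
    exact (DFunLike.congr_fun this v).symm
  rw [(key v).mlieBracket_vectorField_eq (key w),
    ← VectorField.mpullback_mlieBracket (n := ∞)]
  · rw [VectorField.mpullback_apply, ← VectorField.mlieBracketWithin_univ,
      VectorField.mlieBracketWithin_eq_lieBracketWithin]
    have h0 (v w : 𝔼) (z : 𝔼) : VectorField.lieBracketWithin ℝ (fun _ : 𝔼 ↦ v) (fun _ ↦ w)
        univ z = 0 := by
      simp [VectorField.lieBracketWithin]
    exact (congrArg _ (h0 v w _)).trans (map_zero _)
  · exact hc v _
  · exact hc w _
  · exact contMDiffAt_of_mem_maximalAtlas (IsManifold.chart_mem_maximalAtlas x₀) hy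
  · simp only [minSmoothness_of_isRCLikeNormedField]
    exact ENat.LEInfty.out


/-- Additivity of a covariant derivative holds only for differentiable fields, so the induction has
to carry the differentiability of the partial sums along with the formula. -/
lemma IsCovariantDerivativeOn_sum {nabla : ConnOp N M} {U : Set M}
    (h : IsCovariantDerivativeOn 𝔼 nabla U) {ι : Type*} (s : Finset ι) (g : ι → M → ℝ)
    (X : ι → VField N M) {y : M} (hy : y ∈ U)
    (hg : ∀ l ∈ s, MDifferentiableAt (𝓡 N) 𝓘(ℝ, ℝ) (g l) y) (hX : ∀ l ∈ s, DiffFieldAt (X l) y) :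
    DiffFieldAt (∑ l ∈ s, g l • X l) y ∧ nabla (∑ l ∈ s, g l • X l) y =
      ∑ l ∈ s, (g l y • nabla (X l) y + (dForm (N := N) (g l) y).smulRight (X l y)) := by
  classical
  induction s using Finset.induction_on with
  | empty =>
    simp only [Finset.sum_empty]
    exact ⟨mdifferentiableAt_zeroSection .., h.zero hy⟩
  | insert a s ha ih =>
    obtain ⟨h1, h2⟩ := ih (fun l hl ↦ hg l (Finset.mem_insert_of_mem hl))
      (fun l hl ↦ hX l (Finset.mem_insert_of_mem hl))
    have hga := hg a (Finset.mem_insert_self a s)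
    have hXa := hX a (Finset.mem_insert_self a s)
    have h3 : DiffFieldAt (g a • X a) y := hga.smul_section hXa
    rw [Finset.sum_insert ha, Finset.sum_insert ha, ← h2]
    refine ⟨mdifferentiableAt_add_section h3 h1, (h.add h3 h1 hy).trans ?_⟩
    rw [h.leibniz hXa hga hy]
    rfl

/-- The Christoffel symbols of a connection in the chart at `x₀`: the coordinates of `∇_u v`
for constant fields `v`, `u` are `christoffel x₀ nabla z v u`. -/
def christoffel (nabla : ConnOp N M) (z : EuclideanSpace ℝ (Fin N)) :
    EuclideanSpace ℝ (Fin N) →L[ℝ] EuclideanSpace ℝ (Fin N) →L[ℝ] EuclideanSpace ℝ (Fin N) :=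
  ∑ l : Fin N, (EuclideanSpace.proj (𝕜 := ℝ) l).smulRight
    (tcoord x₀ ((chartAt (EuclideanSpace ℝ (Fin N)) x₀).symm z) ∘L
      nabla (cfield x₀ (EuclideanSpace.single l 1))
        ((chartAt (EuclideanSpace ℝ (Fin N)) x₀).symm z) ∘L
      tvec x₀ ((chartAt (EuclideanSpace ℝ (Fin N)) x₀).symm z))

lemma christoffel_apply (nabla : ConnOp N M) {y : M} (hy : y ∈ (chartAt 𝔼 x₀).source) (v u : 𝔼) :
    christoffel x₀ nabla (chartAt 𝔼 x₀ y) v u = ∑ l : Fin N, v l •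
      tcoord x₀ y (nabla (cfield x₀ (EuclideanSpace.single l 1)) y (tvec x₀ y u)) := by
  rw [christoffel, (chartAt 𝔼 x₀).left_inv hy]
  simp

lemma sum_smul_single (v : 𝔼) : ∑ l, v l • EuclideanSpace.single l (1 : ℝ) = v := by
  simpa using (EuclideanSpace.basisFun (Fin N) ℝ).sum_repr v

lemma vfield_eq_sum_cfield (X : VField N M) {y : M} (hy : y ∈ (chartAt 𝔼 x₀).source) :
    X y = (∑ l : Fin N, (fun y ↦ tcoord x₀ y (X y) l) •
      cfield x₀ (EuclideanSpace.single l (1 : ℝ)) : VField N M) y := by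
  rw [Finset.sum_apply]
  have : X y = tvec x₀ y (∑ l, (tcoord x₀ y (X y)) l • EuclideanSpace.single l (1 : ℝ)) := by
    rw [sum_smul_single, tvec_tcoord x₀ hy]
  conv_lhs => rw [this]
  simp only [map_sum, map_smul]
  rfl

/-- A connection in the chart at `x₀`. -/
lemma tcoord_nabla {nabla : ConnOp N M} {U : Set M} (hU : IsOpen U)
    (h : IsCovariantDerivativeOn 𝔼 nabla U) {X : VField N M} {y : M} (hyU : y ∈ U)
    (hy : y ∈ (chartAt 𝔼 x₀).source) (hX : DiffFieldAt X y) (u : TangentSpace (𝓡 N) y) :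
    tcoord x₀ y (nabla X y u) =
      fderiv ℝ (rep x₀ X) (chartAt 𝔼 x₀ y) (tcoord x₀ y u) +
        christoffel x₀ nabla (chartAt 𝔼 x₀ y) (tcoord x₀ y (X y)) (tcoord x₀ y u) := by
  set g : Fin N → M → ℝ := fun l y ↦ tcoord x₀ y (X y) l with hg
  have hrep := (diffFieldAt_iff_rep x₀ hy).1 hX
  have hgd (l : Fin N) : MDifferentiableAt (𝓡 N) 𝓘(ℝ, ℝ) (g l) y := by
    rw [mdifferentiableAt_iff_chart x₀ hy]
    exact (EuclideanSpace.proj (𝕜 := ℝ) l).differentiableAt.comp _ hrep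
  have hdg (l : Fin N) : dForm (N := N) (g l) y u =
      (fderiv ℝ (rep x₀ X) (chartAt 𝔼 x₀ y) (tcoord x₀ y u)) l := by
    rw [dForm_apply x₀ hy (hgd l)]
    have : g l ∘ (chartAt 𝔼 x₀).symm = (EuclideanSpace.proj (𝕜 := ℝ) l) ∘ rep x₀ X := rfl
    rw [this, ((EuclideanSpace.proj (𝕜 := ℝ) l).hasFDerivAt.comp _ hrep.hasFDerivAt).fderiv]
    rfl
  obtain ⟨h1, h2⟩ := IsCovariantDerivativeOn_sum h Finset.univ g
    (fun l ↦ cfield x₀ (EuclideanSpace.single l (1 : ℝ))) hyU (fun l _ ↦ hgd l)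
    (fun l _ ↦ diffFieldAt_cfield x₀ _ hy)
  -- `X` agrees with its coordinate expansion only on the chart domain; the covariant derivative
  -- depends only on the germ.
  have h3 := h.congr_of_eventuallyEq hX h1 (hU.mem_nhds hyU) (by
    filter_upwards [(chartAt 𝔼 x₀).open_source.mem_nhds hy] with y' hy'
    exact vfield_eq_sum_cfield x₀ X hy')
  rw [h3, h2]
  simp only [FunLike.coe_sum, Finset.sum_apply, add_apply, map_sum, map_add,
    Finset.sum_add_distrib, smul_apply, map_smul,
    ContinuousLinearMap.smulRight_apply, hdg, christoffel_apply x₀ nabla hy, tvec_tcoord x₀ hy]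
  rw [add_comm]
  congr 1
  conv_rhs => rw [← sum_smul_single (fderiv ℝ (rep x₀ X) (chartAt 𝔼 x₀ y) (tcoord x₀ y u))]
  exact Finset.sum_congr rfl fun l _ ↦ by rw [cfield, tcoord_tvec x₀ hy]

/-- Coordinate fields commute, so vanishing torsion on them is symmetry of the Christoffel symbol.
-/
lemma christoffel_symm {nabla : ConnOp N M} {U : Set M} (hU : IsOpen U)
    (h : IsTorsionFreeConnOn nabla U) {y : M} (hyU : y ∈ U)
    (hy : y ∈ (chartAt 𝔼 x₀).source) (v w : 𝔼) :
    christoffel x₀ nabla (chartAt 𝔼 x₀ y) v w = christoffel x₀ nabla (chartAt 𝔼 x₀ y) w v := by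
  have h1 := h.torsionFree (cfield x₀ v) (cfield x₀ w) y hyU (diffFieldAt_cfield x₀ v hy)
    (diffFieldAt_cfield x₀ w hy)
  rw [mlieBracket_cfield x₀ v w hy] at h1
  have h2 := congrArg (tcoord x₀ y) h1
  have h3 (v : 𝔼) : fderiv ℝ (rep x₀ (cfield x₀ v)) (chartAt 𝔼 x₀ y) = 0 := by
    have : rep x₀ (cfield x₀ v) =ᶠ[𝓝 (chartAt 𝔼 x₀ y)] fun _ ↦ v := by
      filter_upwards [(chartAt 𝔼 x₀).open_target.mem_nhds ((chartAt 𝔼 x₀).map_source hy)] with z hz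
      exact rep_cfield x₀ v hz
    rw [this.fderiv_eq]; simp
  rw [map_sub, tcoord_nabla x₀ hU h.isCov hyU hy (diffFieldAt_cfield x₀ v hy),
    tcoord_nabla x₀ hU h.isCov hyU hy (diffFieldAt_cfield x₀ w hy), h3, h3] at h2
  simp only [cfield, tcoord_tvec x₀ hy, zero_apply, zero_add, map_zero] at h2
  exact (sub_eq_zero.1 h2).symm

/-- The Lie bracket in the chart at `x₀`. -/
lemma tcoord_mlieBracket {X Y : VField N M} {nabla : ConnOp N M} {U : Set M} (hU : IsOpen U)
    (h : IsTorsionFreeConnOn nabla U) {y : M} (hyU : y ∈ U) (hy : y ∈ (chartAt 𝔼 x₀).source)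
    (hX : DiffFieldAt X y) (hY : DiffFieldAt Y y) :
    tcoord x₀ y (VectorField.mlieBracket (𝓡 N) X Y y) =
      fderiv ℝ (rep x₀ Y) (chartAt 𝔼 x₀ y) (rep x₀ X (chartAt 𝔼 x₀ y)) -
      fderiv ℝ (rep x₀ X) (chartAt 𝔼 x₀ y) (rep x₀ Y (chartAt 𝔼 x₀ y)) := by
  -- Any torsion-free connection computes the bracket, and its Christoffel terms cancel by symmetry.
  rw [← h.torsionFree X Y y hyU hX hY, map_sub, tcoord_nabla x₀ hU h.isCov hyU hy hX,
    tcoord_nabla x₀ hU h.isCov hyU hy hY, rep_chart x₀ hy, rep_chart x₀ hy,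
    christoffel_symm x₀ hU h hyU hy]
  abel

lemma contDiffAt_clm_apply {E₁ E₂ E₃ : Type*} [NormedAddCommGroup E₁] [NormedSpace ℝ E₁]
    [NormedAddCommGroup E₂] [NormedSpace ℝ E₂] [NormedAddCommGroup E₃] [NormedSpace ℝ E₃]
    [FiniteDimensional ℝ E₂] {f : E₁ → E₂ →L[ℝ] E₃} {z : E₁} {n : ℕ∞ω} :
    ContDiffAt ℝ n f z ↔ ∀ v, ContDiffAt ℝ n (fun x ↦ f x v) z := by
  refine ⟨fun h v ↦ h.clm_apply contDiffAt_const, fun h ↦ ?_⟩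
  let d := Module.finrank ℝ E₂
  have hd : d = Module.finrank ℝ (Fin d → ℝ) := (Module.finrank_fin_fun ℝ).symm
  let e₁ := ContinuousLinearEquiv.ofFinrankEq hd
  let e₂ := (e₁.arrowCongr (1 : E₃ ≃L[ℝ] E₃)).trans (ContinuousLinearEquiv.piRing (Fin d))
  rw [← Function.id_comp f, ← e₂.symm_comp_self]
  exact e₂.symm.contDiff.contDiffAt.comp z (contDiffAt_pi.mpr fun i ↦ h _)

/-! ### Bump functions -/

section Cutoff

variable [T2Space M]

/-- A smooth function supported in the chart at `x₀` that is `1` near `x₀`. -/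
def cutoff : M → ℝ := (Classical.arbitrary (SmoothBumpFunction (𝓡 N) x₀) :)

/-- An open neighbourhood of `x₀` in the chart domain on which `cutoff x₀ = 1`. -/
def coreNhd : Set M :=
  interior {y | cutoff (N := N) x₀ y = 1} ∩ (chartAt (EuclideanSpace ℝ (Fin N)) x₀).source

lemma isOpen_coreNhd : IsOpen (coreNhd (N := N) x₀) :=
  isOpen_interior.inter (chartAt 𝔼 x₀).open_source

lemma mem_coreNhd : x₀ ∈ coreNhd (N := N) x₀ :=
  ⟨mem_interior_iff_mem_nhds.2 (Classical.arbitrary (SmoothBumpFunction (𝓡 N) x₀)).eventuallyEq_one,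
    mem_chart_source _ x₀⟩

lemma coreNhd_subset : coreNhd (N := N) x₀ ⊆ (chartAt 𝔼 x₀).source := inter_subset_right

lemma cutoff_eventually {y : M} (hy : y ∈ coreNhd (N := N) x₀) :
    ∀ᶠ y' in 𝓝 y, cutoff (N := N) x₀ y' = 1 := by
  filter_upwards [(isOpen_coreNhd x₀).mem_nhds hy] with y' hy'
  exact (interior_subset hy'.1 : y' ∈ {y | cutoff (N := N) x₀ y = 1})

lemma contMDiff_cutoff : ContMDiff (𝓡 N) 𝓘(ℝ, ℝ) ∞ (cutoff (N := N) x₀) :=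
  (Classical.arbitrary (SmoothBumpFunction (𝓡 N) x₀)).contMDiff

lemma smoothFieldOn_cutoff_smul {X : VField N M}
    (hX : ∀ y ∈ (chartAt 𝔼 x₀).source, ContMDiffAt (𝓡 N) ((𝓡 N).prod 𝓘(ℝ, 𝔼)) ∞
      (fun x ↦ TotalSpace.mk' 𝔼 x (X x)) y) :
    SmoothFieldOn (cutoff (N := N) x₀ • X) univ := by
  rw [smoothFieldOn_iff isOpen_univ]
  intro y _
  by_cases hy : y ∈ tsupport (cutoff (N := N) x₀)
  · have hy' : y ∈ (chartAt 𝔼 x₀).source :=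
      (Classical.arbitrary (SmoothBumpFunction (𝓡 N) x₀)).tsupport_subset_chartAt_source hy
    exact ((contMDiff_cutoff x₀).contMDiffAt (x := y)).smul_section (hX y hy')
  · have h0 : ContMDiffAt (𝓡 N) ((𝓡 N).prod 𝓘(ℝ, 𝔼)) ∞
        (fun x ↦ TotalSpace.mk' 𝔼 x ((0 : VField N M) x)) y :=
      contMDiff_zeroSection ℝ (TangentSpace (𝓡 N) (M := M)) y
    refine h0.congr_of_eventuallyEq ?_
    filter_upwards [(isClosed_tsupport (cutoff (N := N) x₀)).isOpen_compl.mem_nhds hy] with y' hy'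
    have : cutoff (N := N) x₀ y' = 0 := image_eq_zero_of_notMem_tsupport hy'
    simp [this]

/-- Smoothness of a connection, and smoothness and parallelism of a section of `End 𝒯`, are tested
only on fields smooth on the whole given set. The cut-off makes coordinate fields admissible, and on
`coreNhd` nothing is changed by it. -/
lemma smoothFieldOn_cutoff_cfield (v : 𝔼) :
    SmoothFieldOn (cutoff (N := N) x₀ • cfield x₀ v) univ :=
  smoothFieldOn_cutoff_smul x₀ fun _ hy ↦ contMDiffAt_cfield x₀ v hy

lemma cutoff_smul_eventually (X : VField N M) {y : M} (hy : y ∈ coreNhd (N := N) x₀) :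
    ∀ᶠ y' in 𝓝 y, (cutoff (N := N) x₀ • X) y' = X y' := by
  filter_upwards [cutoff_eventually x₀ hy] with y' hy'
  simp [hy']

lemma nabla_cutoff_cfield {nabla : ConnOp N M} {U : Set M} (hU : IsOpen U)
    (h : IsCovariantDerivativeOn 𝔼 nabla U) (v : 𝔼) {y : M} (hyU : y ∈ U)
    (hy : y ∈ coreNhd (N := N) x₀) :
    nabla (cutoff (N := N) x₀ • cfield x₀ v) y = nabla (cfield x₀ v) y :=
  h.congr_of_eventuallyEq ((smoothFieldOn_cutoff_cfield x₀ v).diffFieldAt isOpen_univ (mem_univ y))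
    (diffFieldAt_cfield x₀ v (coreNhd_subset x₀ hy)) (hU.mem_nhds hyU)
    (cutoff_smul_eventually x₀ _ hy)

lemma IsTorsionFreeConnOn.contMDiffAt_nabla {nabla : ConnOp N M} {U : Set M} (hU : IsOpen U)
    (h : IsTorsionFreeConnOn nabla U) {X Y : VField N M} (hX : SmoothFieldOn X U) {y : M}
    (hyU : y ∈ U) (hY : ContMDiffAt (𝓡 N) ((𝓡 N).prod 𝓘(ℝ, 𝔼)) ∞
      (fun x ↦ TotalSpace.mk' 𝔼 x (Y x)) y) :
    ContMDiffAt (𝓡 N) ((𝓡 N).prod 𝓘(ℝ, 𝔼)) ∞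
      (fun x ↦ TotalSpace.mk' 𝔼 x (nabla X x (Y x))) y :=
  ((h.smooth.contMDiff hX).contMDiffAt (hU.mem_nhds hyU)).clm_bundle_apply hY

lemma contDiffAt_christoffel {nabla : ConnOp N M} {U : Set M} (hU : IsOpen U)
    (h : IsTorsionFreeConnOn nabla U) {y : M} (hyU : y ∈ U) (hy : y ∈ coreNhd (N := N) x₀) :
    ContDiffAt ℝ ∞ (christoffel x₀ nabla) (chartAt 𝔼 x₀ y) := by
  have hyS := coreNhd_subset x₀ hy
  unfold christoffel
  refine ContDiffAt.sum fun l _ ↦ ContDiffAt.smulRight contDiffAt_const ?_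
  rw [contDiffAt_clm_apply]
  intro u
  have h1 := h.contMDiffAt_nabla hU
    (X := cutoff (N := N) x₀ • cfield x₀ (EuclideanSpace.single l 1))
    ((smoothFieldOn_cutoff_cfield x₀ _).mono (subset_univ U)) hyU (contMDiffAt_cfield x₀ u hyS)
  rw [contMDiffAt_iff_rep x₀ hyS] at h1
  refine h1.congr_of_eventuallyEq (rep_congr x₀ hyS
    (X := fun x ↦ nabla (cfield x₀ (EuclideanSpace.single l 1)) x (cfield x₀ u x)) ?_)
  filter_upwards [hU.mem_nhds hyU, (isOpen_coreNhd x₀).mem_nhds hy] with y' hy1 hy2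
  rw [nabla_cutoff_cfield x₀ hU h.isCov _ hy1 hy2]

/-- A field of endomorphisms is smooth if its coordinates are. -/
lemma contMDiffAt_hom {L : (x : M) → TangentSpace (𝓡 N) x →L[ℝ] TangentSpace (𝓡 N) x}
    (h : ∀ u : 𝔼, ContDiffAt ℝ ∞ (rep x₀ fun y ↦ L y (cfield x₀ u y)) (chartAt 𝔼 x₀ x₀)) :
    ContMDiffAt (𝓡 N) ((𝓡 N).prod 𝓘(ℝ, 𝔼 →L[ℝ] 𝔼)) ∞
      (fun x ↦ TotalSpace.mk' (𝔼 →L[ℝ] 𝔼)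
        (E := fun x : M ↦ TangentSpace (𝓡 N) x →L[ℝ] TangentSpace (𝓡 N) x) x (L x)) x₀ := by
  rw [contMDiffAt_hom_bundle]
  refine ⟨contMDiffAt_id, ?_⟩
  rw [contMDiffAt_iff_chart x₀ (mem_chart_source _ x₀), contDiffAt_clm_apply]
  exact h

end Cutoff

end Coordinates

/-! ### Smoothness of post-composition on spaces of continuous curves -/

section PostComp

universe u

variable {K : Type*} [TopologicalSpace K] [CompactSpace K]

/-- Pointwise application of a continuous field of linear maps to continuous functions. -/
def pointwiseApply (K : Type*) [TopologicalSpace K] [CompactSpace K] (F G : Type*)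
    [NormedAddCommGroup F] [NormedSpace ℝ F] [NormedAddCommGroup G] [NormedSpace ℝ G] :
    C(K, F →L[ℝ] G) →L[ℝ] C(K, F) →L[ℝ] C(K, G) :=
  LinearMap.mkContinuous₂
    (LinearMap.mk₂ ℝ (fun (A : C(K, F →L[ℝ] G)) (γ : C(K, F)) ↦
      (⟨fun t ↦ A t (γ t), by fun_prop⟩ : C(K, G)))
      (fun _ _ _ ↦ by ext; simp) (fun _ _ _ ↦ by ext; simp)
      (fun _ _ _ ↦ by ext; simp) (fun _ _ _ ↦ by ext; simp)) 1
    (fun A γ ↦ by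
      rw [ContinuousMap.norm_le _ (by positivity)]
      intro t
      rw [one_mul]
      exact ((A t).le_opNorm _).trans (mul_le_mul (A.norm_coe_le_norm t) (γ.norm_coe_le_norm t)
        (norm_nonneg _) (norm_nonneg A)))

variable {F G : Type u} [NormedAddCommGroup F] [NormedSpace ℝ F]
  [NormedAddCommGroup G] [NormedSpace ℝ G]

@[simp] lemma pointwiseApply_apply (A : C(K, F →L[ℝ] G)) (γ : C(K, F)) (t : K) :
    pointwiseApply K F G A γ t = A t (γ t) := rfl

/-- The derivative of post-composition with a `C^1` map. -/
lemma hasFDerivAt_postcomp (f : C(F, G)) (f' : C(F, F →L[ℝ] G))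
    (hf : ∀ x, HasFDerivAt f (f' x) x) (γ : C(K, F)) :
    HasFDerivAt (fun γ : C(K, F) ↦ f.comp γ) (pointwiseApply K F G (f'.comp γ)) γ := by
  rw [hasFDerivAt_iff_isLittleO_nhds_zero, Asymptotics.isLittleO_iff]
  intro c hc
  -- Post-composition with `f'` is continuous in the sup norm, so `f'` varies by at most `c`
  -- simultaneously at all points of `K`. The mean value inequality on each segment from `γ t` to `γ
  -- t + h t` is then uniform in `t`.
  have h1 : Filter.Tendsto (fun h : C(K, F) ↦ f'.comp (γ + h)) (𝓝 0) (𝓝 (f'.comp γ)) := by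
    have : Continuous fun h : C(K, F) ↦ f'.comp (γ + h) :=
      (ContinuousMap.continuous_postcomp f').comp (by fun_prop)
    simpa using this.tendsto 0
  obtain ⟨δ, hδ, h2⟩ := Metric.eventually_nhds_iff.1
    (h1.eventually_mem (Metric.closedBall_mem_nhds (f'.comp γ) hc))
  filter_upwards [Metric.ball_mem_nhds (0 : C(K, F)) hδ] with h hh
  rw [ContinuousMap.norm_le _ (by positivity)]
  intro t
  have key := (convex_segment (𝕜 := ℝ) (γ t) (γ t + h t)).norm_image_sub_le_of_norm_hasFDerivWithin_le'
    (f := f) (f' := f') (φ := f' (γ t)) (C := c) (x := γ t) (y := γ t + h t)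
    (fun x _ ↦ (hf x).hasFDerivWithinAt) ?_ (left_mem_segment ..) (right_mem_segment ..)
  · rw [add_sub_cancel_left] at key
    exact key.trans (by gcongr; exact h.norm_coe_le_norm t)
  · intro x hx
    rw [segment_eq_image'] at hx
    obtain ⟨s, ⟨hs0, hs1⟩, rfl⟩ := hx
    have h3 : dist (s • h) 0 < δ := by
      rw [dist_zero_right, norm_smul, Real.norm_of_nonneg hs0]
      have : ‖h‖ < δ := by simpa using hh
      exact (mul_le_of_le_one_left (norm_nonneg h) hs1).trans_lt this
    have h4 := h2 h3
    have := (ContinuousMap.dist_apply_le_dist t).trans (Metric.mem_closedBall.1 h4)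
    rw [dist_eq_norm] at this
    simpa using this

/-- The derivative of post-composition with `f` is post-composition with `fderiv ℝ f`, followed by a
bounded linear map, so regularity rises one order at a time. The induction replaces `G` by `F →L[ℝ]
G`, hence the quantifier over `G` and the common universe. -/
lemma contDiff_postcomp_nat (n : ℕ) : ∀ {G : Type u} [NormedAddCommGroup G] [NormedSpace ℝ G]
    (f : C(F, G)), ContDiff ℝ n f → ContDiff ℝ n (fun γ : C(K, F) ↦ f.comp γ) := by
  induction n with
  | zero =>
    intro G _ _ f _
    exact contDiff_zero.2 (ContinuousMap.continuous_postcomp f)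
  | succ n ih =>
    intro G _ _ f hf
    have hf' : ContDiff ℝ n (fderiv ℝ f) :=
      ((contDiff_succ_iff_fderiv (n := (n : ℕ∞ω))).1 (mod_cast hf)).2.2
    let f' : C(F, F →L[ℝ] G) := ⟨fderiv ℝ f, hf'.continuous⟩
    have hd (γ : C(K, F)) := hasFDerivAt_postcomp (K := K) f f'
      (fun x ↦ (hf.differentiable (by simp) x).hasFDerivAt) γ
    have : ContDiff ℝ ((n : ℕ∞ω) + 1) (fun γ : C(K, F) ↦ f.comp γ) := by
      refine contDiff_succ_iff_fderiv.2 ⟨fun γ ↦ (hd γ).differentiableAt, by simp, ?_⟩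
      have h2 : fderiv ℝ (fun γ : C(K, F) ↦ f.comp γ) =
          fun γ ↦ pointwiseApply K F G (f'.comp γ) := funext fun γ ↦ (hd γ).fderiv
      rw [h2]
      exact (pointwiseApply K F G).contDiff.comp (ih f' hf')
    exact_mod_cast this

/-- Post-composition with a smooth map is smooth. -/
lemma contDiff_postcomp (f : C(F, G)) (hf : ContDiff ℝ ∞ f) :
    ContDiff ℝ ∞ (fun γ : C(K, F) ↦ f.comp γ) := by
  rw [contDiff_infty] at hf ⊢
  exact fun n ↦ contDiff_postcomp_nat n f (hf n)

end PostComp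

/-! ### Integration as a bounded operator on curves -/

section Primitive

variable {F : Type*} [NormedAddCommGroup F] [NormedSpace ℝ F]

local notation "𝕀" => Set.Icc (0 : ℝ) 1

/-- A continuous curve on `[0, 1]`, extended to the real line by constants. -/
def extCurve (γ : C(Set.Icc (0 : ℝ) 1, F)) : ℝ → F := Set.IccExtend zero_le_one γ

lemma continuous_extCurve (γ : C(𝕀, F)) : Continuous (extCurve γ) := γ.continuous.Icc_extend'

lemma extCurve_of_mem (γ : C(𝕀, F)) {t : ℝ} (ht : t ∈ 𝕀) : extCurve γ t = γ ⟨t, ht⟩ :=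
  Set.IccExtend_of_mem _ _ ht

variable [CompleteSpace F]

/-- Integration of continuous curves from `0`. -/
def primitive (F : Type*) [NormedAddCommGroup F] [NormedSpace ℝ F] [CompleteSpace F] :
    C(Set.Icc (0 : ℝ) 1, F) →L[ℝ] C(Set.Icc (0 : ℝ) 1, F) :=
  LinearMap.mkContinuous
    { toFun := fun γ ↦ ⟨fun t ↦ ∫ s in (0 : ℝ)..t, extCurve γ s, by
        have : Continuous fun t : ℝ ↦ ∫ s in (0 : ℝ)..t, extCurve γ s :=
          intervalIntegral.continuous_primitive
            (fun a b ↦ (continuous_extCurve γ).intervalIntegrable a b) 0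
        exact this.comp continuous_subtype_val⟩
      map_add' := fun γ γ' ↦ by
        ext t
        exact intervalIntegral.integral_add ((continuous_extCurve γ).intervalIntegrable _ _)
          ((continuous_extCurve γ').intervalIntegrable _ _)
      map_smul' := fun c γ ↦ by
        ext t
        exact intervalIntegral.integral_smul c _ } 1
    (fun γ ↦ by
      rw [ContinuousMap.norm_le _ (by positivity)]
      intro t
      have := intervalIntegral.norm_integral_le_of_norm_le_const (a := 0) (b := (t : ℝ))
        (f := extCurve γ) (C := ‖γ‖) (fun s _ ↦ γ.norm_coe_le_norm _)
      refine this.trans ?_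
      rw [sub_zero, abs_of_nonneg t.2.1, one_mul]
      exact mul_le_of_le_one_right (norm_nonneg _) t.2.2)

lemma primitive_apply (γ : C(𝕀, F)) (t : 𝕀) :
    primitive F γ t = ∫ s in (0 : ℝ)..t, extCurve γ s := rfl

/-- The fundamental theorem of calculus for `primitive`. -/
lemma eq_primitive_of_hasDerivAt {γ : C(𝕀, F)} {g : ℝ → F} (t : 𝕀)
    (hg : ∀ s (hs : s ∈ 𝕀), HasDerivAt g (γ ⟨s, hs⟩) s) :
    primitive F γ t = g t - g 0 := by
  rw [primitive_apply]
  refine intervalIntegral.integral_eq_sub_of_hasDerivAt (fun s hs ↦ ?_)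
    ((continuous_extCurve γ).intervalIntegrable _ _)
  rw [Set.uIcc_of_le t.2.1] at hs
  have hs' : s ∈ 𝕀 := ⟨hs.1, hs.2.trans t.2.2⟩
  rw [extCurve_of_mem γ hs']
  exact hg s hs'

end Primitive

/-! ### Implicit functions that are smooth on a neighbourhood -/

section Implicit

variable {E₁ E₂ F : Type*} [NormedAddCommGroup E₁] [NormedSpace ℝ E₁] [CompleteSpace E₁]
  [NormedAddCommGroup E₂] [NormedSpace ℝ E₂] [CompleteSpace E₂]
  [NormedAddCommGroup F] [NormedSpace ℝ F] [CompleteSpace F]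

/-- The implicit function of a smooth equation is smooth in a neighbourhood. -/
lemma exists_smooth_implicit {f : E₁ × E₂ → F} (hf : ContDiff ℝ ∞ f) (u : E₁ × E₂)
    (hu : (fderiv ℝ f u ∘L .inr ℝ E₁ E₂).IsInvertible) :
    ∃ ψ : E₁ → E₂, ψ u.1 = u.2 ∧ (∀ᶠ x in 𝓝 u.1, ContDiffAt ℝ ∞ ψ x ∧ f (x, ψ x) = f u ∧
        (fderiv ℝ f (x, ψ x) ∘L .inr ℝ E₁ E₂).IsInvertible) ∧
      ∀ᶠ v in 𝓝 u, f v = f u ↔ ψ v.1 = v.2 := by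
  have h0 : (∞ : ℕ∞ω) ≠ 0 := by simp
  have hcd := hf.contDiffAt (x := u)
  refine ⟨hcd.implicitFunction h0 hu, hcd.implicitFunction_apply_self h0 hu, ?_,
    hcd.eventually_apply_eq_iff_implicitFunction h0 hu⟩
  set ψ := hcd.implicitFunction h0 hu with hψ
  have hψu : ψ u.1 = u.2 := hcd.implicitFunction_apply_self h0 hu
  have hψs : ContDiffAt ℝ 1 ψ u.1 := (hcd.contDiffAt_implicitFunction h0 hu).of_le
    ENat.LEInfty.out
  have hev := hcd.eventually_apply_implicitFunction h0 hu
  have hinv : ∀ᶠ x in 𝓝 u.1, (fderiv ℝ f (x, ψ x) ∘L .inr ℝ E₁ E₂).IsInvertible := by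
    obtain ⟨e, he⟩ := hu
    have hc : ContinuousAt (fun x ↦ fderiv ℝ f (x, ψ x) ∘L .inr ℝ E₁ E₂) u.1 := by
      have h1 : Continuous (fderiv ℝ f) := hf.continuous_fderiv h0
      have h2 : ContinuousAt (fun x ↦ (x, ψ x)) u.1 := continuousAt_id.prodMk hψs.continuousAt
      exact (h1.continuousAt.comp h2).clm_comp continuousAt_const
    have h3 := hc.eventually (p := fun L ↦ L.IsInvertible) (by
      beta_reduce
      rw [hψu, ← he]
      exact e.nhds)
    exact h3
  filter_upwards [(hψs.eventually (by simp)), hev.eventually_nhds, hinv] with x h1 h2 h3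
  refine ⟨?_, h2.self_of_nhds, h3⟩
  -- Being `C^∞` at the single point `u.1` allows neighbourhoods that shrink with the order. The
  -- theorem is therefore applied anew at each nearby `(x, ψ x)`, and local uniqueness identifies
  -- the new implicit function with `ψ`.
  have hcx := hf.contDiffAt (x := (x, ψ x))
  have h4 := hcx.eventually_apply_eq_iff_implicitFunction h0 h3
  have h5 : Filter.Tendsto (fun x ↦ (x, ψ x)) (𝓝 x) (𝓝 (x, ψ x)) :=
    continuousAt_id.prodMk h1.continuousAt
  refine (hcx.contDiffAt_implicitFunction h0 h3).congr_of_eventuallyEq ?_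
  filter_upwards [h5.eventually h4, h2] with x' h6 h7
  exact (h6.1 (by rw [h7, h2.self_of_nhds])).symm

end Implicit

/-! ### Flows of linear combinations of fields, and their tangency to the span -/

section Flow

universe u

variable {F : Type u} [NormedAddCommGroup F] [NormedSpace ℝ F] [CompleteSpace F]

local notation "𝕀" => Set.Icc (0 : ℝ) 1

/-- Constant curves. -/
def constCurve (F : Type u) [NormedAddCommGroup F] [NormedSpace ℝ F] :
    F →L[ℝ] C(Set.Icc (0 : ℝ) 1, F) :=
  LinearMap.mkContinuous
    { toFun := fun q ↦ ContinuousMap.const _ q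
      map_add' := fun _ _ ↦ rfl
      map_smul' := fun _ _ ↦ rfl } 1
    (fun q ↦ by
      rw [ContinuousMap.norm_le _ (by positivity), one_mul]
      exact fun _ ↦ le_rfl)

@[simp] lemma constCurve_apply (q : F) (t : 𝕀) : constCurve F q t = q := rfl

variable {r : ℕ}

/-- The integral equation for the integral curves, starting at `p.1.2`, of the linear combination of
the fields `η l` with coefficients `p.1.1 l`. -/
def flowEq (η : Fin r → C(F, F)) (p : ((Fin r → ℝ) × F) × C(Set.Icc (0 : ℝ) 1, F)) :
    C(Set.Icc (0 : ℝ) 1, F) :=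
  p.2 - constCurve F p.1.2 - primitive F (∑ l, p.1.1 l • (η l).comp p.2)

variable {η : Fin r → C(F, F)}

lemma contDiff_flowEq (hη : ∀ l, ContDiff ℝ ∞ (η l)) : ContDiff ℝ ∞ (flowEq η) := by
  unfold flowEq
  have h1 (l : Fin r) : ContDiff ℝ ∞ fun p : ((Fin r → ℝ) × F) × C(𝕀, F) ↦ (η l).comp p.2 :=
    (contDiff_postcomp (η l) (hη l)).comp contDiff_snd
  have h2 (l : Fin r) : ContDiff ℝ ∞ fun p : ((Fin r → ℝ) × F) × C(𝕀, F) ↦ p.1.1 l := by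
    fun_prop
  refine (contDiff_snd.sub ((constCurve F).contDiff.comp (by fun_prop))).sub
    ((primitive F).contDiff.comp (ContDiff.sum fun l _ ↦ (h2 l).smul (h1 l)))

lemma fderiv_flowEq {η' : Fin r → C(F, F →L[ℝ] F)} (hη : ∀ l x, HasFDerivAt (η l) (η' l x) x)
    (p v : ((Fin r → ℝ) × F) × C(𝕀, F)) :
    fderiv ℝ (flowEq η) p v = v.2 - constCurve F v.1.2 -
      primitive F (∑ l, (p.1.1 l • pointwiseApply 𝕀 F F ((η' l).comp p.2) v.2 +
        v.1.1 l • (η l).comp p.2)) := by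
  have h1 (l : Fin r) : HasFDerivAt (fun p : ((Fin r → ℝ) × F) × C(𝕀, F) ↦ (η l).comp p.2)
      (pointwiseApply 𝕀 F F ((η' l).comp p.2) ∘L ContinuousLinearMap.snd ℝ _ _) p :=
    (hasFDerivAt_postcomp (η l) (η' l) (hη l) p.2).comp p
      (hasFDerivAt_snd (𝕜 := ℝ) (E := (Fin r → ℝ) × F) (F := C(𝕀, F)) (p := p))
  have h2 (l : Fin r) : HasFDerivAt (fun p : ((Fin r → ℝ) × F) × C(𝕀, F) ↦ p.1.1 l)
      ((ContinuousLinearMap.proj (R := ℝ) (φ := fun _ : Fin r ↦ ℝ) l) ∘L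
        ContinuousLinearMap.fst ℝ _ _ ∘L ContinuousLinearMap.fst ℝ _ _) p :=
    ((ContinuousLinearMap.proj (R := ℝ) (φ := fun _ : Fin r ↦ ℝ) l) ∘L
        ContinuousLinearMap.fst ℝ (Fin r → ℝ) F ∘L
          ContinuousLinearMap.fst ℝ ((Fin r → ℝ) × F) C(𝕀, F)).hasFDerivAt
  have h3 : HasFDerivAt (flowEq η) _ p :=
    ((hasFDerivAt_snd (𝕜 := ℝ) (E := (Fin r → ℝ) × F) (F := C(𝕀, F)) (p := p)).sub
      ((constCurve F) ∘L ContinuousLinearMap.snd ℝ _ _ ∘L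
        ContinuousLinearMap.fst ℝ _ _).hasFDerivAt).sub
    ((primitive F).hasFDerivAt.comp p (HasFDerivAt.fun_sum fun l _ ↦ (h2 l).smul (h1 l)))
  rw [h3.fderiv]
  simp

/-- Smooth families of integral curves. -/
theorem exists_flow (hη : ∀ l, ContDiff ℝ ∞ (η l)) {η' : Fin r → C(F, F →L[ℝ] F)}
    (hη' : ∀ l x, HasFDerivAt (η l) (η' l x) x) (q₀ : F) {Ω : Set F} (hΩ : IsOpen Ω)
    (hq₀ : q₀ ∈ Ω) :
    ∃ ψ : (Fin r → ℝ) × F → C(𝕀, F), ∀ᶠ p in 𝓝 ((0 : Fin r → ℝ), q₀),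
      ContDiffAt ℝ ∞ ψ p ∧ (p.1 = 0 → ψ p = constCurve F p.2) ∧ (∀ t, ψ p t ∈ Ω) ∧
      ψ p = constCurve F p.2 + primitive F (∑ l, p.1 l • (η l).comp (ψ p)) ∧
      ∀ (v : (Fin r → ℝ) × F) (V : C(𝕀, F)), V = constCurve F v.2 +
        primitive F (∑ l, (p.1 l • pointwiseApply 𝕀 F F ((η' l).comp (ψ p)) V +
          v.1 l • (η l).comp (ψ p))) → fderiv ℝ ψ p v = V := by
  set u : ((Fin r → ℝ) × F) × C(𝕀, F) := ((0, q₀), constCurve F q₀) with hu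
  have hcd := contDiff_flowEq hη
  have hu0 (q : F) : flowEq η ((0, q), constCurve F q) = 0 := by simp [flowEq]
  -- For zero coefficients the integral term vanishes, so the partial derivative in the direction of
  -- the curve is the identity.
  have hinv : (fderiv ℝ (flowEq η) u ∘L .inr ℝ _ _).IsInvertible := by
    refine ⟨ContinuousLinearEquiv.refl ℝ _, ?_⟩
    ext1 δ
    simp [fderiv_flowEq hη', hu]
  obtain ⟨ψ, h1, h2, h3⟩ := exists_smooth_implicit hcd u hinv
  have hc0 : ContinuousAt ψ ((0 : Fin r → ℝ), q₀) := h2.self_of_nhds.1.continuousAt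
  refine ⟨ψ, ?_⟩
  have h4 : ∀ᶠ p : (Fin r → ℝ) × F in 𝓝 (0, q₀), flowEq η (p, constCurve F p.2) = flowEq η u ↔
      ψ p = constCurve F p.2 := by
    have hc : ContinuousAt (fun p : (Fin r → ℝ) × F ↦ (p, constCurve F p.2)) (0, q₀) := by
      fun_prop
    exact hc.eventually h3
  have h5 : ∀ᶠ p : (Fin r → ℝ) × F in 𝓝 (0, q₀), ∀ t, ψ p t ∈ Ω := by
    have ho : IsOpen {γ : C(𝕀, F) | Set.MapsTo γ Set.univ Ω} :=
      ContinuousMap.isOpen_setOfPred_mapsTo isCompact_univ hΩ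
    have hm : ψ (0, q₀) ∈ {γ : C(𝕀, F) | Set.MapsTo γ Set.univ Ω} := by
      have : ψ (0, q₀) = constCurve F q₀ := h1
      rw [this]
      exact fun t _ ↦ hq₀
    filter_upwards [hc0.eventually_mem (ho.mem_nhds hm)] with p hp t
    exact hp (Set.mem_univ t)
  have h2' : ∀ᶠ p in 𝓝 ((0 : Fin r → ℝ), q₀), ContDiffAt ℝ ∞ ψ p ∧
    flowEq η (p, ψ p) = flowEq η u ∧
        (fderiv ℝ (flowEq η) (p, ψ p) ∘L .inr ℝ _ _).IsInvertible := h2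
  filter_upwards [h2'.eventually_nhds, h4, h5] with p h2 h4 h5
  obtain ⟨h6, h7, h8⟩ := h2.self_of_nhds
  refine ⟨h6, ?_, h5, ?_, ?_⟩
  · obtain ⟨a, q⟩ := p
    rintro ⟨rfl⟩
    exact h4.1 ((hu0 q).trans (hu0 q₀).symm)
  · rw [hu, hu0, flowEq] at h7
    rw [← sub_eq_zero, ← sub_sub]
    exact h7
  · intro v V hV
    have h9 : HasFDerivAt (fun p ↦ flowEq η (p, ψ p))
        (fderiv ℝ (flowEq η) (p, ψ p) ∘L
          (ContinuousLinearMap.id ℝ _).prod (fderiv ℝ ψ p)) p := by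
      have h10 := (h6.differentiableAt (by simp)).hasFDerivAt
      exact (hcd.differentiable (by simp) _).hasFDerivAt.comp p ((hasFDerivAt_id p).prodMk h10)
    have h11 : HasFDerivAt (fun p ↦ flowEq η (p, ψ p))
        (0 : (Fin r → ℝ) × F →L[ℝ] C(𝕀, F)) p := by
      refine (hasFDerivAt_const (flowEq η u) p).congr_of_eventuallyEq ?_
      filter_upwards [h2] with p' hp' using hp'.2.1
    have h12 := DFunLike.congr_fun (h9.unique h11) v
    have h13 : fderiv ℝ (flowEq η) (p, ψ p) (v, V) = 0 := by
      rw [fderiv_flowEq hη', sub_sub, sub_eq_zero]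
      exact hV
    -- Both `fderiv ℝ ψ p v` and `V` solve the linearised integral equation; the partial derivative
    -- along curves is invertible, so they coincide.
    have h14 : (fderiv ℝ (flowEq η) (p, ψ p) ∘L .inr ℝ ((Fin r → ℝ) × F) C(𝕀, F))
        (fderiv ℝ ψ p v - V) = 0 := by
      have : (ContinuousLinearMap.inr ℝ ((Fin r → ℝ) × F) C(𝕀, F)) (fderiv ℝ ψ p v - V) =
          (v, fderiv ℝ ψ p v) - (v, V) := by simp
      rw [ContinuousLinearMap.comp_apply, this, map_sub, h13, sub_zero]
      exact h12
    obtain ⟨e, he⟩ := h8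
    rw [← he] at h14
    exact sub_eq_zero.1 (e.map_eq_zero_iff.1 h14)

/-- Affine ordinary differential equations with constant coefficients have global solutions. -/
lemma exists_affine_ode {W : Type*} [NormedAddCommGroup W] [NormedSpace ℝ W] [CompleteSpace W]
    (B : W →L[ℝ] W) (e : W) :
    ∃ v : ℝ → W, v 0 = 0 ∧ ∀ t, HasDerivAt v (B (v t) + e) t := by
  -- An extra coordinate that stays equal to `1` makes the affine equation linear, and the
  -- exponential solves it.
  let A : W × ℝ →L[ℝ] W × ℝ :=
    (B ∘L ContinuousLinearMap.fst ℝ W ℝ + (ContinuousLinearMap.snd ℝ W ℝ).smulRight e).prod 0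
  let x : ℝ → W × ℝ := fun t ↦ NormedSpace.exp (t • A) (0, 1)
  have hx (t : ℝ) : HasDerivAt x (A (x t)) t := by
    have := hasDerivAt_exp_smul_const' (𝕂 := ℝ) A t
    exact this.clm_apply (hasDerivAt_const t ((0 : W), (1 : ℝ))) |>.congr_deriv (by simp [x])
  have hx0 : x 0 = (0, 1) := by simp [x]
  have h2 (t : ℝ) : HasDerivAt (fun t ↦ (x t).2) 0 t :=
    ((ContinuousLinearMap.snd ℝ W ℝ).hasFDerivAt.comp_hasDerivAt t (hx t)).congr_deriv
      (by simp [A])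
  have h3 (t : ℝ) : (x t).2 = 1 := by
    rw [is_const_of_deriv_eq_zero (fun t ↦ (h2 t).differentiableAt) (fun t ↦ (h2 t).deriv) t 0, hx0]
  refine ⟨fun t ↦ (x t).1, by simp [hx0], fun t ↦ ?_⟩
  exact ((ContinuousLinearMap.fst ℝ W ℝ).hasFDerivAt.comp_hasDerivAt t (hx t)).congr_deriv
      (by simp [A, h3])

/-- Here `y m` and `D m` stand for `η m` and its derivative at a point of an integral curve with
velocity `∑ a l • y l`. If `v' = w + e`, the left side is the derivative of `∑ v m • η m` along the
curve, and the right side is what the linearised equation demands. They differ by brackets of the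
fields, which the choice of `w` absorbs. -/
lemma tangent_identity (c : Fin r → Fin r → Fin r → ℝ) (a e v w : Fin r → ℝ)
    (hw : ∀ n, w n = -∑ m, (∑ l, a l * c l m n) * v m) (y : Fin r → F) (D : Fin r → F →L[ℝ] F)
    (hc : ∀ l m, D m (y l) - D l (y m) = ∑ n, c l m n • y n) :
    ∑ m, (v m • D m (∑ l, a l • y l) + (w + e) m • y m) =
      ∑ l, (a l • D l (∑ m, v m • y m) + e l • y l) := by
  have h1 : ∑ m, v m • D m (∑ l, a l • y l) = ∑ l, a l • D l (∑ m, v m • y m) +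
      ∑ m, ∑ l, ∑ n, (v m * a l * c l m n) • y n := by
    simp only [map_sum, map_smul, Finset.smul_sum, smul_smul]
    rw [Finset.sum_comm (γ := Fin r) (f := fun l m ↦ (a l * v m) • D l (y m)),
      ← Finset.sum_add_distrib]
    refine Finset.sum_congr rfl fun m _ ↦ ?_
    rw [← Finset.sum_add_distrib]
    refine Finset.sum_congr rfl fun l _ ↦ ?_
    rw [← sub_eq_iff_eq_add', mul_comm (a l), ← smul_sub, hc, Finset.smul_sum]
    simp only [smul_smul]
  have h2 : ∑ n, w n • y n = -∑ m, ∑ l, ∑ n, (v m * a l * c l m n) • y n := by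
    simp only [hw, neg_smul, Finset.sum_neg_distrib, Finset.sum_mul, Finset.sum_smul]
    congr 1
    rw [Finset.sum_comm]
    refine Finset.sum_congr rfl fun m _ ↦ ?_
    rw [Finset.sum_comm]
    refine Finset.sum_congr rfl fun l _ ↦ Finset.sum_congr rfl fun n _ ↦ ?_
    congr 1
    ring
  simp only [Finset.sum_add_distrib, Pi.add_apply, add_smul, h1, h2]
  abel

/-- The derivatives of the flow with respect to the coefficients are tangent to the span of the
fields, if these generate a finite-dimensional Lie algebra. -/
lemma exists_curve_tangent {η' : Fin r → C(F, F →L[ℝ] F)}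
    (hη' : ∀ l x, HasFDerivAt (η l) (η' l x) x) {Ω : Set F} (c : Fin r → Fin r → Fin r → ℝ)
    (hc : ∀ x ∈ Ω, ∀ l m, η' m x (η l x) - η' l x (η m x) = ∑ n, c l m n • η n x)
    {a : Fin r → ℝ} {q : F} {γ : C(𝕀, F)} (hγΩ : ∀ t, γ t ∈ Ω)
    (hγ : γ = constCurve F q + primitive F (∑ l, a l • (η l).comp γ)) (e : Fin r → ℝ) :
    ∃ V : C(𝕀, F), (V = constCurve F 0 +
        primitive F (∑ l, (a l • pointwiseApply 𝕀 F F ((η' l).comp γ) V +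
          e l • (η l).comp γ))) ∧ ∀ t, V t ∈ Submodule.span ℝ (Set.range fun l ↦ η l (γ t)) := by
  -- The ansatz `V = ∑ v m • η m` along `γ` solves the linearised equation if `v' = B v + e`. `B`
  -- does not depend on time because the structure constants are constant.
  let B : (Fin r → ℝ) →L[ℝ] (Fin r → ℝ) := ContinuousLinearMap.pi fun n ↦
    -∑ m, (∑ l, a l * c l m n) • ContinuousLinearMap.proj (R := ℝ) (φ := fun _ : Fin r ↦ ℝ) m
  have hB (v : Fin r → ℝ) (n : Fin r) : B v n = -∑ m, (∑ l, a l * c l m n) * v m := by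
    simp [B]
  obtain ⟨v, hv0, hv⟩ := exists_affine_ode B e
  have hvc : Continuous v := continuous_iff_continuousAt.2 fun t ↦ (hv t).continuousAt
  -- the curve, extended to the real line
  let g : ℝ → F := fun t ↦ q + ∫ s in (0 : ℝ)..t, extCurve (∑ l, a l • (η l).comp γ) s
  have hg (t : ℝ) (ht : t ∈ 𝕀) : g t = γ ⟨t, ht⟩ := by
    conv_rhs => rw [hγ]
    rfl
  have hg' (t : ℝ) (ht : t ∈ 𝕀) : HasDerivAt g (∑ l, a l • η l (g t)) t := by
    have h1 := ((continuous_extCurve (∑ l, a l • (η l).comp γ)).integral_hasStrictDerivAt 0 t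
      ).hasDerivAt.const_add q
    refine h1.congr_deriv ?_
    rw [extCurve_of_mem _ ht, hg t ht]
    simp
  let V : C(𝕀, F) := ⟨fun t ↦ ∑ m, v t m • η m (γ t), by fun_prop⟩
  refine ⟨V, ?_, fun t ↦ ?_⟩
  · ext t
    have key := eq_primitive_of_hasDerivAt
      (γ := ∑ l, (a l • pointwiseApply 𝕀 F F ((η' l).comp γ) V + e l • (η l).comp γ))
      (g := fun t ↦ ∑ m, v t m • η m (g t)) t (fun s hs ↦ by
        have h1 (m : Fin r) : HasDerivAt (fun t ↦ v t m • η m (g t))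
            (v s m • (η' m (g s) (∑ l, a l • η l (g s))) + (B (v s) + e) m • η m (g s)) s :=
          ((hasDerivAt_pi.1 (hv s)) m).smul ((hη' m (g s)).comp_hasDerivAt s (hg' s hs))
        refine (HasDerivAt.fun_sum fun m _ ↦ h1 m).congr_deriv ?_
        have hΩ : g s ∈ Ω := by rw [hg s hs]; exact hγΩ _
        rw [tangent_identity c a e (v s) (B (v s)) (hB _) (fun m ↦ η m (g s))
          (fun m ↦ η' m (g s)) (hc _ hΩ)]
        simp only [ContinuousMap.coe_sum, Finset.sum_apply, ContinuousMap.add_apply,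
          ContinuousMap.smul_apply, pointwiseApply_apply, ContinuousMap.comp_apply, ← hg s hs, V,
          ContinuousMap.coe_mk])
    rw [ContinuousMap.add_apply, key]
    simp only [constCurve_apply, hv0, V, ContinuousMap.coe_mk]
    simp [hg t t.2]
  · change ∑ m, v t m • η m (γ t) ∈ _
    exact Submodule.sum_mem (Submodule.span ℝ (Set.range fun l ↦ η l (γ t))) fun m _ ↦
    Submodule.smul_mem _ _
      (Submodule.subset_span (Set.mem_range_self (f := fun l ↦ η l (γ t)) m))

end Flow

/-! ### Frobenius theorem together with a compatible first-order linear system -/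

section Frobenius

variable {N r : ℕ}
local notation "𝔼" => EuclideanSpace ℝ (Fin N)
local notation "𝕀" => Set.Icc (0 : ℝ) 1

/-- A linearly independent family can be moved to the first vectors of the standard basis. -/
lemma exists_equiv_single (hr : r ≤ N) {ξ : Fin r → 𝔼} (hξ : LinearIndependent ℝ ξ) :
    ∃ L : 𝔼 ≃L[ℝ] 𝔼, ∀ l, L (EuclideanSpace.single (Fin.castLE hr l) 1) = ξ l := by
  let b := Module.Basis.sumExtend hξ
  have hfin : Finite (Fin r ⊕ Module.Basis.sumExtendIndex hξ) := Module.Finite.finite_basis b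
  have : Finite (Module.Basis.sumExtendIndex hξ) :=
    Finite.of_injective (Sum.inr (α := Fin r)) Sum.inr_injective
  let _ : Fintype (Module.Basis.sumExtendIndex hξ) := Fintype.ofFinite _
  have hcard : Fintype.card (Module.Basis.sumExtendIndex hξ) = N - r := by
    have := Module.finrank_eq_card_basis b
    rw [Fintype.card_sum, finrank_euclideanSpace_fin, Fintype.card_fin] at this
    omega
  let e₁ : Module.Basis.sumExtendIndex hξ ≃ Fin (N - r) := Fintype.equivFinOfCardEq hcard
  let e : Fin r ⊕ Module.Basis.sumExtendIndex hξ ≃ Fin N :=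
    ((Equiv.refl _).sumCongr e₁).trans (finSumFinEquiv.trans (finCongr (by omega)))
  refine ⟨((EuclideanSpace.basisFun (Fin N) ℝ).toBasis.equiv b e.symm).toContinuousLinearEquiv,
    fun l ↦ ?_⟩
  have h1 : e.symm (Fin.castLE hr l) = Sum.inl l := by
    rw [Equiv.symm_apply_eq]
    ext
    simp [e]
  have h2 := (EuclideanSpace.basisFun (Fin N) ℝ).toBasis.equiv_apply (b' := b)
    (Fin.castLE hr l) e.symm
  simp only [OrthonormalBasis.coe_toBasis, EuclideanSpace.basisFun_apply, h1] at h2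
  have h3 : b (Sum.inl l) = ξ l := by
    simp [b, Module.Basis.sumExtend, Equiv.Set.sumDiffSubset]
    rfl
  exact h2.trans h3

/-- The theorem of Frobenius for fields that generate a finite-dimensional Lie algebra, and the
local solvability of the equations `df (ξ l) = h l` under the integrability conditions. -/
theorem exists_straightening (hr : r ≤ N) {Ω : Set 𝔼} (hΩ : IsOpen Ω) {z₀ : 𝔼} (hz₀ : z₀ ∈ Ω)
    {ξ : Fin r → 𝔼 → 𝔼} {h : Fin r → 𝔼 → ℝ} (hξ : ∀ l, ContDiffOn ℝ ∞ (ξ l) Ω)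
    (hh : ∀ l, ContDiffOn ℝ ∞ (h l) Ω) (c : Fin r → Fin r → Fin r → ℝ)
    (hcξ : ∀ z ∈ Ω, ∀ l m, fderiv ℝ (ξ m) z (ξ l z) - fderiv ℝ (ξ l) z (ξ m z) =
      ∑ n, c l m n • ξ n z)
    (hch : ∀ z ∈ Ω, ∀ l m, fderiv ℝ (h m) z (ξ l z) - fderiv ℝ (h l) z (ξ m z) =
      ∑ n, c l m n • h n z)
    (hli : LinearIndependent ℝ fun l ↦ ξ l z₀) :
    ∃ Φ : OpenPartialHomeomorph 𝔼 𝔼, z₀ ∈ Φ.target ∧ Φ.target ⊆ Ω ∧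
      ContDiffOn ℝ ∞ Φ Φ.source ∧ ContDiffOn ℝ ∞ Φ.symm Φ.target ∧
      (∀ z ∈ Φ.source, Submodule.span ℝ (Set.range fun l : Fin r ↦
        fderiv ℝ Φ z (EuclideanSpace.single (Fin.castLE hr l) 1)) =
          Submodule.span ℝ (Set.range fun l ↦ ξ l (Φ z))) ∧
      ∃ f : 𝔼 → ℝ, ContDiffOn ℝ ∞ f Φ.target ∧
        ∀ z ∈ Φ.target, ∀ l, fderiv ℝ f z (ξ l z) = h l z := by
  -- cut-off fields on `𝔼 × ℝ`
  obtain ⟨ρ, hρ, hρΩ⟩ := Metric.isOpen_iff.1 hΩ z₀ hz₀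
  let χ : ContDiffBump z₀ := ⟨ρ / 4, ρ / 2, by positivity, by linarith⟩
  have hχs : tsupport χ ⊆ Ω := by
    rw [χ.tsupport_eq]
    exact (Metric.closedBall_subset_ball (by simp [χ]; linarith)).trans hρΩ
  -- The lifts `(ξ l, h l)` obey the same bracket relations as the `ξ l`: this is the content of
  -- `hcξ` and `hch` together. A solution `f` is a function whose graph is tangent to all lifts. The
  -- lifts do not depend on the last coordinate.
  let η : Fin r → 𝔼 × ℝ → 𝔼 × ℝ := fun l p ↦ (χ p.1 • ξ l p.1, χ p.1 • h l p.1)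
  have hcut {G : Type} [NormedAddCommGroup G] [NormedSpace ℝ G] {g : 𝔼 → G}
      (hg : ContDiffOn ℝ ∞ g Ω) : ContDiff ℝ ∞ fun z ↦ χ z • g z := by
    refine contDiff_iff_contDiffAt.2 fun z ↦ ?_
    by_cases hz : z ∈ tsupport χ
    · exact χ.contDiffAt.smul (hg.contDiffAt (hΩ.mem_nhds (hχs hz)))
    · refine (contDiffAt_const (c := (0 : G))).congr_of_eventuallyEq ?_
      filter_upwards [notMem_tsupport_iff_eventuallyEq.1 hz] with y hy
      simp [hy]
  have hη (l : Fin r) : ContDiff ℝ ∞ (η l) :=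
    ((hcut (hξ l)).comp contDiff_fst).prodMk ((hcut (hh l)).comp contDiff_fst)
  let Ω₁ : Set 𝔼 := Metric.ball z₀ (ρ / 4)
  have hΩ₁ : Ω₁ ⊆ Ω := (Metric.ball_subset_ball (by linarith)).trans hρΩ
  have hηΩ (l : Fin r) (p : 𝔼 × ℝ) (hp : p.1 ∈ Ω₁) : η l p = (ξ l p.1, h l p.1) := by
    have : χ p.1 = 1 := χ.one_of_mem_closedBall (Metric.ball_subset_closedBall hp)
    simp [η, this]
  have hη' (l : Fin r) (p : 𝔼 × ℝ) (hp : p.1 ∈ Ω₁) (v : 𝔼 × ℝ) :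
      fderiv ℝ (η l) p v = (fderiv ℝ (ξ l) p.1 v.1, fderiv ℝ (h l) p.1 v.1) := by
    have hev : η l =ᶠ[𝓝 p] fun p ↦ (ξ l p.1, h l p.1) := by
      filter_upwards [continuous_fst.continuousAt.preimage_mem_nhds (Metric.isOpen_ball.mem_nhds hp)]
        with p' hp' using hηΩ l p' hp'
    have h1 : HasFDerivAt (ξ l) (fderiv ℝ (ξ l) p.1) p.1 :=
      (((hξ l).contDiffAt (hΩ.mem_nhds (hΩ₁ hp))).differentiableAt (by simp)).hasFDerivAt
    have h2 : HasFDerivAt (h l) (fderiv ℝ (h l) p.1) p.1 :=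
      (((hh l).contDiffAt (hΩ.mem_nhds (hΩ₁ hp))).differentiableAt (by simp)).hasFDerivAt
    have h3 : HasFDerivAt (fun p : 𝔼 × ℝ ↦ (ξ l p.1, h l p.1)) _ p :=
      (h1.comp p (hasFDerivAt_fst (𝕜 := ℝ))).prodMk (h2.comp p (hasFDerivAt_fst (𝕜 := ℝ)))
    rw [hev.fderiv_eq, h3.fderiv]
    rfl
  -- the flow
  let ηc : Fin r → C(𝔼 × ℝ, 𝔼 × ℝ) := fun l ↦ ⟨η l, (hη l).continuous⟩
  let ηc' : Fin r → C(𝔼 × ℝ, 𝔼 × ℝ →L[ℝ] 𝔼 × ℝ) := fun l ↦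
    ⟨fderiv ℝ (η l), (hη l).continuous_fderiv (by simp)⟩
  have hηc' (l : Fin r) (x : 𝔼 × ℝ) : HasFDerivAt (ηc l) (ηc' l x) x :=
    ((hη l).differentiable (by simp) x).hasFDerivAt
  obtain ⟨ψ, hψ⟩ := exists_flow (η := ηc) hη hηc' (z₀, 0)
    (Ω := {p | p.1 ∈ Ω₁}) (Metric.isOpen_ball.preimage continuous_fst)
    (Metric.mem_ball_self (by positivity))
  have htang : ∀ᶠ p in 𝓝 ((0 : Fin r → ℝ), ((z₀, 0) : 𝔼 × ℝ)), ∀ e : Fin r → ℝ,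
      fderiv ℝ ψ p (e, 0) 1 ∈ Submodule.span ℝ
        (Set.range fun l ↦ (ξ l (ψ p 1).1, h l (ψ p 1).1)) := by
    filter_upwards [hψ] with p ⟨_, _, h3, h4, h5⟩ e
    obtain ⟨V, hV, hVs⟩ := exists_curve_tangent hηc' (Ω := {p | p.1 ∈ Ω₁}) c
      (fun x hx l m ↦ by
        have h6 (l m : Fin r) : ηc' m x (ηc l x) =
            (fderiv ℝ (ξ m) x.1 (ξ l x.1), fderiv ℝ (h m) x.1 (ξ l x.1)) := by
          refine (hη' m x hx _).trans ?_
          change (fderiv ℝ (ξ m) x.1 (η l x).1, fderiv ℝ (h m) x.1 (η l x).1) = _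
          rw [hηΩ l x hx]
        rw [h6, h6, Prod.mk_sub_mk, hcξ _ (hΩ₁ hx), hch _ (hΩ₁ hx)]
        ext1
        · simp only [Prod.fst_sum, Prod.smul_fst]
          exact Finset.sum_congr rfl fun n _ ↦ congrArg (c l m n • ·)
            (congrArg Prod.fst (hηΩ n x hx)).symm
        · simp only [Prod.snd_sum, Prod.smul_snd]
          exact Finset.sum_congr rfl fun n _ ↦ congrArg (c l m n • ·)
            (congrArg Prod.snd (hηΩ n x hx)).symm) h3 h4 e
    rw [h5 (e, 0) V hV]
    have := hVs 1
    have h7 : (fun l ↦ ηc l (ψ p 1)) = fun l ↦ (ξ l (ψ p 1).1, h l (ψ p 1).1) :=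
      funext fun l ↦ hηΩ l _ (h3 1)
    rwa [h7] at this
  -- the straightening map
  obtain ⟨L, hL⟩ := exists_equiv_single hr hli
  let ε : Fin r → 𝔼 := fun l ↦ EuclideanSpace.single (Fin.castLE hr l) 1
  let σ : 𝔼 →L[ℝ] (Fin r → ℝ) :=
    ContinuousLinearMap.pi fun l ↦ EuclideanSpace.proj (Fin.castLE hr l)
  have hσ (m : Fin r) : σ (ε m) = Pi.single m 1 := by
    ext l
    simp [σ, ε, Pi.single_apply, Fin.castLE_inj]
  let q : 𝔼 →L[ℝ] 𝔼 := (L : 𝔼 →L[ℝ] 𝔼) ∘L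
    (ContinuousLinearMap.id ℝ 𝔼 - ∑ l, (ContinuousLinearMap.proj l ∘L σ).smulRight (ε l))
  have hq (z : 𝔼) : q z = L (z - ∑ l, σ z l • ε l) := by simp [q]
  have hqε (m : Fin r) : q (ε m) = 0 := by
    rw [hq, hσ]
    simp [Pi.single_apply]
  -- The first `r` coordinates of `z` become the coefficients of the flow. The others, carried by
  -- `q`, parametrise a transversal through `z₀` from which the flow starts, at height `0`.
  let A : 𝔼 → (Fin r → ℝ) × 𝔼 × ℝ := fun z ↦ (σ z, (z₀ + q z, 0))
  have hA (z : 𝔼) : HasFDerivAt A (σ.prod (q.prod 0)) z :=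
    σ.hasFDerivAt.prodMk ((q.hasFDerivAt.const_add z₀).prodMk (hasFDerivAt_const 0 z))
  have hAs : ContDiff ℝ ∞ A :=
    σ.contDiff.prodMk ((contDiff_const.add q.contDiff).prodMk contDiff_const)
  have hA0 : A 0 = (0, (z₀, 0)) := by simp [A]
  let one : 𝕀 := 1
  let ev : C(𝕀, 𝔼 × ℝ) →L[ℝ] 𝔼 × ℝ := ContinuousMap.evalCLM ℝ one
  let G : 𝔼 → 𝔼 × ℝ := fun z ↦ ψ (A z) 1
  have hGd (z : 𝔼) (hz : ContDiffAt ℝ ∞ ψ (A z)) :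
      HasFDerivAt G (ev ∘L fderiv ℝ ψ (A z) ∘L σ.prod (q.prod 0)) z :=
    ev.hasFDerivAt.comp z ((hz.differentiableAt (by simp)).hasFDerivAt.comp z (hA z))
  have hGs (z : 𝔼) (hz : ContDiffAt ℝ ∞ ψ (A z)) : ContDiffAt ℝ ∞ G z :=
    ev.contDiff.contDiffAt.comp z (hz.comp z hAs.contDiffAt)
  have hAc : Filter.Tendsto A (𝓝 0) (𝓝 (0, (z₀, 0))) := hA0 ▸ hAs.continuous.tendsto 0
  have hev1 := hAc.eventually hψ
  have hev2 := hAc.eventually htang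
  let Φ₁ : 𝔼 → 𝔼 := fun z ↦ (G z).1
  have hψ0 := hev1.self_of_nhds
  -- At `z = 0` the curve is constant and the linearised equation integrates a constant. The
  -- derivative is `q z + ∑ σ z l • ξ l z₀`, and this is `L z` because `L (ε l) = ξ l z₀`.
  have hΦ0 : HasFDerivAt Φ₁ (L : 𝔼 →L[ℝ] 𝔼) 0 := by
    have h1 : HasFDerivAt Φ₁ _ 0 :=
      (ContinuousLinearMap.fst ℝ 𝔼 ℝ).hasFDerivAt.comp 0 (hGd 0 hψ0.1)
    refine h1.congr_fderiv ?_
    ext1 z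
    have hA01 : (A 0).1 = 0 := by rw [hA0]
    have hA02 : (A 0).2 = (z₀, 0) := by rw [hA0]
    have hψc := hψ0.2.1 hA01
    rw [hA02] at hψc
    have h2 := hψ0.2.2.2.2 (σ z, (q z, 0))
      (constCurve _ (q z, (0 : ℝ)) + primitive _ (constCurve _ (∑ l, σ z l • η l (z₀, 0)))) (by
        rw [hA01, hψc]
        simp only [Pi.zero_apply, zero_smul, zero_add, map_sum, map_smul]
        rfl)
    have h3 : primitive (𝔼 × ℝ) (constCurve _ (∑ l, σ z l • η l (z₀, 0))) 1 =
        ∑ l, σ z l • η l (z₀, 0) := by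
      rw [primitive_apply]
      have : extCurve (constCurve (𝔼 × ℝ) (∑ l, σ z l • η l (z₀, 0))) =
          fun _ ↦ ∑ l, σ z l • η l (z₀, 0) := rfl
      rw [this, intervalIntegral.integral_const]
      simp
    change (fderiv ℝ ψ (A 0) (σ z, (q z, 0)) 1).1 = L z
    rw [h2, ContinuousMap.add_apply, h3]
    change q z + (∑ l, σ z l • η l (z₀, 0)).1 = L z
    have h4 (l : Fin r) : η l (z₀, 0) = (L (ε l), h l z₀) := by
      rw [hηΩ l (z₀, 0) (Metric.mem_ball_self (by positivity)), hL]
    simp only [h4, Prod.fst_sum, Prod.smul_fst, hq, map_sub, map_sum, map_smul]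
    abel
  have hΦs (z : 𝔼) (hz : ContDiffAt ℝ ∞ ψ (A z)) : ContDiffAt ℝ ∞ Φ₁ z :=
    contDiff_fst.contDiffAt.comp z (hGs z hz)
  have hinv : ∀ᶠ z in 𝓝 (0 : 𝔼), ∃ L' : 𝔼 ≃L[ℝ] 𝔼, HasFDerivAt Φ₁ (L' : 𝔼 →L[ℝ] 𝔼) z := by
    have h1 : ContinuousAt (fderiv ℝ Φ₁) 0 :=
      ((hΦs 0 hψ0.1).fderiv_right (m := ∞) (by simp)).continuousAt
    have h2 : Set.range ((↑) : (𝔼 ≃L[ℝ] 𝔼) → 𝔼 →L[ℝ] 𝔼) ∈ 𝓝 (fderiv ℝ Φ₁ 0) := by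
      rw [hΦ0.fderiv]
      exact ContinuousLinearEquiv.nhds L
    filter_upwards [h1 h2, hev1] with z ⟨L', hL'⟩ hz
    refine ⟨L', ?_⟩
    rw [hL']
    exact ((hΦs z hz.1).differentiableAt (by simp)).hasFDerivAt
  obtain ⟨O, hO, hOo, h0O⟩ := eventually_nhds_iff.1 (hev1.and (hev2.and hinv))
  let Φ₀ : OpenPartialHomeomorph 𝔼 𝔼 := (hΦs 0 hψ0.1).toOpenPartialHomeomorph Φ₁ hΦ0 (by simp)
  let Φ : OpenPartialHomeomorph 𝔼 𝔼 := Φ₀.restrOpen O hOo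
  have hΦΦ : (Φ : 𝔼 → 𝔼) = Φ₁ := rfl
  have hΦO (z : 𝔼) (hz : z ∈ Φ.source) : z ∈ O := by
    rw [OpenPartialHomeomorph.restrOpen_source] at hz
    exact hz.2
  have h0s : (0 : 𝔼) ∈ Φ.source := by
    rw [OpenPartialHomeomorph.restrOpen_source]
    exact ⟨(hΦs 0 hψ0.1).mem_toOpenPartialHomeomorph_source hΦ0 (by simp), h0O⟩
  have hΦ00 : Φ 0 = z₀ := by
    change (ψ (A 0) 1).1 = z₀
    rw [hψ0.2.1 (by rw [hA0]), hA0]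
    rfl
  have hmem (z : 𝔼) (hz : z ∈ Φ.source) : Φ z ∈ Ω₁ := (hO z (hΦO z hz)).1.2.2.1 1
  have hsymm (w : 𝔼) (hw : w ∈ Φ.target) : ContDiffAt ℝ ∞ Φ.symm w := by
    obtain ⟨h1, h2, L', hL'⟩ := hO _ (hΦO _ (Φ.map_target hw))
    exact Φ.contDiffAt_symm hw hL' (hΦs _ h1.1)
  -- The image of `G` is the graph over `Φ.target` of the function sought, so `f` is the height
  -- `G.2` read through `Φ.symm`.
  let f : 𝔼 → ℝ := fun w ↦ (G (Φ.symm w)).2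
  have hf (w : 𝔼) (hw : w ∈ Φ.target) : ContDiffAt ℝ ∞ f w :=
    contDiff_snd.contDiffAt.comp w
      ((hGs _ (hO _ (hΦO _ (Φ.map_target hw))).1.1).comp w (hsymm w hw))
  -- The derivatives of `G` along `ε l` lie in the span of the lifts by `exists_curve_tangent`.
  -- Their first components are independent since `Φ` has invertible derivative, so a dimension
  -- count gives equality.
  have hspan (z : 𝔼) (hz : z ∈ Φ.source) :
      Submodule.span ℝ (Set.range fun l ↦ fderiv ℝ G z (ε l)) =
        Submodule.span ℝ (Set.range fun l ↦ (ξ l (Φ z), h l (Φ z))) := by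
    obtain ⟨h1, h2, L', hL'⟩ := hO z (hΦO z hz)
    have h3 : HasFDerivAt Φ₁ _ z :=
      (ContinuousLinearMap.fst ℝ 𝔼 ℝ).hasFDerivAt.comp z (hGd z h1.1).differentiableAt.hasFDerivAt
    have h4 := h3.unique hL'
    have hle : Submodule.span ℝ (Set.range fun l ↦ fderiv ℝ G z (ε l)) ≤
        Submodule.span ℝ (Set.range fun l ↦ (ξ l (Φ z), h l (Φ z))) := by
      rw [Submodule.span_le]
      rintro _ ⟨l, rfl⟩
      have h5 := h2 (σ (ε l))
      have h6 : fderiv ℝ G z (ε l) = fderiv ℝ ψ (A z) (σ (ε l), 0) 1 := by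
        rw [(hGd z h1.1).fderiv]
        change fderiv ℝ ψ (A z) (σ (ε l), (q (ε l), 0)) 1 = _
        rw [hqε]
        rfl
      change fderiv ℝ G z (ε l) ∈ _
      rw [h6]
      exact h5
    have hli' : LinearIndependent ℝ fun l ↦ fderiv ℝ G z (ε l) := by
      have h5 : LinearIndependent ℝ fun l ↦ L' (ε l) := by
        have h6 : LinearIndependent ℝ ε := by
          refine LinearIndependent.of_comp (σ : 𝔼 →ₗ[ℝ] (Fin r → ℝ)) ?_
          have : (σ : 𝔼 →ₗ[ℝ] (Fin r → ℝ)) ∘ ε = fun m ↦ Pi.single m 1 := funext hσ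
          rw [this]
          exact Pi.linearIndependent_single_one (Fin r) ℝ
        exact h6.map' (L' : 𝔼 →ₗ[ℝ] 𝔼) (LinearMap.ker_eq_bot.2 L'.injective)
      refine LinearIndependent.of_comp (LinearMap.fst ℝ 𝔼 ℝ) ?_
      have : (LinearMap.fst ℝ 𝔼 ℝ) ∘ (fun l ↦ fderiv ℝ G z (ε l)) = fun l ↦ L' (ε l) :=
        funext fun l ↦ DFunLike.congr_fun h4 (ε l)
      rw [this]
      exact h5
    refine Submodule.eq_of_le_of_finrank_le hle ?_
    rw [finrank_span_eq_card hli']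
    exact finrank_range_le_card _
  refine ⟨Φ, hΦ00 ▸ Φ.map_source h0s, ?_, fun z hz ↦ ?_, fun w hw ↦ ?_, fun z hz ↦ ?_, f,
    fun w hw ↦ (hf w hw).contDiffWithinAt, ?_⟩
  · intro w hw
    rw [← Φ.right_inv hw]
    exact hΩ₁ (hmem _ (Φ.map_target hw))
  · exact (hΦs z (hO z (hΦO z hz)).1.1).contDiffWithinAt
  · exact (hsymm w hw).contDiffWithinAt
  · have h1 := congrArg (Submodule.map (LinearMap.fst ℝ 𝔼 ℝ)) (hspan z hz)
    rw [Submodule.map_span, Submodule.map_span, ← Set.range_comp, ← Set.range_comp] at h1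
    have h2 : HasFDerivAt Φ₁ _ z := (ContinuousLinearMap.fst ℝ 𝔼 ℝ).hasFDerivAt.comp z
      (hGd z (hO z (hΦO z hz)).1.1).differentiableAt.hasFDerivAt
    rw [hΦΦ, h2.fderiv]
    exact h1
  · intro w hw m
    set z := Φ.symm w with hz
    have hzs : z ∈ Φ.source := Φ.map_target hw
    have hw' : Φ z = w := Φ.right_inv hw
    have h1 := hGd z (hO z (hΦO z hzs)).1.1
    have h2 : (ξ m w, h m w) ∈ Submodule.span ℝ (Set.range fun l ↦ fderiv ℝ G z (ε l)) := by
      rw [hspan z hzs, hw']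
      exact Submodule.subset_span ⟨m, rfl⟩
    have h3 : Submodule.span ℝ (Set.range fun l ↦ fderiv ℝ G z (ε l)) ≤
        LinearMap.range (fderiv ℝ G z : 𝔼 →ₗ[ℝ] 𝔼 × ℝ) := by
      rw [Submodule.span_le]
      rintro _ ⟨l, rfl⟩
      exact ⟨ε l, rfl⟩
    -- This `v` satisfies `dΦ v = ξ m w` and `d(G.2) v = h m w`. Differentiating `f ∘ Φ = G.2` along
    -- `v` gives the equation.
    obtain ⟨v, hv⟩ := h3 h2
    have h4 : HasFDerivAt Φ₁ (ContinuousLinearMap.fst ℝ 𝔼 ℝ ∘L fderiv ℝ G z) z :=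
      (ContinuousLinearMap.fst ℝ 𝔼 ℝ).hasFDerivAt.comp z h1.differentiableAt.hasFDerivAt
    have h5 : HasFDerivAt (fun z ↦ (G z).2) (ContinuousLinearMap.snd ℝ 𝔼 ℝ ∘L fderiv ℝ G z) z :=
      (ContinuousLinearMap.snd ℝ 𝔼 ℝ).hasFDerivAt.comp z h1.differentiableAt.hasFDerivAt
    have h6 : HasFDerivAt f (fderiv ℝ f w) (Φ₁ z) := by
      have : Φ₁ z = w := hw'
      rw [this]
      exact ((hf w hw).differentiableAt (by simp)).hasFDerivAt
    have h7 : (fun z ↦ f (Φ₁ z)) =ᶠ[𝓝 z] fun z ↦ (G z).2 := by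
      filter_upwards [Φ.open_source.mem_nhds hzs] with y hy
      change (G (Φ.symm (Φ y))).2 = _
      rw [Φ.left_inv hy]
    have h8 := DFunLike.congr_fun ((h6.comp z h4).unique (h5.congr_of_eventuallyEq h7)) v
    have h9 : fderiv ℝ G z v = (ξ m w, h m w) := hv
    have h10 : fderiv ℝ f w (fderiv ℝ G z v).1 = (fderiv ℝ G z v).2 := h8
    rwa [h9] at h10

end Frobenius

/-! ### Tractor curvature and the vanishing of the Weyl tensor on `Π(C)`, in coordinates -/

section LocalModel

open Filter

lemma hasFDerivAt_clm_apply_const {E F G : Type*} [NormedAddCommGroup E] [NormedSpace ℝ E]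
    [NormedAddCommGroup F] [NormedSpace ℝ F] [NormedAddCommGroup G] [NormedSpace ℝ G]
    {Φ : E → F →L[ℝ] G} {z : E} (h : DifferentiableAt ℝ Φ z) (v : F) :
    HasFDerivAt (fun y ↦ Φ y v) ((fderiv ℝ Φ z).flip v) z :=
  (h.hasFDerivAt.clm_apply (hasFDerivAt_const v z)).congr_fderiv (by ext x; simp)

/-- Integrability condition for parallel sections of a bundle of algebras. -/
lemma commute_curvature {E 𝒜 : Type*} [NormedAddCommGroup E] [NormedSpace ℝ E]
    [NormedRing 𝒜] [NormedAlgebra ℝ 𝒜] {G : E → E →L[ℝ] 𝒜} {A : E → 𝒜} {z : E}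
    (hG : DifferentiableAt ℝ G z) (hA : ContDiffAt ℝ ∞ A z)
    (h : ∀ᶠ y in 𝓝 z, ∀ u, fderiv ℝ A y u + G y u * A y - A y * G y u = 0) (u v : E) :
    (fderiv ℝ G z u v - fderiv ℝ G z v u + G z u * G z v - G z v * G z u) * A z =
      A z * (fderiv ℝ G z u v - fderiv ℝ G z v u + G z u * G z v - G z v * G z u) := by
  have hA1 := (hA.differentiableAt (by simp)).hasFDerivAt
  have h0 (u : E) : fderiv ℝ A z u = A z * G z u - G z u * A z := by
    have := h.self_of_nhds u
    rw [add_sub_assoc] at this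
    rw [eq_neg_of_add_eq_zero_left this]
    abel
  have h1 (u v : E) : fderiv ℝ (fderiv ℝ A) z u v =
      fderiv ℝ A z u * G z v + A z * fderiv ℝ G z u v - fderiv ℝ G z u v * A z -
        G z v * fderiv ℝ A z u := by
    have h2 : (fun y ↦ fderiv ℝ A y v) =ᶠ[𝓝 z] fun y ↦ A y * G y v - G y v * A y := by
      filter_upwards [h] with y hy
      have := hy v
      rw [add_sub_assoc] at this
      rw [eq_neg_of_add_eq_zero_left this]
      abel
    have h3 : HasFDerivAt (fun y ↦ fderiv ℝ A y v) ((fderiv ℝ (fderiv ℝ A) z).flip v) z :=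
      hasFDerivAt_clm_apply_const
        ((hA.fderiv_right (m := ∞) (by simp)).differentiableAt (by simp)) v
    have h4 : HasFDerivAt (fun y ↦ G y v) ((fderiv ℝ G z).flip v) z :=
      hasFDerivAt_clm_apply_const hG v
    have h5 := ((hA1.mul' h4).sub (h4.mul' hA1)).congr_of_eventuallyEq h2
    have h6 := DFunLike.congr_fun (h3.unique h5) u
    simp only [ContinuousLinearMap.flip_apply, sub_apply, add_apply, smul_apply,
      smul_eq_mul, MulOpposite.smul_eq_mul_unop, MulOpposite.unop_op] at h6
    rw [h6]
    noncomm_ring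
  -- Mixed second derivatives of `A` agree; inserting `A' = [A, G]` twice turns this into
  -- commutation with the curvature of `G`.
  have h7 : fderiv ℝ (fderiv ℝ A) z u v = fderiv ℝ (fderiv ℝ A) z v u :=
    (hA.isSymmSndFDerivAt (by simpa using ENat.LEInfty.out)) u v
  rw [h1 u v, h1 v u, h0, h0] at h7
  rw [← sub_eq_zero] at h7 ⊢
  rw [← neg_eq_zero, ← h7]
  noncomm_ring

/-- Symmetric maps that are linear over two anticommuting units vanish. -/
lemma eq_zero_of_symm_of_anticomm {V : Type*} [AddCommGroup V] [Module ℝ V]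
    {A B : Module.End ℝ V} (hAB : A * B = -(B * A)) (hA : A * A = -1) (hB : B * B = -1)
    {S : V → V → V} (hs : ∀ t t', S t t' = S t' t) (hSA : ∀ t t', S t (A t') = A (S t t'))
    (hSB : ∀ t t', S t (B t') = B (S t t')) (t t' : V) : S t t' = 0 := by
  -- By symmetry `S` is linear over `A` and `B` in the first slot too. Extracting the two units from
  -- `S (A t) (B t')` in either order gives `B A` and `A B`, which are opposite.
  have h1 : S (A t) (B t') = (B * A) (S t t') := by
    rw [hSB, hs, hSA, hs]; rfl
  have h2 : S (A t) (B t') = (A * B) (S t t') := by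
    rw [hs, hSA, hs, hSB]; rfl
  have h3 : (A * B) (S t t') = 0 := by
    have h4 : (A * B) (S t t') = -(A * B) (S t t') := by
      conv_lhs => rw [← h2, h1]
      rw [hAB]; simp
    have h5 : (2 : ℝ) • (A * B) (S t t') = 0 := by
      rw [two_smul]
      exact eq_neg_iff_add_eq_zero.1 h4
    exact (smul_eq_zero.1 h5).resolve_left two_ne_zero
  have h4 : S t t' = (B * A * (A * B)) (S t t') := by
    have : B * A * (A * B) = 1 := by
      rw [mul_assoc, ← mul_assoc A, hA]; simp [hB]
    rw [this]; rfl
  rw [h4, Module.End.mul_apply, h3, map_zero]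

variable {E : Type*} [NormedAddCommGroup E] [NormedSpace ℝ E] [FiniteDimensional ℝ E]

/-- The curvature of the connection with Christoffel symbol `Γ`. -/
def curv (Γ : E → E →L[ℝ] E →L[ℝ] E) (z u v w : E) : E :=
  fderiv ℝ Γ z u v w - fderiv ℝ Γ z v u w + Γ z u (Γ z v w) - Γ z v (Γ z u w)

/-- The connection form of the tractor connection with Christoffel symbol `Γ` and Schouten
tensor `P`. -/
def connForm (Γ : E → E →L[ℝ] E →L[ℝ] E) (P : E → E →L[ℝ] E →L[ℝ] ℝ) (z : E) :
    E →L[ℝ] E × ℝ →L[ℝ] E × ℝ :=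
  LinearMap.toContinuousLinearMap
    { toFun := fun u ↦ ((Γ z u ∘L ContinuousLinearMap.fst ℝ E ℝ) +
        (ContinuousLinearMap.snd ℝ E ℝ).smulRight u).prod
          (-(P z u ∘L ContinuousLinearMap.fst ℝ E ℝ))
      map_add' := fun u v ↦ by
        ext t <;> simp <;> abel
      map_smul' := fun c u ↦ by
        ext t <;> simp }

lemma connForm_apply (Γ : E → E →L[ℝ] E →L[ℝ] E) (P : E → E →L[ℝ] E →L[ℝ] ℝ) (z u : E)
    (t : E × ℝ) : connForm Γ P z u t = (Γ z u t.1 + t.2 • u, -P z u t.1) := rfl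

variable {Γ : E → E →L[ℝ] E →L[ℝ] E} {P : E → E →L[ℝ] E →L[ℝ] ℝ} {z : E}

lemma contDiffAt_apply_apply {F : Type*} [NormedAddCommGroup F] [NormedSpace ℝ F]
    {Γ : E → E →L[ℝ] E →L[ℝ] F} (hΓ : ContDiffAt ℝ ∞ Γ z) (u v : E) :
    ContDiffAt ℝ ∞ (fun y ↦ Γ y u v) z :=
  (hΓ.clm_apply contDiffAt_const).clm_apply contDiffAt_const

lemma hasFDerivAt_apply_apply {F : Type*} [NormedAddCommGroup F] [NormedSpace ℝ F]
    {Γ : E → E →L[ℝ] E →L[ℝ] F} (hΓ : ContDiffAt ℝ ∞ Γ z) (u v : E) :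
    HasFDerivAt (fun y ↦ Γ y u v) (((fderiv ℝ Γ z).flip u).flip v) z := by
  have h := (hΓ.differentiableAt (by simp)).hasFDerivAt
  exact ((h.clm_apply (hasFDerivAt_const u z)).clm_apply (hasFDerivAt_const v z)).congr_fderiv
    (by ext; simp)

lemma contDiffAt_connForm (hΓ : ContDiffAt ℝ ∞ Γ z) (hP : ContDiffAt ℝ ∞ P z) :
    ContDiffAt ℝ ∞ (connForm Γ P) z := by
  refine contDiffAt_clm_apply.2 fun u ↦ contDiffAt_clm_apply.2 fun t ↦ ?_
  exact ((contDiffAt_apply_apply hΓ u t.1).add contDiffAt_const).prodMk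
    (contDiffAt_apply_apply hP u t.1).neg

lemma fderiv_connForm (hΓ : ContDiffAt ℝ ∞ Γ z) (hP : ContDiffAt ℝ ∞ P z) (v u : E)
    (t : E × ℝ) : fderiv ℝ (connForm Γ P) z v u t =
      (fderiv ℝ Γ z v u t.1, -fderiv ℝ P z v u t.1) := by
  have h0 : HasFDerivAt (fun y ↦ connForm Γ P y u t) _ z :=
    ((((contDiffAt_connForm hΓ hP).differentiableAt (by simp)).hasFDerivAt.clm_apply
      (hasFDerivAt_const u z)).clm_apply (hasFDerivAt_const t z))
  have h2 : HasFDerivAt (fun y ↦ connForm Γ P y u t) _ z :=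
    ((hasFDerivAt_apply_apply hΓ u t.1).add_const (t.2 • u)).prodMk
      (hasFDerivAt_apply_apply hP u t.1).neg
  simpa using DFunLike.congr_fun (h0.unique h2) v

lemma curv_cyclic (hs : ∀ᶠ y in 𝓝 z, ∀ u v, Γ y u v = Γ y v u) (hΓ : ContDiffAt ℝ ∞ Γ z)
    (u v w : E) : curv Γ z u v w + curv Γ z v w u + curv Γ z w u v = 0 := by
  have h1 (u v w : E) : fderiv ℝ Γ z u v w = fderiv ℝ Γ z u w v := by
    have h2 : (fun y ↦ Γ y v w) =ᶠ[𝓝 z] fun y ↦ Γ y w v := by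
      filter_upwards [hs] with y hy using hy v w
    exact DFunLike.congr_fun ((hasFDerivAt_apply_apply hΓ v w).unique
      ((hasFDerivAt_apply_apply hΓ w v).congr_of_eventuallyEq h2)) u
  have h3 := hs.self_of_nhds
  simp only [curv]
  rw [h1 u w v, h1 v w u, h1 w v u, h3 v w, h3 u w, h3 v u]
  abel

/-- The endomorphism field `A` is parallel for the tractor connection near `z`. -/
def IsParallelNear (Γ : E → E →L[ℝ] E →L[ℝ] E) (P : E → E →L[ℝ] E →L[ℝ] ℝ) (z : E)
    (A : E → E × ℝ →L[ℝ] E × ℝ) : Prop :=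
  ∀ᶠ y in 𝓝 z, ContDiffAt ℝ ∞ A y ∧
    ∀ u, fderiv ℝ A y u + connForm Γ P y u * A y - A y * connForm Γ P y u = 0

lemma IsParallelNear.contDiffAt {A : E → E × ℝ →L[ℝ] E × ℝ} (hA : IsParallelNear Γ P z A) :
    ContDiffAt ℝ ∞ A z := hA.self_of_nhds.1

/-- The curvature of the tractor connection, normalised such that it annihilates `(0, 1)`. -/
def tractorCurv (Γ : E → E →L[ℝ] E →L[ℝ] E) (P : E → E →L[ℝ] E →L[ℝ] ℝ) (z u v : E) :
    E × ℝ →L[ℝ] E × ℝ :=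
  fderiv ℝ (connForm Γ P) z u v - fderiv ℝ (connForm Γ P) z v u +
    connForm Γ P z u * connForm Γ P z v - connForm Γ P z v * connForm Γ P z u +
    (P z u v - P z v u) • 1

lemma tractorCurv_apply (hΓ : ContDiffAt ℝ ∞ Γ z) (hP : ContDiffAt ℝ ∞ P z)
    (hs : ∀ u v, Γ z u v = Γ z v u) (u v : E) (t : E × ℝ) :
    tractorCurv Γ P z u v t =
      (curv Γ z u v t.1 + (P z u v - P z v u) • t.1 - P z v t.1 • u + P z u t.1 • v,
        -fderiv ℝ P z u v t.1 + fderiv ℝ P z v u t.1 - P z u (Γ z v t.1) + P z v (Γ z u t.1)) := by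
  simp only [tractorCurv, add_apply, sub_apply, smul_apply, mul_apply_eq_comp,
    fderiv_connForm hΓ hP, connForm_apply, one_apply_eq_self, curv, map_add, map_smul]
  ext1
  · simp [hs v u]; module
  · simp; ring

lemma tractorCurv_swap (u v : E) : tractorCurv Γ P z u v = -tractorCurv Γ P z v u := by
  simp only [tractorCurv]
  module

/-- The connection form alone has curvature `(0, -(P u v - P v u))` on `(0, 1)`, and no first
component because the torsion vanishes. The scalar in `tractorCurv` cancels this. Being a scalar, it
does not affect commutation with endomorphisms. -/
lemma tractorCurv_zero_one (hΓ : ContDiffAt ℝ ∞ Γ z) (hP : ContDiffAt ℝ ∞ P z)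
    (hs : ∀ u v, Γ z u v = Γ z v u) (u v : E) : tractorCurv Γ P z u v (0, 1) = 0 := by
  rw [tractorCurv_apply hΓ hP hs]
  simp [curv]

variable {τ : E → E →L[ℝ] ℝ}

/-- In the first component the `P`-terms cancel and the first Bianchi identity remains. In the
second component the cyclic sum is minus the exterior derivative of the skew part of `P`, which
vanishes because that part is the exact form `dτ`. -/
lemma tractorCurv_cyclic (hΓ : ContDiffAt ℝ ∞ Γ z) (hP : ContDiffAt ℝ ∞ P z)
    (hs : ∀ᶠ y in 𝓝 z, ∀ u v, Γ y u v = Γ y v u) (hτ : ContDiffAt ℝ ∞ τ z)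
    (hPτ : ∀ᶠ y in 𝓝 z, ∀ u v, P y u v - P y v u = fderiv ℝ τ y u v - fderiv ℝ τ y v u)
    (t₁ t₂ t₃ : E × ℝ) : tractorCurv Γ P z t₁.1 t₂.1 t₃ + tractorCurv Γ P z t₂.1 t₃.1 t₁ +
      tractorCurv Γ P z t₃.1 t₁.1 t₂ = 0 := by
  have hs0 := hs.self_of_nhds
  have hd (u v w : E) : fderiv ℝ P z u v w - fderiv ℝ P z u w v =
      fderiv ℝ (fderiv ℝ τ) z u v w - fderiv ℝ (fderiv ℝ τ) z u w v := by
    have h1 : (fun y ↦ P y v w - P y w v) =ᶠ[𝓝 z]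
        fun y ↦ fderiv ℝ τ y v w - fderiv ℝ τ y w v := by
      filter_upwards [hPτ] with y hy using hy v w
    have hτ' : ContDiffAt ℝ ∞ (fderiv ℝ τ) z := hτ.fderiv_right (by simp)
    exact DFunLike.congr_fun (((hasFDerivAt_apply_apply hP v w).sub
      (hasFDerivAt_apply_apply hP w v)).unique
        (((hasFDerivAt_apply_apply hτ' v w).sub
          (hasFDerivAt_apply_apply hτ' w v)).congr_of_eventuallyEq h1)) u
  have hsymm (u v w : E) : fderiv ℝ (fderiv ℝ τ) z u v w = fderiv ℝ (fderiv ℝ τ) z v u w :=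
    DFunLike.congr_fun ((hτ.isSymmSndFDerivAt (by simpa using ENat.LEInfty.out)) u v) w
  rw [tractorCurv_apply hΓ hP hs0, tractorCurv_apply hΓ hP hs0, tractorCurv_apply hΓ hP hs0]
  ext1
  · have := curv_cyclic hs hΓ t₁.1 t₂.1 t₃.1
    simp only [Prod.fst_add, Prod.fst_zero]
    rw [← this]
    module
  · simp only [Prod.snd_add, Prod.snd_zero]
    have h1 := hd t₁.1 t₂.1 t₃.1
    have h2 := hd t₂.1 t₃.1 t₁.1
    have h3 := hd t₃.1 t₁.1 t₂.1
    have h4 := hsymm t₁.1 t₂.1 t₃.1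
    have h5 := hsymm t₂.1 t₃.1 t₁.1
    have h6 := hsymm t₃.1 t₁.1 t₂.1
    rw [hs0 t₂.1 t₁.1, hs0 t₃.1 t₂.1, hs0 t₁.1 t₃.1]
    linarith

lemma tractorCurv_commute (hΓ : ContDiffAt ℝ ∞ Γ z) (hP : ContDiffAt ℝ ∞ P z)
    {A : E → E × ℝ →L[ℝ] E × ℝ} (hA : IsParallelNear Γ P z A) (u v : E) (t : E × ℝ) :
    tractorCurv Γ P z u v (A z t) = A z (tractorCurv Γ P z u v t) := by
  have h := commute_curvature ((contDiffAt_connForm hΓ hP).differentiableAt (by simp))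
    hA.contDiffAt (hA.mono fun _ h ↦ h.2) u v
  have h' : tractorCurv Γ P z u v * A z = A z * tractorCurv Γ P z u v := by
    rw [tractorCurv, add_mul, mul_add, h]
    simp
  exact DFunLike.congr_fun h' t

/-- The projective Weyl tensor vanishes upon contraction with the field `Π(A)`, if there are
anticommuting parallel tractor complex structures. -/
theorem curv_proj (hΓ : ContDiffAt ℝ ∞ Γ z) (hP : ContDiffAt ℝ ∞ P z)
    (hs : ∀ᶠ y in 𝓝 z, ∀ u v, Γ y u v = Γ y v u) (hτ : ContDiffAt ℝ ∞ τ z)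
    (hPτ : ∀ᶠ y in 𝓝 z, ∀ u v, P y u v - P y v u = fderiv ℝ τ y u v - fderiv ℝ τ y v u)
    {A B C : E → E × ℝ →L[ℝ] E × ℝ} (hA : IsParallelNear Γ P z A) (hB : IsParallelNear Γ P z B)
    (hC : IsParallelNear Γ P z C) (hAB : A z * B z = -(B z * A z)) (hAA : A z * A z = -1)
    (hBB : B z * B z = -1) (u v : E) :
    curv Γ z (C z (0, 1)).1 u v = P z u v • (C z (0, 1)).1 - P z (C z (0, 1)).1 v • u -
      (P z (C z (0, 1)).1 u - P z u (C z (0, 1)).1) • v := by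
  have hs0 := hs.self_of_nhds
  set ξ := (C z (0, 1)).1 with hξ
  -- The curvature kills `(0, 1)` and commutes with `C`, hence kills `C (0, 1)`; modulo `(0, 1)` the
  -- latter is `(ξ, 0)`.
  have hF0 (u v : E) : tractorCurv Γ P z u v (ξ, 0) = 0 := by
    have h1 : (ξ, (0 : ℝ)) = C z (0, 1) - (C z (0, 1)).2 • (0, 1) := by
      ext1 <;> simp [hξ]
    rw [h1, map_sub, map_smul, tractorCurv_commute hΓ hP hC, tractorCurv_zero_one hΓ hP hs0]
    simp
  let A' : Module.End ℝ (E × ℝ) := (A z : E × ℝ →ₗ[ℝ] E × ℝ)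
  let B' : Module.End ℝ (E × ℝ) := (B z : E × ℝ →ₗ[ℝ] E × ℝ)
  -- With `(ξ, 0)` as one of the three entries, the cyclic identity loses a term and becomes the
  -- symmetry of `S`. Linearity over `A` and `B` is commutation of the curvature with parallel
  -- endomorphisms.
  have hS := eq_zero_of_symm_of_anticomm (A := A') (B := B')
    (S := fun t t' ↦ tractorCurv Γ P z ξ t.1 t')
    (LinearMap.ext fun t ↦ DFunLike.congr_fun hAB t)
    (LinearMap.ext fun t ↦ DFunLike.congr_fun hAA t)
    (LinearMap.ext fun t ↦ DFunLike.congr_fun hBB t)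
    (fun t t' ↦ by
      have h := tractorCurv_cyclic hΓ hP hs hτ hPτ (ξ, 0) t t'
      simp only [hF0, add_zero] at h
      rw [tractorCurv_swap t'.1] at h
      exact add_neg_eq_zero.1 h)
    (fun t t' ↦ tractorCurv_commute hΓ hP hA _ _ _)
    (fun t t' ↦ tractorCurv_commute hΓ hP hB _ _ _) (u, 0) (v, 0)
  have h := congrArg Prod.fst hS
  simp only [tractorCurv_apply hΓ hP hs0, Prod.fst_zero] at h
  rw [← sub_eq_zero, ← h]
  module

/-- The Lie derivative along the field `ξ` of the connection with Christoffel symbol `Γ`. -/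
def lieForm (Γ : E → E →L[ℝ] E →L[ℝ] E) (ξ : E → E) (z u v : E) : E :=
  fderiv ℝ (fderiv ℝ ξ) z u v + fderiv ℝ Γ z (ξ z) u v - fderiv ℝ ξ z (Γ z u v) +
    Γ z (fderiv ℝ ξ z u) v + Γ z u (fderiv ℝ ξ z v)

lemma IsParallelNear.fderiv_apply {A : E → E × ℝ →L[ℝ] E × ℝ} (hA : IsParallelNear Γ P z A)
    (u : E) (t : E × ℝ) : fderiv ℝ A z u t =
      A z (Γ z u t.1 + t.2 • u, -P z u t.1) -
        (Γ z u (A z t).1 + (A z t).2 • u, -P z u (A z t).1) := by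
  have h := hA.self_of_nhds.2 u
  rw [add_sub_assoc] at h
  have h' := DFunLike.congr_fun (eq_neg_of_add_eq_zero_left h) t
  rw [h', neg_apply, sub_apply, neg_sub]
  rfl

lemma IsParallelNear.eventually {A : E → E × ℝ →L[ℝ] E × ℝ} (hA : IsParallelNear Γ P z A) :
    ∀ᶠ y in 𝓝 z, IsParallelNear Γ P y A :=
  hA.eventually_nhds

lemma IsParallelNear.hasFDerivAt_apply {A : E → E × ℝ →L[ℝ] E × ℝ}
    (hA : IsParallelNear Γ P z A) (t : E × ℝ) :
    HasFDerivAt (fun y ↦ A y t) ((fderiv ℝ A z).flip t) z :=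
  hasFDerivAt_clm_apply_const (hA.contDiffAt.differentiableAt (by simp)) t

/-- The covariant derivative of the field `Π(A)`. -/
lemma IsParallelNear.fderiv_proj {A : E → E × ℝ →L[ℝ] E × ℝ} (hA : IsParallelNear Γ P z A)
    (u : E) : fderiv ℝ (fun y ↦ (A y (0, 1)).1) z u =
      (A z (u, 0)).1 - (A z (0, 1)).2 • u - Γ z u (A z (0, 1)).1 := by
  have h : HasFDerivAt (fun y ↦ (A y (0, 1)).1) _ z :=
    (ContinuousLinearMap.fst ℝ E ℝ).hasFDerivAt.comp z (hA.hasFDerivAt_apply (0, 1))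
  rw [h.fderiv]
  change (fderiv ℝ A z u (0, 1)).1 = _
  rw [hA.fderiv_apply]
  simp
  abel

lemma IsParallelNear.fderiv_fderiv_proj {A : E → E × ℝ →L[ℝ] E × ℝ}
    (hΓ : ContDiffAt ℝ ∞ Γ z) (hA : IsParallelNear Γ P z A) (u v : E) :
    fderiv ℝ (fderiv ℝ fun y ↦ (A y (0, 1)).1) z u v =
      (fderiv ℝ A z u (v, 0)).1 - (fderiv ℝ A z u (0, 1)).2 • v -
        fderiv ℝ Γ z u v (A z (0, 1)).1 - Γ z v (fderiv ℝ (fun y ↦ (A y (0, 1)).1) z u) := by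
  have hs : ContDiffAt ℝ ∞ (fun y ↦ (A y (0, 1)).1) z :=
    contDiff_fst.contDiffAt.comp z (hA.contDiffAt.clm_apply contDiffAt_const)
  have h1 : HasFDerivAt (fun y ↦ fderiv ℝ (fun y ↦ (A y (0, 1)).1) y v)
      ((fderiv ℝ (fderiv ℝ fun y ↦ (A y (0, 1)).1) z).flip v) z :=
    hasFDerivAt_clm_apply_const
      ((hs.fderiv_right (m := ∞) (by simp)).differentiableAt (by simp)) v
  have h2 : (fun y ↦ fderiv ℝ (fun y ↦ (A y (0, 1)).1) y v) =ᶠ[𝓝 z] fun y ↦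
      (A y (v, 0)).1 - (A y (0, 1)).2 • v - Γ y v (A y (0, 1)).1 := by
    filter_upwards [hA.eventually] with y hy using hy.fderiv_proj v
  have h3 : HasFDerivAt (fun y ↦ (A y (v, 0)).1 - (A y (0, 1)).2 • v - Γ y v (A y (0, 1)).1) _ z :=
    (((ContinuousLinearMap.fst ℝ E ℝ).hasFDerivAt.comp z (hA.hasFDerivAt_apply (v, 0))).sub
      (((ContinuousLinearMap.snd ℝ E ℝ).hasFDerivAt.comp z
        (hA.hasFDerivAt_apply (0, 1))).smul_const v)).sub
    (((hΓ.differentiableAt (by simp)).hasFDerivAt.clm_apply (hasFDerivAt_const v z)).clm_apply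
      (hs.differentiableAt (by simp)).hasFDerivAt)
  have h4 := DFunLike.congr_fun (h1.unique (h3.congr_of_eventuallyEq h2)) u
  simp only [ContinuousLinearMap.flip_apply] at h4
  rw [h4]
  simp
  abel

/-- The field `Π(A)` is a projective symmetry. -/
theorem lieForm_proj (hΓ : ContDiffAt ℝ ∞ Γ z) (hP : ContDiffAt ℝ ∞ P z)
    (hs : ∀ᶠ y in 𝓝 z, ∀ u v, Γ y u v = Γ y v u) (hτ : ContDiffAt ℝ ∞ τ z)
    (hPτ : ∀ᶠ y in 𝓝 z, ∀ u v, P y u v - P y v u = fderiv ℝ τ y u v - fderiv ℝ τ y v u)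
    {A B C : E → E × ℝ →L[ℝ] E × ℝ} (hA : IsParallelNear Γ P z A) (hB : IsParallelNear Γ P z B)
    (hC : IsParallelNear Γ P z C) (hAB : A z * B z = -(B z * A z)) (hAA : A z * A z = -1)
    (hBB : B z * B z = -1) :
    ∃ β : E →L[ℝ] ℝ, ∀ u v, lieForm Γ (fun y ↦ (C y (0, 1)).1) z u v = β u • v + β v • u := by
  have hs0 := hs.self_of_nhds
  -- With `ν(u) = (C(u,0)).2`, parallelism gives the Hessian `∇_u∇_v ξ = -P(u,v)ξ - ν(v)u - (ν(u) +
  -- P(u,ξ))v`. Adding `R(ξ,u)v` from `curv_proj` cancels `P(u,v)ξ` and `P(u,ξ)v` and leaves `β = -ν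
  -- - P(ξ,·)`.
  refine ⟨-((ContinuousLinearMap.snd ℝ E ℝ) ∘L C z ∘L (ContinuousLinearMap.inl ℝ E ℝ)) -
    P z (C z (0, 1)).1, fun u v ↦ ?_⟩
  have h1 := curv_proj hΓ hP hs hτ hPτ hA hB hC hAB hAA hBB u v
  have hsplit (t : E × ℝ) : C z t = C z (t.1, 0) + t.2 • C z (0, 1) := by
    rw [← map_smul, ← map_add]
    simp
  have hd (u v w : E) : fderiv ℝ Γ z u v w = fderiv ℝ Γ z u w v := by
    have h2 : (fun y ↦ Γ y v w) =ᶠ[𝓝 z] fun y ↦ Γ y w v := by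
      filter_upwards [hs] with y hy using hy v w
    exact DFunLike.congr_fun ((hasFDerivAt_apply_apply hΓ v w).unique
      ((hasFDerivAt_apply_apply hΓ w v).congr_of_eventuallyEq h2)) u
  simp only [curv] at h1
  simp only [lieForm, hC.fderiv_fderiv_proj hΓ, hC.fderiv_proj, hC.fderiv_apply]
  rw [hsplit (Γ z u (v, (0 : ℝ)).1 + _, _), hsplit (Γ z u ((0 : E), (1 : ℝ)).1 + _, _)]
  simp only [Prod.fst_sub, Prod.snd_sub, Prod.fst_add, Prod.smul_fst,
    map_zero, zero_add, neg_zero, zero_smul, add_zero, one_smul, map_sub, map_smul, sub_apply,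
    smul_apply, neg_apply, ContinuousLinearMap.comp_apply, ContinuousLinearMap.inl_apply,
    ContinuousLinearMap.coe_snd']
  rw [hd u v, hs0 v (C z (u, 0)).1, hs0 v (Γ z u (C z (0, 1)).1), hs0 v u,
    hs0 (Γ z u v) (C z (0, 1)).1, hs0 v (C z (0, 1)).1]
  rw [← sub_eq_zero] at h1 ⊢
  refine Eq.trans ?_ h1
  module

end LocalModel

/-! ### Ricci and Schouten tensors in coordinates; the trace of a Lie derivative of a connection -/

section RicciForm

open Filter

variable {E : Type*} [NormedAddCommGroup E] [NormedSpace ℝ E] [FiniteDimensional ℝ E]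

/-- The trace, as a continuous linear functional. -/
def traceCLM (E : Type*) [NormedAddCommGroup E] [NormedSpace ℝ E] [FiniteDimensional ℝ E] :
    (E →L[ℝ] E) →L[ℝ] ℝ :=
  LinearMap.toContinuousLinearMap (LinearMap.trace ℝ E ∘ₗ ContinuousLinearMap.coeLM ℝ)

lemma traceCLM_apply (L : E →L[ℝ] E) : traceCLM E L = LinearMap.trace ℝ E (L : E →ₗ[ℝ] E) := rfl

lemma traceCLM_mul_comm (L L' : E →L[ℝ] E) : traceCLM E (L ∘L L') = traceCLM E (L' ∘L L) :=
  LinearMap.trace_mul_comm ℝ (L : E →ₗ[ℝ] E) (L' : E →ₗ[ℝ] E)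

lemma traceCLM_smulRight (β : E →L[ℝ] ℝ) (v : E) : traceCLM E (β.smulRight v) = β v := by
  rw [traceCLM_apply]
  exact LinearMap.trace_smulRight (β : E →ₗ[ℝ] ℝ) v

lemma traceCLM_id : traceCLM E (ContinuousLinearMap.id ℝ E) = Module.finrank ℝ E := by
  rw [traceCLM_apply]
  exact LinearMap.trace_id ℝ E

variable {Γ : E → E →L[ℝ] E →L[ℝ] E} {z : E}

/-- The curvature operator of the connection with Christoffel symbol `Γ`. -/
def curvOp (Γ : E → E →L[ℝ] E →L[ℝ] E) (z u v : E) : E →L[ℝ] E :=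
  fderiv ℝ Γ z u v - fderiv ℝ Γ z v u + Γ z u ∘L Γ z v - Γ z v ∘L Γ z u

lemma curvOp_apply (u v w : E) : curvOp Γ z u v w = curv Γ z u v w := rfl

/-- The curvature as a linear map in the first argument. -/
def curvFst (Γ : E → E →L[ℝ] E →L[ℝ] E) (z v w : E) : E →L[ℝ] E :=
  ((fderiv ℝ Γ z).flip v).flip w - (fderiv ℝ Γ z v).flip w +
    (Γ z).flip (Γ z v w) - Γ z v ∘L (Γ z).flip w

lemma curvFst_apply (u v w : E) : curvFst Γ z v w u = curv Γ z u v w := by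
  simp [curvFst, curv]

/-- The Ricci tensor of the connection with Christoffel symbol `Γ`. -/
def ricForm (Γ : E → E →L[ℝ] E →L[ℝ] E) (z : E) : E →L[ℝ] E →L[ℝ] ℝ :=
  LinearMap.toContinuousLinearMap ((LinearMap.toContinuousLinearMap : (E →ₗ[ℝ] ℝ) ≃ₗ[ℝ] _) ∘ₗ
    LinearMap.mk₂ ℝ (fun v w ↦ traceCLM E (curvFst Γ z v w))
      (fun v v' w ↦ by
        rw [← map_add]; congr 1; ext u; simp [curvFst_apply, curv]; abel)
      (fun c v w ↦ by
        rw [← map_smul]; congr 1; ext u; simp [curvFst_apply, curv, smul_sub, smul_add])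
      (fun v w w' ↦ by
        rw [← map_add]; congr 1; ext u; simp [curvFst_apply, curv]; abel)
      (fun c v w ↦ by
        rw [← map_smul]; congr 1; ext u; simp [curvFst_apply, curv, smul_sub, smul_add]))

lemma ricForm_apply (v w : E) : ricForm Γ z v w = traceCLM E (curvFst Γ z v w) := rfl

set_option maxSynthPendingDepth 4 in
lemma contDiffAt_curv (hΓ : ContDiffAt ℝ ∞ Γ z) (u v w : E) :
    ContDiffAt ℝ ∞ (fun y ↦ curv Γ y u v w) z := by
  have h1 : ContDiffAt ℝ ∞ (fderiv ℝ Γ) z := hΓ.fderiv_right (m := ∞) (by simp)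
  have h2 (u v w : E) : ContDiffAt ℝ ∞ (fun y ↦ fderiv ℝ Γ y u v w) z :=
    ((h1.clm_apply contDiffAt_const).clm_apply contDiffAt_const).clm_apply contDiffAt_const
  have h3 (u v w : E) : ContDiffAt ℝ ∞ (fun y ↦ Γ y u (Γ y v w)) z :=
    (hΓ.clm_apply contDiffAt_const).clm_apply (contDiffAt_apply_apply hΓ v w)
  exact (((h2 u v w).sub (h2 v u w)).add (h3 u v w)).sub (h3 v u w)

lemma contDiffAt_ricForm (hΓ : ContDiffAt ℝ ∞ Γ z) : ContDiffAt ℝ ∞ (ricForm Γ) z := by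
  refine contDiffAt_clm_apply.2 fun v ↦ contDiffAt_clm_apply.2 fun w ↦ ?_
  refine (traceCLM E).contDiff.contDiffAt.comp z (contDiffAt_clm_apply.2 fun u ↦ ?_)
  simp only [curvFst_apply]
  exact contDiffAt_curv hΓ u v w

/-- The trace of the Christoffel symbol. -/
def traceForm (Γ : E → E →L[ℝ] E →L[ℝ] E) (z : E) : E →L[ℝ] ℝ := traceCLM E ∘L Γ z

lemma traceForm_apply (v : E) : traceForm Γ z v = traceCLM E (Γ z v) := rfl

lemma contDiffAt_traceForm (hΓ : ContDiffAt ℝ ∞ Γ z) : ContDiffAt ℝ ∞ (traceForm Γ) z :=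
  contDiffAt_const.clm_comp hΓ

lemma fderiv_traceForm (hΓ : ContDiffAt ℝ ∞ Γ z) (u v : E) :
    fderiv ℝ (traceForm Γ) z u v = traceCLM E (fderiv ℝ Γ z u v) := by
  have h1 : HasFDerivAt (fun y ↦ traceForm Γ y v) _ z :=
    (traceCLM E).hasFDerivAt.comp z (hasFDerivAt_clm_apply_const
      (hΓ.differentiableAt (by simp)) v)
  exact DFunLike.congr_fun ((hasFDerivAt_clm_apply_const
    ((contDiffAt_traceForm hΓ).differentiableAt (by simp)) v).unique h1) u

/-- By the Bianchi identity the skew part of the Ricci tensor is minus the trace of the curvature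
operator. The commutator in that operator is traceless, so what remains is the exterior derivative
of `traceForm`. -/
lemma ricForm_sub_ricForm (hs : ∀ᶠ y in 𝓝 z, ∀ u v, Γ y u v = Γ y v u)
    (hΓ : ContDiffAt ℝ ∞ Γ z) (u v : E) : ricForm Γ z u v - ricForm Γ z v u =
      -(fderiv ℝ (traceForm Γ) z u v - fderiv ℝ (traceForm Γ) z v u) := by
  have h1 : curvFst Γ z u v - curvFst Γ z v u = -curvOp Γ z u v := by
    ext x
    simp only [sub_apply, neg_apply, curvFst_apply, curvOp_apply]
    rw [eq_neg_iff_add_eq_zero, ← curv_cyclic hs hΓ x u v]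
    simp only [curv]
    abel
  rw [ricForm_apply, ricForm_apply, ← map_sub, h1, map_neg, curvOp, map_sub, map_add, map_sub,
    traceCLM_mul_comm (Γ z u), fderiv_traceForm hΓ, fderiv_traceForm hΓ]
  ring

/-- The projective Schouten tensor of the connection with Christoffel symbol `Γ`. -/
def schoutenForm (Γ : E → E →L[ℝ] E →L[ℝ] E) (z : E) : E →L[ℝ] E →L[ℝ] ℝ :=
  (1 / (((Module.finrank ℝ E : ℝ) - 1) * ((Module.finrank ℝ E : ℝ) + 1))) •
    ((Module.finrank ℝ E : ℝ) • ricForm Γ z + (ricForm Γ z).flip)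

lemma schoutenForm_apply (v w : E) : schoutenForm Γ z v w =
    1 / (((Module.finrank ℝ E : ℝ) - 1) * ((Module.finrank ℝ E : ℝ) + 1)) *
      ((Module.finrank ℝ E : ℝ) * ricForm Γ z v w + ricForm Γ z w v) := rfl

lemma contDiffAt_schoutenForm (hΓ : ContDiffAt ℝ ∞ Γ z) : ContDiffAt ℝ ∞ (schoutenForm Γ) z := by
  refine contDiffAt_clm_apply.2 fun v ↦ contDiffAt_clm_apply.2 fun w ↦ ?_
  have h : ContDiffAt ℝ ∞ (fun y ↦ (Module.finrank ℝ E : ℝ) * ricForm Γ y v w + ricForm Γ y w v) z :=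
    (contDiffAt_const.mul (contDiffAt_apply_apply (contDiffAt_ricForm hΓ) v w)).add
      (contDiffAt_apply_apply (contDiffAt_ricForm hΓ) w v)
  exact contDiffAt_const.mul h

/-- Provides the potential `τ` for `tractorCurv_cyclic`. In the skew part of the Schouten tensor the
factor `N - 1` cancels, which requires `N ≠ 1` and leaves `1/(N+1)` times the skew part of Ricci. -/
lemma schoutenForm_sub_schoutenForm (hs : ∀ᶠ y in 𝓝 z, ∀ u v, Γ y u v = Γ y v u)
    (hΓ : ContDiffAt ℝ ∞ Γ z) (hE : 2 ≤ Module.finrank ℝ E) (u v : E) :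
    schoutenForm Γ z u v - schoutenForm Γ z v u =
      fderiv ℝ (fun y ↦ (-1 / ((Module.finrank ℝ E : ℝ) + 1)) • traceForm Γ y) z u v -
        fderiv ℝ (fun y ↦ (-1 / ((Module.finrank ℝ E : ℝ) + 1)) • traceForm Γ y) z v u := by
  have h := ricForm_sub_ricForm hs hΓ u v
  have h2 : (2 : ℝ) ≤ Module.finrank ℝ E := by exact_mod_cast hE
  rw [fderiv_fun_const_smul ((contDiffAt_traceForm hΓ).differentiableAt (by simp))]
  simp only [schoutenForm, smul_apply, add_apply, ContinuousLinearMap.flip_apply, smul_eq_mul]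
  have h3 : (Module.finrank ℝ E : ℝ) - 1 ≠ 0 := by linarith
  have h4 : (Module.finrank ℝ E : ℝ) + 1 ≠ 0 := by linarith
  field_simp
  linear_combination ((Module.finrank ℝ E : ℝ) - 1) * h

/-- The projectively changed Christoffel symbol has the Lie derivative changed by a trace. -/
lemma lieForm_add {υ : E → E →L[ℝ] ℝ} {Γ' : E → E →L[ℝ] E →L[ℝ] E} {ξ : E → E}
    (hΓ : ContDiffAt ℝ ∞ Γ z) (hυ : ContDiffAt ℝ ∞ υ z)
    (h : ∀ᶠ y in 𝓝 z, ∀ u v, Γ' y u v = Γ y u v + υ y u • v + υ y v • u) (u v : E) :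
    lieForm Γ' ξ z u v = lieForm Γ ξ z u v +
      (fderiv ℝ υ z (ξ z) u + υ z (fderiv ℝ ξ z u)) • v +
        (fderiv ℝ υ z (ξ z) v + υ z (fderiv ℝ ξ z v)) • u := by
  have hd (u v : E) : HasFDerivAt (fun y ↦ Γ y u v + υ y u • v + υ y v • u)
      (((fderiv ℝ Γ z).flip u).flip v + ((fderiv ℝ υ z).flip u).smulRight v +
        ((fderiv ℝ υ z).flip v).smulRight u) z :=
    ((hasFDerivAt_apply_apply hΓ u v).add
      ((hasFDerivAt_clm_apply_const (hυ.differentiableAt (by simp)) u).smul_const v)).add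
      ((hasFDerivAt_clm_apply_const (hυ.differentiableAt (by simp)) v).smul_const u)
  have hΓ' : ContDiffAt ℝ ∞ Γ' z := by
    refine contDiffAt_clm_apply.2 fun u ↦ contDiffAt_clm_apply.2 fun v ↦ ?_
    have : ContDiffAt ℝ ∞ (fun y ↦ Γ y u v + υ y u • v + υ y v • u) z :=
      ((contDiffAt_apply_apply hΓ u v).add ((hυ.clm_apply contDiffAt_const).smul
        contDiffAt_const)).add ((hυ.clm_apply contDiffAt_const).smul contDiffAt_const)
    exact this.congr_of_eventuallyEq (h.mono fun y hy ↦ hy u v)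
  have h1 := DFunLike.congr_fun ((hasFDerivAt_apply_apply hΓ' u v).unique
    ((hd u v).congr_of_eventuallyEq (h.mono fun y hy ↦ hy u v))) (ξ z)
  simp only [ContinuousLinearMap.flip_apply, add_apply, ContinuousLinearMap.smulRight_apply] at h1
  have h0 := h.self_of_nhds
  simp only [lieForm, h0, h1, map_add, map_smul]
  module

/-- The trace of the Lie derivative of a connection that preserves a volume density, along a
field whose divergence is constant. -/
lemma lieForm_eq_zero {ξ : E → E} {β : E →L[ℝ] ℝ}
    (hΓ : ContDiffAt ℝ ∞ Γ z) (hξ : ContDiffAt ℝ ∞ ξ z) (hβ : ∀ u v, lieForm Γ ξ z u v = β u • v + β v • u)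
    (hclosed : ∀ u v, fderiv ℝ (traceForm Γ) z u v = fderiv ℝ (traceForm Γ) z v u)
    (hdiv : ∀ᶠ y in 𝓝 z, traceCLM E (fderiv ℝ ξ y) + traceForm Γ y (ξ y) = 0) (u v : E) :
    lieForm Γ ξ z u v = 0 := by
  have hξ1 := (hξ.differentiableAt (by simp)).hasFDerivAt
  have hξ2 : HasFDerivAt (fderiv ℝ ξ) (fderiv ℝ (fderiv ℝ ξ) z) z :=
    ((hξ.fderiv_right (m := ∞) (by simp)).differentiableAt (by simp)).hasFDerivAt
  have h0 : β = 0 := by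
    ext u
    -- Taking the trace over `v` gives `(N+1) β u` on the right. On the left, once `hclosed`
    -- exchanges `∂_ξ τ(u)` for `∂_u τ(ξ)`, where `τ = traceForm Γ`, it gives the derivative of `div
    -- ξ` along `u`.
    have h1 : fderiv ℝ (fderiv ℝ ξ) z u + fderiv ℝ Γ z (ξ z) u - fderiv ℝ ξ z ∘L Γ z u +
        Γ z (fderiv ℝ ξ z u) + Γ z u ∘L fderiv ℝ ξ z =
          β u • ContinuousLinearMap.id ℝ E + β.smulRight u := by
      ext v
      exact hβ u v
    have h2 := congrArg (traceCLM E) h1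
    rw [map_add, map_add, map_sub, map_add, map_add, map_smul, traceCLM_id, traceCLM_smulRight,
      traceCLM_mul_comm (fderiv ℝ ξ z)] at h2
    have h3 : HasFDerivAt (fun y ↦ traceCLM E (fderiv ℝ ξ y) + traceForm Γ y (ξ y)) _ z :=
      ((traceCLM E).hasFDerivAt.comp z hξ2).add
        (((contDiffAt_traceForm hΓ).differentiableAt (by simp)).hasFDerivAt.clm_apply hξ1)
    have h4 : HasFDerivAt (fun y ↦ traceCLM E (fderiv ℝ ξ y) + traceForm Γ y (ξ y))
        (0 : E →L[ℝ] ℝ) z :=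
      (hasFDerivAt_const (0 : ℝ) z).congr_of_eventuallyEq hdiv
    have h5 := DFunLike.congr_fun (h3.unique h4) u
    simp only [add_apply, ContinuousLinearMap.comp_apply, ContinuousLinearMap.flip_apply,
      zero_apply] at h5
    rw [hclosed, fderiv_traceForm hΓ, traceForm_apply] at h5
    have h6 : ((Module.finrank ℝ E : ℝ) + 1) * β u = 0 := by
      simp only [smul_eq_mul] at h2
      linarith
    simpa using (mul_eq_zero.1 h6).resolve_left (by positivity)
  rw [hβ, h0]
  simp

/-- The Lie bracket of vector fields on a vector space has the expected divergence. -/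
lemma trace_fderiv_bracket {X Y : E → E} (hX : ContDiffAt ℝ ∞ X z) (hY : ContDiffAt ℝ ∞ Y z) :
    traceCLM E (fderiv ℝ (fun y ↦ fderiv ℝ Y y (X y) - fderiv ℝ X y (Y y)) z) =
      fderiv ℝ (fun y ↦ traceCLM E (fderiv ℝ Y y)) z (X z) -
        fderiv ℝ (fun y ↦ traceCLM E (fderiv ℝ X y)) z (Y z) := by
  have h1 {X : E → E} (hX : ContDiffAt ℝ ∞ X z) :
      HasFDerivAt (fderiv ℝ X) (fderiv ℝ (fderiv ℝ X) z) z :=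
    ((hX.fderiv_right (m := ∞) (by simp)).differentiableAt (by simp)).hasFDerivAt
  have h2 {X : E → E} (hX : ContDiffAt ℝ ∞ X z) : HasFDerivAt X (fderiv ℝ X z) z :=
    (hX.differentiableAt (by simp)).hasFDerivAt
  have h3 {X : E → E} (hX : ContDiffAt ℝ ∞ X z) : HasFDerivAt (fun y ↦ traceCLM E (fderiv ℝ X y))
      (traceCLM E ∘L fderiv ℝ (fderiv ℝ X) z) z := (traceCLM E).hasFDerivAt.comp z (h1 hX)
  have h4 {X : E → E} (hX : ContDiffAt ℝ ∞ X z) (v : E) :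
      (fderiv ℝ (fderiv ℝ X) z).flip v = fderiv ℝ (fderiv ℝ X) z v := by
    ext u
    exact (hX.isSymmSndFDerivAt (by simpa using ENat.LEInfty.out)) u v
  have h5 : HasFDerivAt (fun y ↦ fderiv ℝ Y y (X y) - fderiv ℝ X y (Y y)) _ z :=
    ((h1 hY).clm_apply (h2 hX)).sub ((h1 hX).clm_apply (h2 hY))
  -- The traces of `DY ∘ DX` and `DX ∘ DY` cancel; symmetry of second derivatives turns the rest
  -- into derivatives of the divergences.
  rw [h5.fderiv, (h3 hX).fderiv, (h3 hY).fderiv, h4 hX, h4 hY, map_sub, map_add, map_add,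
    traceCLM_mul_comm (fderiv ℝ Y z)]
  simp only [ContinuousLinearMap.comp_apply]
  ring

end RicciForm

/-! ### Curvature, Ricci tensor and Lie derivative on the manifold against their coordinate forms -/

section CoordinateCurvature

open Filter Bundle Set

variable {N : ℕ} {M : Type*} [TopologicalSpace M]
  [ChartedSpace (EuclideanSpace ℝ (Fin N)) M] [IsManifold (𝓡 N) ∞ M] [T2Space M]

local notation "𝔼" => EuclideanSpace ℝ (Fin N)

variable (x₀ : M)

lemma eventually_chart_symm {p : M → Prop} {y : M} (hy : y ∈ (chartAt 𝔼 x₀).source)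
    (h : ∀ᶠ y' in 𝓝 y, p y') : ∀ᶠ z in 𝓝 (chartAt 𝔼 x₀ y), z ∈ (chartAt 𝔼 x₀).target ∧
      p ((chartAt 𝔼 x₀).symm z) := by
  have h1 : Tendsto (chartAt 𝔼 x₀).symm (𝓝 (chartAt 𝔼 x₀ y)) (𝓝 y) := by
    have := (chartAt 𝔼 x₀).continuousAt_symm ((chartAt 𝔼 x₀).map_source hy)
    rwa [ContinuousAt, (chartAt 𝔼 x₀).left_inv hy] at this
  filter_upwards [(chartAt 𝔼 x₀).open_target.mem_nhds ((chartAt 𝔼 x₀).map_source hy),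
    h1.eventually h] with z hz hz' using ⟨hz, hz'⟩

/-- A property of points near the image of `y` holds if it holds at the images of the points
near `y`. -/
lemma eventually_chart {q : 𝔼 → Prop} {y : M} (hy : y ∈ (chartAt 𝔼 x₀).source)
    (h : ∀ᶠ y' in 𝓝 y, y' ∈ (chartAt 𝔼 x₀).source → q (chartAt 𝔼 x₀ y')) :
    ∀ᶠ z in 𝓝 (chartAt 𝔼 x₀ y), q z := by
  filter_upwards [eventually_chart_symm x₀ hy h] with z hz
  have := hz.2 ((chartAt 𝔼 x₀).map_target hz.1)
  rwa [(chartAt 𝔼 x₀).right_inv hz.1] at this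

/-- The field `X` is smooth near `y`. -/
def SmoothNear (X : VField N M) (y : M) : Prop :=
  ∀ᶠ y' in 𝓝 y, ContMDiffAt (𝓡 N) ((𝓡 N).prod 𝓘(ℝ, 𝔼)) ∞ (fun x ↦ TotalSpace.mk' 𝔼 x (X x)) y'

lemma SmoothFieldOn.smoothNear {X : VField N M} {U : Set M} (hX : SmoothFieldOn X U)
    (hU : IsOpen U) {y : M} (hy : y ∈ U) : SmoothNear X y := by
  filter_upwards [hU.mem_nhds hy] with y' hy' using (smoothFieldOn_iff hU).1 hX y' hy'

lemma smoothNear_extend {y : M} (v : TangentSpace (𝓡 N) y) :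
    SmoothNear (FiberBundle.extend 𝔼 v : VField N M) y := by
  obtain ⟨s, hs, h⟩ := FiberBundle.exists_contMDiffOn_extend (k := ∞) (𝓡 N) 𝔼 v
  filter_upwards [eventually_mem_nhds_iff.2 hs] with y' hy'
  exact (h y' (mem_of_mem_nhds hy')).contMDiffAt hy'

variable {x₀}

lemma SmoothNear.contDiffAt_rep {X : VField N M} {y : M} (hX : SmoothNear X y)
    (hy : y ∈ (chartAt 𝔼 x₀).source) : ContDiffAt ℝ ∞ (rep x₀ X) (chartAt 𝔼 x₀ y) :=
  (contMDiffAt_iff_rep x₀ hy).1 hX.self_of_nhds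

lemma SmoothNear.diffFieldAt {X : VField N M} {y : M} (hX : SmoothNear X y) : DiffFieldAt X y :=
  hX.self_of_nhds.mdifferentiableAt (by simp)

variable {nabla : ConnOp N M} {U : Set M} (hU : IsOpen U) (h : IsTorsionFreeConnOn nabla U)
  {y : M} (hyU : y ∈ U) (hy : y ∈ coreNhd (N := N) x₀)

include hU h hyU hy

lemma christoffel_symm_eventually : ∀ᶠ z in 𝓝 (chartAt 𝔼 x₀ y), ∀ v w,
    christoffel x₀ nabla z v w = christoffel x₀ nabla z w v := by
  refine eventually_chart x₀ (coreNhd_subset x₀ hy) ?_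
  filter_upwards [hU.mem_nhds hyU] with y' hy' hs
  exact christoffel_symm x₀ hU h hy' hs

lemma rep_nabla_eventually {W V : VField N M} (hW : SmoothNear W y) :
    rep x₀ (fun y ↦ nabla W y (V y)) =ᶠ[𝓝 (chartAt 𝔼 x₀ y)] fun z ↦
      fderiv ℝ (rep x₀ W) z (rep x₀ V z) +
        christoffel x₀ nabla z (rep x₀ W z) (rep x₀ V z) := by
  refine eventually_chart x₀ (coreNhd_subset x₀ hy) ?_
  filter_upwards [hU.mem_nhds hyU, hW.eventually_nhds] with y' hy' hW' hs
  have hW'' : SmoothNear W y' := hW'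
  rw [rep_chart x₀ hs, rep_chart x₀ hs, rep_chart x₀ hs,
    tcoord_nabla x₀ hU h.isCov hy' hs hW''.diffFieldAt]

lemma rep_mlieBracket_eventually {X Y : VField N M} (hX : SmoothNear X y)
    (hY : SmoothNear Y y) :
    rep x₀ (VectorField.mlieBracket (𝓡 N) X Y) =ᶠ[𝓝 (chartAt 𝔼 x₀ y)] fun z ↦
      fderiv ℝ (rep x₀ Y) z (rep x₀ X z) - fderiv ℝ (rep x₀ X) z (rep x₀ Y z) := by
  refine eventually_chart x₀ (coreNhd_subset x₀ hy) ?_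
  filter_upwards [hU.mem_nhds hyU, hX.eventually_nhds, hY.eventually_nhds] with y' hy' hX' hY' hs
  have hX'' : SmoothNear X y' := hX'
  have hY'' : SmoothNear Y y' := hY'
  rw [rep_chart x₀ hs, tcoord_mlieBracket x₀ hU h hy' hs hX''.diffFieldAt hY''.diffFieldAt]

lemma hasFDerivAt_rep_nabla {W V : VField N M} (hW : SmoothNear W y) (hV : SmoothNear V y) :
    DifferentiableAt ℝ (rep x₀ fun y ↦ nabla W y (V y)) (chartAt 𝔼 x₀ y) ∧
    ∀ u, fderiv ℝ (rep x₀ fun y ↦ nabla W y (V y)) (chartAt 𝔼 x₀ y) u =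
      fderiv ℝ (fderiv ℝ (rep x₀ W)) (chartAt 𝔼 x₀ y) u (rep x₀ V (chartAt 𝔼 x₀ y)) +
      fderiv ℝ (rep x₀ W) (chartAt 𝔼 x₀ y) (fderiv ℝ (rep x₀ V) (chartAt 𝔼 x₀ y) u) +
      (fderiv ℝ (christoffel x₀ nabla) (chartAt 𝔼 x₀ y) u (rep x₀ W (chartAt 𝔼 x₀ y))
        (rep x₀ V (chartAt 𝔼 x₀ y)) +
      christoffel x₀ nabla (chartAt 𝔼 x₀ y) (fderiv ℝ (rep x₀ W) (chartAt 𝔼 x₀ y) u)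
        (rep x₀ V (chartAt 𝔼 x₀ y)) +
      christoffel x₀ nabla (chartAt 𝔼 x₀ y) (rep x₀ W (chartAt 𝔼 x₀ y))
        (fderiv ℝ (rep x₀ V) (chartAt 𝔼 x₀ y) u)) := by
  have hyS := coreNhd_subset x₀ hy
  have hW1 := hW.contDiffAt_rep hyS
  have h1 := (hW1.differentiableAt (by simp)).hasFDerivAt
  have h2 := ((hV.contDiffAt_rep hyS).differentiableAt (by simp)).hasFDerivAt
  have h3 := ((hW1.fderiv_right (m := ∞) (by simp)).differentiableAt (by simp)).hasFDerivAt
  have h4 := ((contDiffAt_christoffel x₀ hU h hyU hy).differentiableAt (by simp)).hasFDerivAt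
  have h5 := ((h3.clm_apply h2).add ((h4.clm_apply h1).clm_apply h2)).congr_of_eventuallyEq
    (rep_nabla_eventually hU h hyU hy hW)
  refine ⟨h5.differentiableAt, fun u ↦ ?_⟩
  rw [h5.fderiv]
  simp
  abel

lemma hasFDerivAt_rep_mlieBracket {X Y : VField N M} (hX : SmoothNear X y)
    (hY : SmoothNear Y y) :
    DifferentiableAt ℝ (rep x₀ (VectorField.mlieBracket (𝓡 N) X Y)) (chartAt 𝔼 x₀ y) ∧
    ∀ u, fderiv ℝ (rep x₀ (VectorField.mlieBracket (𝓡 N) X Y)) (chartAt 𝔼 x₀ y) u =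
      fderiv ℝ (fderiv ℝ (rep x₀ Y)) (chartAt 𝔼 x₀ y) u (rep x₀ X (chartAt 𝔼 x₀ y)) +
      fderiv ℝ (rep x₀ Y) (chartAt 𝔼 x₀ y) (fderiv ℝ (rep x₀ X) (chartAt 𝔼 x₀ y) u) -
      (fderiv ℝ (fderiv ℝ (rep x₀ X)) (chartAt 𝔼 x₀ y) u (rep x₀ Y (chartAt 𝔼 x₀ y)) +
      fderiv ℝ (rep x₀ X) (chartAt 𝔼 x₀ y) (fderiv ℝ (rep x₀ Y) (chartAt 𝔼 x₀ y) u)) := by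
  have hyS := coreNhd_subset x₀ hy
  have hX1 := hX.contDiffAt_rep hyS
  have hY1 := hY.contDiffAt_rep hyS
  have h1 := (hX1.differentiableAt (by simp)).hasFDerivAt
  have h2 := (hY1.differentiableAt (by simp)).hasFDerivAt
  have h3 := ((hX1.fderiv_right (m := ∞) (by simp)).differentiableAt (by simp)).hasFDerivAt
  have h4 := ((hY1.fderiv_right (m := ∞) (by simp)).differentiableAt (by simp)).hasFDerivAt
  have h5 := ((h4.clm_apply h1).sub (h3.clm_apply h2)).congr_of_eventuallyEq
    (rep_mlieBracket_eventually hU h hyU hy hX hY)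
  refine ⟨h5.differentiableAt, fun u ↦ ?_⟩
  rw [h5.fderiv]
  simp
  abel

/-- The curvature in coordinates. -/
lemma tcoord_curvature (u v w : TangentSpace (𝓡 N) y) :
    tcoord x₀ y (curvature nabla y u v w) = curv (christoffel x₀ nabla) (chartAt 𝔼 x₀ y)
      (tcoord x₀ y u) (tcoord x₀ y v) (tcoord x₀ y w) := by
  have hyS := coreNhd_subset x₀ hy
  set eu : VField N M := FiberBundle.extend 𝔼 u with heu
  set ev : VField N M := FiberBundle.extend 𝔼 v with hev
  set ew : VField N M := FiberBundle.extend 𝔼 w with hew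
  have hu : SmoothNear eu y := smoothNear_extend u
  have hv : SmoothNear ev y := smoothNear_extend v
  have hw : SmoothNear ew y := smoothNear_extend w
  have hu0 : rep x₀ eu (chartAt 𝔼 x₀ y) = tcoord x₀ y u := by
    rw [rep_chart x₀ hyS, heu, FiberBundle.extend_apply_self]
  have hv0 : rep x₀ ev (chartAt 𝔼 x₀ y) = tcoord x₀ y v := by
    rw [rep_chart x₀ hyS, hev, FiberBundle.extend_apply_self]
  have hw0 : rep x₀ ew (chartAt 𝔼 x₀ y) = tcoord x₀ y w := by
    rw [rep_chart x₀ hyS, hew, FiberBundle.extend_apply_self]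
  have hwy : ew y = w := FiberBundle.extend_apply_self 𝔼 w
  have hvy : ev y = v := FiberBundle.extend_apply_self 𝔼 v
  have huy : eu y = u := FiberBundle.extend_apply_self 𝔼 u
  have h1 := hasFDerivAt_rep_nabla hU h hyU hy hw hv
  have h2 := hasFDerivAt_rep_nabla hU h hyU hy hw hu
  have h3 : tcoord x₀ y (nabla (fun y ↦ nabla ew y (ev y)) y u) = _ :=
    tcoord_nabla x₀ hU h.isCov hyU hyS ((diffFieldAt_iff_rep x₀ hyS).2 h1.1) u
  have h4 : tcoord x₀ y (nabla (fun y ↦ nabla ew y (eu y)) y v) = _ :=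
    tcoord_nabla x₀ hU h.isCov hyU hyS ((diffFieldAt_iff_rep x₀ hyS).2 h2.1) v
  have h5 := tcoord_nabla x₀ hU h.isCov hyU hyS hw.diffFieldAt
  have hsymm := christoffel_symm x₀ hU h hyU hyS
  have hD : fderiv ℝ (fderiv ℝ (rep x₀ ew)) (chartAt 𝔼 x₀ y) (tcoord x₀ y u) (tcoord x₀ y v) =
      fderiv ℝ (fderiv ℝ (rep x₀ ew)) (chartAt 𝔼 x₀ y) (tcoord x₀ y v) (tcoord x₀ y u) :=
    ((hw.contDiffAt_rep hyS).isSymmSndFDerivAt (by simpa using ENat.LEInfty.out)) _ _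
  have hd (a b c : 𝔼) : fderiv ℝ (christoffel x₀ nabla) (chartAt 𝔼 x₀ y) a b c =
      fderiv ℝ (christoffel x₀ nabla) (chartAt 𝔼 x₀ y) a c b := by
    have h2 : (fun z ↦ christoffel x₀ nabla z b c) =ᶠ[𝓝 (chartAt 𝔼 x₀ y)]
        fun z ↦ christoffel x₀ nabla z c b := by
      filter_upwards [christoffel_symm_eventually hU h hyU hy] with y hy using hy b c
    have hΓ := contDiffAt_christoffel x₀ hU h hyU hy
    exact DFunLike.congr_fun ((hasFDerivAt_apply_apply hΓ b c).unique
      ((hasFDerivAt_apply_apply hΓ c b).congr_of_eventuallyEq h2)) a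
  change tcoord x₀ y (nabla (fun y ↦ nabla ew y (ev y)) y u -
    nabla (fun y ↦ nabla ew y (eu y)) y v -
      nabla ew y (VectorField.mlieBracket (𝓡 N) eu ev y)) = _
  rw [map_sub, map_sub, h3, h4, h5, h1.2, h2.2, h5, h5,
    tcoord_mlieBracket x₀ hU h hyU hyS hu.diffFieldAt hv.diffFieldAt, hu0, hv0, hw0, hwy, huy, hvy,
    curv, hD]
  simp only [map_add, map_sub, add_apply]
  -- In `christoffel` the differentiated field comes before the direction, in `curv` after it.
  -- Symmetry of the Christoffel symbol and of its derivative reconciles the two orders.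
  rw [hd _ (tcoord x₀ y w), hd _ (tcoord x₀ y w), hsymm (tcoord x₀ y w) (tcoord x₀ y v),
    hsymm (tcoord x₀ y w) (tcoord x₀ y u),
    hsymm (tcoord x₀ y u) (christoffel x₀ nabla (chartAt 𝔼 x₀ y) (tcoord x₀ y v) _),
    hsymm (tcoord x₀ y v) (christoffel x₀ nabla (chartAt 𝔼 x₀ y) (tcoord x₀ y u) _)]
  abel

/-- The basis used in `ricci` need not be the coordinate frame at `x₀`; only the invariance of the
trace under conjugation by `tcoord` matters. -/
lemma ricci_eq (v w : TangentSpace (𝓡 N) y) :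
    ricci nabla y v w = ricForm (christoffel x₀ nabla) (chartAt 𝔼 x₀ y)
      (tcoord x₀ y v) (tcoord x₀ y w) := by
  have hyS := coreNhd_subset x₀ hy
  let C := curvFst (christoffel x₀ nabla) (chartAt 𝔼 x₀ y) (tcoord x₀ y v) (tcoord x₀ y w)
  have h1 (u : TangentSpace (𝓡 N) y) :
      curvature nabla y u v w = (tvec x₀ y ∘L (C ∘L tcoord x₀ y)) u := by
    rw [← tvec_tcoord x₀ hyS (curvature nabla y u v w), tcoord_curvature hU h hyU hy]
    simp only [ContinuousLinearMap.comp_apply, C, curvFst_apply]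
  let b : Module.Basis (Fin N) ℝ (TangentSpace (𝓡 N) y) :=
    (EuclideanSpace.basisFun (Fin N) ℝ).toBasis
  have h2 : ricci nabla y v w = LinearMap.trace ℝ (TangentSpace (𝓡 N) y)
      (tvec x₀ y ∘L (C ∘L tcoord x₀ y) : TangentSpace (𝓡 N) y →L[ℝ] TangentSpace (𝓡 N) y) := by
    rw [LinearMap.trace_eq_matrix_trace ℝ b, Matrix.trace]
    change ∑ c, b.coord c (curvature nabla y (b c) v w) = _
    refine Finset.sum_congr rfl fun c _ ↦ ?_
    rw [h1, Matrix.diag_apply, LinearMap.toMatrix_apply]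
    rfl
  rw [h2, ricForm_apply]
  have h3 : ((C ∘L tcoord x₀ y) ∘L tvec x₀ y : 𝔼 →L[ℝ] 𝔼) = C := by
    ext1 a
    simp only [ContinuousLinearMap.comp_apply, tcoord_tvec x₀ hyS]
  refine Eq.trans ?_ (congrArg (traceCLM 𝔼) h3)
  have : Module.Finite ℝ (TangentSpace (𝓡 N) y) := inferInstanceAs (Module.Finite ℝ 𝔼)
  exact (LinearMap.trace_comp_comm' (tvec (N := N) x₀ y).toLinearMap
    (C ∘L tcoord x₀ y : TangentSpace (𝓡 N) y →L[ℝ] 𝔼).toLinearMap).symm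

lemma schouten_eq (v w : TangentSpace (𝓡 N) y) :
    schouten nabla y v w = schoutenForm (christoffel x₀ nabla) (chartAt 𝔼 x₀ y)
      (tcoord x₀ y v) (tcoord x₀ y w) := by
  rw [schouten, ricci_eq hU h hyU hy, ricci_eq hU h hyU hy, schoutenForm_apply,
    finrank_euclideanSpace_fin]

/-- The Lie derivative of a connection in coordinates. -/
lemma tcoord_lieConn {ξ Y η : VField N M} (hξ : SmoothNear ξ y) (hY : SmoothNear Y y)
    (hη : SmoothNear η y) :
    tcoord x₀ y (lieConn nabla ξ Y η y) =
      lieForm (christoffel x₀ nabla) (rep x₀ ξ) (chartAt 𝔼 x₀ y)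
        (tcoord x₀ y (Y y)) (tcoord x₀ y (η y)) := by
  have hyS := coreNhd_subset x₀ hy
  have h1 := hasFDerivAt_rep_nabla hU h hyU hy hη hY
  have h2 := hasFDerivAt_rep_mlieBracket hU h hyU hy hξ hη
  have h3 : tcoord x₀ y (VectorField.mlieBracket (𝓡 N) ξ (fun y ↦ nabla η y (Y y)) y) = _ :=
    tcoord_mlieBracket x₀ hU h hyU hyS hξ.diffFieldAt ((diffFieldAt_iff_rep x₀ hyS).2 h1.1)
  have h4 := tcoord_nabla x₀ hU h.isCov hyU hyS hη.diffFieldAt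
  have h5 : tcoord x₀ y (nabla (VectorField.mlieBracket (𝓡 N) ξ η) y (Y y)) = _ :=
    tcoord_nabla x₀ hU h.isCov hyU hyS ((diffFieldAt_iff_rep x₀ hyS).2 h2.1) (Y y)
  have hsymm := christoffel_symm x₀ hU h hyU hyS
  have hD (X : VField N M) (hX : SmoothNear X y) (a b : 𝔼) :
      fderiv ℝ (fderiv ℝ (rep x₀ X)) (chartAt 𝔼 x₀ y) a b =
      fderiv ℝ (fderiv ℝ (rep x₀ X)) (chartAt 𝔼 x₀ y) b a :=
    ((hX.contDiffAt_rep hyS).isSymmSndFDerivAt (by simpa using ENat.LEInfty.out)) _ _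
  have hd (a b c : 𝔼) : fderiv ℝ (christoffel x₀ nabla) (chartAt 𝔼 x₀ y) a b c =
      fderiv ℝ (christoffel x₀ nabla) (chartAt 𝔼 x₀ y) a c b := by
    have h2 : (fun z ↦ christoffel x₀ nabla z b c) =ᶠ[𝓝 (chartAt 𝔼 x₀ y)]
        fun z ↦ christoffel x₀ nabla z c b := by
      filter_upwards [christoffel_symm_eventually hU h hyU hy] with y hy using hy b c
    have hΓ := contDiffAt_christoffel x₀ hU h hyU hy
    exact DFunLike.congr_fun ((hasFDerivAt_apply_apply hΓ b c).unique
      ((hasFDerivAt_apply_apply hΓ c b).congr_of_eventuallyEq h2)) a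
  have h6 := (rep_nabla_eventually hU h hyU hy hη (V := Y)).self_of_nhds
  have h7 := tcoord_mlieBracket x₀ hU h hyU hyS hξ.diffFieldAt hη.diffFieldAt
  have h8 := tcoord_mlieBracket x₀ hU h hyU hyS hξ.diffFieldAt hY.diffFieldAt
  rw [lieConn, map_sub, map_sub, h3, h4, h5, h1.2, h2.2, h6, h7, h8,
    ← rep_chart x₀ hyS (X := Y), ← rep_chart x₀ hyS (X := η), lieForm]
  simp only [map_add, map_sub, sub_apply]
  rw [hD η hη (rep x₀ ξ _), hd _ (rep x₀ η _), hsymm (rep x₀ η _) (rep x₀ Y _),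
    hsymm (rep x₀ Y _) (fderiv ℝ (rep x₀ ξ) _ (rep x₀ η _)),
    hsymm (fderiv ℝ (rep x₀ ξ) _ (rep x₀ Y _)) (rep x₀ η _)]
  abel

end CoordinateCurvature

/-! ### Parallel tractor endomorphisms in coordinates; brackets and independence of `i, j, k` -/

section TractorCoordinates

open Filter Bundle Set

variable {N : ℕ} {M : Type*} [TopologicalSpace M]
  [ChartedSpace (EuclideanSpace ℝ (Fin N)) M] [IsManifold (𝓡 N) ∞ M] [T2Space M]

local notation "𝔼" => EuclideanSpace ℝ (Fin N)

/-- Endomorphisms of `T_y M ⊕ ℝ` in the coordinates at `x₀`. -/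
def endRep (x₀ y : M) (a : Module.End ℝ (TangentSpace (𝓡 N) y × ℝ)) :
    EuclideanSpace ℝ (Fin N) × ℝ →L[ℝ] EuclideanSpace ℝ (Fin N) × ℝ :=
  LinearMap.toContinuousLinearMap
    (((tcoord x₀ y).toLinearMap.prodMap LinearMap.id) ∘ₗ a ∘ₗ
      ((tvec x₀ y).toLinearMap.prodMap LinearMap.id))

variable (x₀ : M)

lemma endRep_apply {y : M} (a : Module.End ℝ (TangentSpace (𝓡 N) y × ℝ)) (t : 𝔼 × ℝ) :
    endRep x₀ y a t = (tcoord x₀ y (a (tvec x₀ y t.1, t.2)).1, (a (tvec x₀ y t.1, t.2)).2) := rfl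

lemma endRep_mul {y : M} (hy : y ∈ (chartAt 𝔼 x₀).source)
    (a b : Module.End ℝ (TangentSpace (𝓡 N) y × ℝ)) :
    endRep x₀ y (a * b) = endRep x₀ y a * endRep x₀ y b := by
  refine ContinuousLinearMap.ext fun t ↦ ?_
  rw [mul_apply_eq_comp, endRep_apply, endRep_apply, endRep_apply]
  simp only [tvec_tcoord x₀ hy]
  rfl

lemma endRep_neg {y : M} (a : Module.End ℝ (TangentSpace (𝓡 N) y × ℝ)) :
    endRep x₀ y (-a) = -endRep x₀ y a := by
  refine ContinuousLinearMap.ext fun t ↦ ?_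
  rw [neg_apply, endRep_apply, endRep_apply, LinearMap.neg_apply, Prod.fst_neg, Prod.snd_neg,
    map_neg]
  rfl

lemma endRep_one {y : M} (hy : y ∈ (chartAt 𝔼 x₀).source) :
    endRep x₀ y (1 : Module.End ℝ (TangentSpace (𝓡 N) y × ℝ)) = 1 := by
  refine ContinuousLinearMap.ext fun t ↦ ?_
  rw [endRep_apply, Module.End.one_apply, tcoord_tvec x₀ hy]
  rfl

namespace TractorEnd

variable {p : ProjStructure N M}

/-- A section of `End 𝒯` in coordinates. -/
def coord (A : TractorEnd p) (nabla : p.conns) (z : EuclideanSpace ℝ (Fin N)) :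
    EuclideanSpace ℝ (Fin N) × ℝ →L[ℝ] EuclideanSpace ℝ (Fin N) × ℝ :=
  endRep x₀ _ (A.toFun nabla ((chartAt (EuclideanSpace ℝ (Fin N)) x₀).symm z))

lemma coord_chart (A : TractorEnd p) (nabla : p.conns) {y : M}
    (hy : y ∈ (chartAt 𝔼 x₀).source) :
    A.coord x₀ nabla (chartAt 𝔼 x₀ y) = endRep x₀ y (A.toFun nabla y) := by
  rw [coord, (chartAt 𝔼 x₀).left_inv hy]

lemma rep_proj (A : TractorEnd p) (nabla : p.conns) :
    rep x₀ A.proj = fun z ↦ (A.coord x₀ nabla z (0, 1)).1 := by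
  funext z
  rw [rep, A.proj_eq nabla, coord, endRep_apply, map_zero]

lemma smoothFieldOn_proj (A : TractorEnd p) : SmoothFieldOn A.proj univ := by
  refine (A.smooth ⟨p.nonempty.some, p.nonempty.some_mem⟩ 0 (fun _ ↦ 1) ?_ contMDiffOn_const).1
  exact (contMDiff_zeroSection ℝ (TangentSpace (𝓡 N) : M → Type _)).contMDiffOn

lemma smoothNear_proj (A : TractorEnd p) (y : M) : SmoothNear A.proj y :=
  A.smoothFieldOn_proj.smoothNear isOpen_univ (mem_univ y)

variable {x₀}

lemma rep_cutoff_eventually (A : TractorEnd p) (nabla : p.conns) {y : M}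
    (hy : y ∈ coreNhd (N := N) x₀) (t : 𝔼 × ℝ) :
    (rep x₀ fun x ↦ (A.toFun nabla x ((cutoff (N := N) x₀ • cfield x₀ t.1) x, t.2)).1)
      =ᶠ[𝓝 (chartAt 𝔼 x₀ y)] fun z ↦ (A.coord x₀ nabla z t).1 := by
  refine eventually_chart x₀ (coreNhd_subset x₀ hy) ?_
  filter_upwards [cutoff_smul_eventually x₀ (cfield x₀ t.1) hy] with y' hy' hs
  rw [rep_chart x₀ hs, A.coord_chart x₀ nabla hs, endRep_apply, hy']
  rfl

lemma snd_cutoff_eventually (A : TractorEnd p) (nabla : p.conns) {y : M}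
    (hy : y ∈ coreNhd (N := N) x₀) (t : 𝔼 × ℝ) :
    ((fun x ↦ (A.toFun nabla x ((cutoff (N := N) x₀ • cfield x₀ t.1) x, t.2)).2) ∘
      (chartAt 𝔼 x₀).symm) =ᶠ[𝓝 (chartAt 𝔼 x₀ y)] fun z ↦ (A.coord x₀ nabla z t).2 := by
  refine eventually_chart x₀ (coreNhd_subset x₀ hy) ?_
  filter_upwards [cutoff_smul_eventually x₀ (cfield x₀ t.1) hy] with y' hy' hs
  rw [Function.comp_apply, (chartAt 𝔼 x₀).left_inv hs, A.coord_chart x₀ nabla hs, endRep_apply,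
    hy']
  rfl

lemma contDiffAt_coord (A : TractorEnd p) (nabla : p.conns) {y : M}
    (hy : y ∈ coreNhd (N := N) x₀) : ContDiffAt ℝ ∞ (A.coord x₀ nabla) (chartAt 𝔼 x₀ y) := by
  refine contDiffAt_clm_apply.2 fun t ↦ ?_
  have h := A.smooth nabla (cutoff (N := N) x₀ • cfield x₀ t.1) (fun _ ↦ t.2)
    (smoothFieldOn_cutoff_cfield x₀ t.1) contMDiffOn_const
  exact ((h.1.contDiffAt_rep x₀ isOpen_univ (mem_univ y)
      (coreNhd_subset x₀ hy)).congr_of_eventuallyEq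
        (A.rep_cutoff_eventually nabla hy t).symm).prodMk
    ((h.2.contDiffAt_chart x₀ isOpen_univ (mem_univ y)
      (coreNhd_subset x₀ hy)).congr_of_eventuallyEq
        (A.snd_cutoff_eventually nabla hy t).symm)

/-- Parallelism is tested on the cut-off field with constant coordinates `t.1` and the constant
function `t.2`. The ordinary derivatives of this pair vanish near `y`, so only the derivative of `A`
and the commutator with the connection form survive. -/
lemma fderiv_coord {A : TractorEnd p} (hA : A.IsParallel) (nabla : p.conns) {y : M}
    (hy : y ∈ coreNhd (N := N) x₀) (u : 𝔼) :
    fderiv ℝ (A.coord x₀ nabla) (chartAt 𝔼 x₀ y) u +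
      connForm (christoffel x₀ nabla.1) (schoutenForm (christoffel x₀ nabla.1))
        (chartAt 𝔼 x₀ y) u * A.coord x₀ nabla (chartAt 𝔼 x₀ y) -
      A.coord x₀ nabla (chartAt 𝔼 x₀ y) *
        connForm (christoffel x₀ nabla.1) (schoutenForm (christoffel x₀ nabla.1))
          (chartAt 𝔼 x₀ y) u = 0 := by
  have hyS := coreNhd_subset x₀ hy
  have hT := p.torsionFree nabla.1 nabla.2
  refine ContinuousLinearMap.ext fun t ↦ ?_
  have hX := smoothFieldOn_cutoff_cfield (N := N) x₀ t.1
  have h := A.smooth nabla (cutoff (N := N) x₀ • cfield x₀ t.1) (fun _ ↦ t.2) hX contMDiffOn_const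
  have hpar := hA nabla (cutoff (N := N) x₀ • cfield x₀ t.1) (fun _ ↦ t.2) hX contMDiffOn_const y
    (tvec x₀ y u)
  have hXy : (cutoff (N := N) x₀ • cfield x₀ t.1 : VField N M) y = tvec x₀ y t.1 :=
    (cutoff_smul_eventually x₀ (cfield x₀ t.1) hy).self_of_nhds
  have hd := (hasFDerivAt_clm_apply_const
    ((A.contDiffAt_coord nabla hy).differentiableAt (by simp)) t)
  have h1 : HasFDerivAt (fun z ↦ (A.coord x₀ nabla z t).1) _ (chartAt 𝔼 x₀ y) :=
    hd.fst
  have h2 : HasFDerivAt (fun z ↦ (A.coord x₀ nabla z t).2) _ (chartAt 𝔼 x₀ y) :=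
    hd.snd
  have h3 := tcoord_nabla x₀ isOpen_univ hT.isCov (mem_univ y) hyS
    (h.1.diffFieldAt isOpen_univ (mem_univ y)) (tvec x₀ y u)
  have h4 := dForm_apply x₀ hyS
    (((smoothFunOn_iff isOpen_univ).1 h.2 y (mem_univ y)).mdifferentiableAt (by simp))
    (tvec x₀ y u)
  rw [(A.rep_cutoff_eventually nabla hy t).fderiv_eq, h1.fderiv, hXy, tcoord_tvec x₀ hyS] at h3
  rw [(A.snd_cutoff_eventually nabla hy t).fderiv_eq, h2.fderiv, tcoord_tvec x₀ hyS] at h4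
  have h5 := tcoord_nabla x₀ isOpen_univ hT.isCov (mem_univ y) hyS
    (diffFieldAt_cfield x₀ t.1 hyS) (tvec x₀ y u)
  have h6 : rep x₀ (cfield x₀ t.1) =ᶠ[𝓝 (chartAt 𝔼 x₀ y)] fun _ ↦ t.1 := by
    filter_upwards [(chartAt 𝔼 x₀).open_target.mem_nhds ((chartAt 𝔼 x₀).map_source hyS)]
      with z hz using rep_cfield x₀ t.1 hz
  rw [h6.fderiv_eq, tcoord_tvec x₀ hyS, cfield, tcoord_tvec x₀ hyS] at h5
  have h7 : nabla.1 (cutoff (N := N) x₀ • cfield x₀ t.1) y (tvec x₀ y u) =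
      tvec x₀ y (christoffel x₀ nabla.1 (chartAt 𝔼 x₀ y) t.1 u) := by
    rw [nabla_cutoff_cfield x₀ isOpen_univ hT.isCov _ (mem_univ y) hy,
      ← tvec_tcoord x₀ hyS (nabla.1 (cfield x₀ t.1) y (tvec x₀ y u))]
    congr 1
    simpa using h5
  have h8 : dForm (N := N) (fun _ : M ↦ t.2) y (tvec x₀ y u) = 0 := by
    rw [dForm_apply x₀ hyS mdifferentiableAt_const]
    have : (fun _ : M ↦ t.2) ∘ (chartAt 𝔼 x₀).symm = fun _ ↦ t.2 := rfl
    rw [this]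
    simp
  have hsymm := christoffel_symm x₀ isOpen_univ hT (mem_univ y) hyS
  have h9 : tvec x₀ y (christoffel x₀ nabla.1 (chartAt 𝔼 x₀ y) t.1 u) + t.2 • tvec x₀ y u =
      tvec x₀ y (christoffel x₀ nabla.1 (chartAt 𝔼 x₀ y) t.1 u + t.2 • u) := by
    rw [map_add, map_smul]
  simp only [tractorConn, hXy, h7, h8] at hpar
  rw [schouten_eq isOpen_univ hT (mem_univ y) hy, schouten_eq isOpen_univ hT (mem_univ y) hy,
    h9, tcoord_tvec x₀ hyS, tcoord_tvec x₀ hyS, zero_sub, h4] at hpar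
  have hpar1 := congrArg (fun q ↦ tcoord x₀ y q.1) hpar
  have hpar2 := congrArg Prod.snd hpar
  simp only [map_add, map_smul, tcoord_tvec x₀ hyS] at hpar1 hpar2
  rw [h3] at hpar1
  have hc := A.coord_chart x₀ nabla hyS
  simp only [sub_apply, add_apply, mul_apply_eq_comp, connForm_apply, hc, endRep_apply,
    zero_apply]
  ext1
  · simp only [Prod.fst_sub, Prod.fst_add, Prod.fst_zero, hsymm u, sub_eq_zero]
    rw [map_add, map_smul, ← hpar1]
    simp [add_assoc]
  · simp only [Prod.snd_sub, Prod.snd_add, Prod.snd_zero, hsymm u, sub_eq_zero]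
    rw [map_add, map_smul, ← hpar2]
    simp [sub_eq_add_neg]

lemma isParallelNear_coord {A : TractorEnd p} (hA : A.IsParallel) (nabla : p.conns) {y : M}
    (hy : y ∈ coreNhd (N := N) x₀) :
    IsParallelNear (christoffel x₀ nabla.1) (schoutenForm (christoffel x₀ nabla.1))
      (chartAt 𝔼 x₀ y) (A.coord x₀ nabla) := by
  refine eventually_chart x₀ (coreNhd_subset x₀ hy) ?_
  filter_upwards [(isOpen_coreNhd x₀).mem_nhds hy] with y' hy' _
  exact ⟨A.contDiffAt_coord nabla hy', fun u ↦ fderiv_coord hA nabla hy' u⟩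

/-- The Lie bracket of the fields underlying parallel sections of `End 𝒯`. -/
theorem mlieBracket_proj {A B : TractorEnd p} (hA : A.IsParallel) (hB : B.IsParallel)
    (nabla : p.conns) (y : M) : VectorField.mlieBracket (𝓡 N) A.proj B.proj y =
      ((B.toFun nabla y * A.toFun nabla y - A.toFun nabla y * B.toFun nabla y) (0, 1)).1 := by
  have hy := mem_coreNhd (N := N) y
  have hyS := coreNhd_subset y hy
  have hT := p.torsionFree nabla.1 nabla.2
  have h1 := tcoord_mlieBracket y isOpen_univ hT (mem_univ y) hyS
    (A.smoothNear_proj y).diffFieldAt (B.smoothNear_proj y).diffFieldAt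
  rw [A.rep_proj y nabla, B.rep_proj y nabla, (isParallelNear_coord hA nabla hy).fderiv_proj,
    (isParallelNear_coord hB nabla hy).fderiv_proj,
    christoffel_symm y isOpen_univ hT (mem_univ y) hyS] at h1
  rw [← tvec_tcoord y hyS (VectorField.mlieBracket (𝓡 N) A.proj B.proj y), h1]
  have h2 (A : Module.End ℝ (TangentSpace (𝓡 N) y × ℝ)) :
      (A (0, 1)).1 = tvec y y (endRep y y A (0, 1)).1 := by
    rw [endRep_apply, tvec_tcoord y hyS, map_zero]
  have h3 (A B : Module.End ℝ (TangentSpace (𝓡 N) y × ℝ)) :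
      endRep y y (A - B) = endRep y y A - endRep y y B := by
    refine ContinuousLinearMap.ext fun t ↦ ?_
    simp [endRep_apply]
  rw [h2, h3, endRep_mul y hyS, endRep_mul y hyS, ← A.coord_chart y nabla hyS,
    ← B.coord_chart y nabla hyS]
  congr 1
  -- The products applied to `(0, 1)` are expanded by columns: `(BA(0,1)).1 = (B(Π A, 0)).1 +
  -- (A(0,1)).2 Π B`. These are the terms of `∇_{ΠA} ΠB - ∇_{ΠB} ΠA` given by `fderiv_proj`.
  have h4 (C : 𝔼 × ℝ →L[ℝ] 𝔼 × ℝ) (t : 𝔼 × ℝ) : C t = C (t.1, 0) + t.2 • C (0, 1) := by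
    rw [← map_smul, ← map_add]
    simp
  rw [sub_apply, mul_apply_eq_comp, mul_apply_eq_comp,
    h4 (A.coord y nabla _) (B.coord y nabla _ (0, 1)),
    h4 (B.coord y nabla _) (A.coord y nabla _ (0, 1))]
  simp only [Prod.fst_sub, Prod.fst_add, Prod.smul_fst]
  abel

end TractorEnd

lemma quaternion_relations {R : Type*} [Ring R] {a b c : R} (ha : a * a = -1) (hb : b * b = -1)
    (hc : c * c = -1) (habc : a * b * c = -1) :
    a * b = c ∧ b * a = -c ∧ b * c = a ∧ c * b = -a ∧ c * a = b ∧ a * c = -b := by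
  have h1 : a * b = c := by
    have h2 := congrArg (· * c) habc
    simp only [mul_assoc, hc] at h2
    simpa using h2
  have h2 : b * a = -c := by
    have h3 : b * a * b = a := by
      have := congrArg (a * ·) hc
      simp only [← h1, ← mul_assoc, ha] at this
      simpa using this
    have h4 := congrArg (· * b) h3
    simp only [mul_assoc, hb] at h4
    rw [← h1, ← h4]
    simp
  refine ⟨h1, h2, ?_, ?_, ?_, ?_⟩
  · rw [← h1, ← mul_assoc, h2, ← h1, neg_mul, mul_assoc, hb]
    simp
  · rw [← h1, mul_assoc, hb]
    simp
  · rw [← h1, mul_assoc, h2, ← h1, mul_neg, ← mul_assoc, ha]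
    simp
  · rw [← h1, ← mul_assoc, ha]
    simp

/-- A real combination of the units squares to `-|g|²`. If its projection vanishes, `(0, 1)` is an
eigenvector with real eigenvalue `λ`, and `λ² = -|g|²` forces `g = 0`. -/
lemma linearIndependent_fst_of_quaternion {V : Type*} [AddCommGroup V] [Module ℝ V]
    {I J K : Module.End ℝ (V × ℝ)} (hI : I * I = -1) (hJ : J * J = -1) (hK : K * K = -1)
    (hIJK : I * J * K = -1) :
    LinearIndependent ℝ ![(I (0, 1)).1, (J (0, 1)).1, (K (0, 1)).1] := by
  obtain ⟨h1, h2, h3, h4, h5, h6⟩ := quaternion_relations hI hJ hK hIJK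
  rw [Fintype.linearIndependent_iff]
  intro g hg
  simp only [Fin.sum_univ_three, Matrix.cons_val_zero, Matrix.cons_val_one, Matrix.cons_val] at hg
  set A : Module.End ℝ (V × ℝ) := g 0 • I + g 1 • J + g 2 • K with hA
  have hAA : A * A = -((g 0 ^ 2 + g 1 ^ 2 + g 2 ^ 2) • 1) := by
    simp only [hA, mul_add, add_mul, smul_mul_smul_comm, hI, hJ, hK, h1, h2, h3, h4, h5, h6]
    module
  have hA1 : A (0, 1) = (A (0, 1)).2 • ((0 : V), (1 : ℝ)) := by
    ext1
    · simpa [hA] using hg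
    · simp
  have hAA' := congrArg Prod.snd (DFunLike.congr_fun hAA ((0 : V), (1 : ℝ)))
  rw [Module.End.mul_apply, hA1, map_smul, hA1] at hAA'
  simp at hAA'
  have h7 : g 0 ^ 2 + g 1 ^ 2 + g 2 ^ 2 + (A (0, 1)).2 * (A (0, 1)).2 = 0 := by linarith
  have h8 := mul_self_nonneg (A (0, 1)).2
  have h9 : g 0 ^ 2 = 0 := by nlinarith
  have h10 : g 1 ^ 2 = 0 := by nlinarith
  have h11 : g 2 ^ 2 = 0 := by nlinarith
  intro l
  fin_cases l
  exacts [pow_eq_zero_iff two_ne_zero |>.1 h9, pow_eq_zero_iff two_ne_zero |>.1 h10,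
    pow_eq_zero_iff two_ne_zero |>.1 h11]

namespace IsHypercomplex

variable {p : ProjStructure N M} {I J K : TractorEnd p} (h : IsHypercomplex I J K)
include h

lemma relations (nabla : p.conns) (y : M) :
    I.toFun nabla y * J.toFun nabla y = K.toFun nabla y ∧
    J.toFun nabla y * I.toFun nabla y = -K.toFun nabla y ∧
    J.toFun nabla y * K.toFun nabla y = I.toFun nabla y ∧
    K.toFun nabla y * J.toFun nabla y = -I.toFun nabla y ∧
    K.toFun nabla y * I.toFun nabla y = J.toFun nabla y ∧
    I.toFun nabla y * K.toFun nabla y = -J.toFun nabla y :=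
  quaternion_relations (h.sq_I nabla y) (h.sq_J nabla y) (h.sq_K nabla y) (h.mul_IJK nabla y)

/-- The fields `i`, `j`, `k` are linearly independent. -/
theorem linearIndependent (y : M) : LinearIndependent ℝ ![I.proj y, J.proj y, K.proj y] :=
  linearIndependent_fst_of_quaternion (h.sq_I _ y) (h.sq_J _ y) (h.sq_K _ y) (h.mul_IJK _ y)

variable (hI : I.IsParallel) (hJ : J.IsParallel) (hK : K.IsParallel)
include hI hJ hK

theorem mlieBracket_IJ (y : M) :
    VectorField.mlieBracket (𝓡 N) I.proj J.proj y = (-2 : ℝ) • K.proj y := by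
  have nabla : p.conns := ⟨p.nonempty.some, p.nonempty.some_mem⟩
  rw [TractorEnd.mlieBracket_proj hI hJ nabla, (h.relations nabla _).1, (h.relations nabla _).2.1, K.proj_eq nabla,
    LinearMap.sub_apply, LinearMap.neg_apply, Prod.fst_sub, Prod.fst_neg]
  module

theorem mlieBracket_JK (y : M) :
    VectorField.mlieBracket (𝓡 N) J.proj K.proj y = (-2 : ℝ) • I.proj y := by
  have nabla : p.conns := ⟨p.nonempty.some, p.nonempty.some_mem⟩
  rw [TractorEnd.mlieBracket_proj hJ hK nabla, (h.relations nabla _).2.2.1, (h.relations nabla _).2.2.2.1, I.proj_eq nabla,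
    LinearMap.sub_apply, LinearMap.neg_apply, Prod.fst_sub, Prod.fst_neg]
  module

theorem mlieBracket_KI (y : M) :
    VectorField.mlieBracket (𝓡 N) K.proj I.proj y = (-2 : ℝ) • J.proj y := by
  have nabla : p.conns := ⟨p.nonempty.some, p.nonempty.some_mem⟩
  rw [TractorEnd.mlieBracket_proj hK hI nabla, (h.relations nabla _).2.2.2.2.1, (h.relations nabla _).2.2.2.2.2, J.proj_eq nabla,
    LinearMap.sub_apply, LinearMap.neg_apply, Prod.fst_sub, Prod.fst_neg]
  module

/-- In coordinates, the Lie derivatives of the connections of the projective class along the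
fields `i`, `j`, `k` are pure trace. -/
theorem lieForm_proj {C : TractorEnd p} (hC : C.IsParallel) (hN : 2 ≤ N) (nabla : p.conns)
    {x₀ y : M} (hy : y ∈ coreNhd (N := N) x₀) :
    ∃ β : 𝔼 →L[ℝ] ℝ, ∀ u v, lieForm (christoffel x₀ nabla.1) (rep x₀ C.proj) (chartAt 𝔼 x₀ y) u v =
      β u • v + β v • u := by
  have hyS := coreNhd_subset x₀ hy
  have hT := p.torsionFree nabla.1 nabla.2
  have hΓ := contDiffAt_christoffel x₀ isOpen_univ hT (mem_univ y) hy
  have hs := christoffel_symm_eventually isOpen_univ hT (mem_univ y) hy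
  rw [C.rep_proj x₀ nabla]
  -- The potential of the skew part of the Schouten tensor is `τ = -1/(N+1)` times the trace of the
  -- Christoffel symbol.
  refine ProjTractor.lieForm_proj hΓ (contDiffAt_schoutenForm hΓ) hs
    ((contDiffAt_const (𝕜 := ℝ) (c := -1 / ((Module.finrank ℝ 𝔼 : ℝ) + 1))).smul
      (contDiffAt_traceForm hΓ)) ?_
    (TractorEnd.isParallelNear_coord hI nabla hy) (TractorEnd.isParallelNear_coord hJ nabla hy)
    (TractorEnd.isParallelNear_coord hC nabla hy) ?_ ?_ ?_
  · refine eventually_chart x₀ hyS ?_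
    filter_upwards [(isOpen_coreNhd x₀).mem_nhds hy] with y' hy' _ u v
    exact schoutenForm_sub_schoutenForm
      (christoffel_symm_eventually isOpen_univ hT (mem_univ y') hy')
      (contDiffAt_christoffel x₀ isOpen_univ hT (mem_univ y') hy') (by simpa using hN) u v
  · rw [I.coord_chart x₀ nabla hyS, J.coord_chart x₀ nabla hyS, ← endRep_mul x₀ hyS,
      ← endRep_mul x₀ hyS, (h.relations nabla _).1, (h.relations nabla _).2.1, endRep_neg, neg_neg]
  · rw [I.coord_chart x₀ nabla hyS, ← endRep_mul x₀ hyS, h.sq_I, endRep_neg, endRep_one x₀ hyS]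
  · rw [J.coord_chart x₀ nabla hyS, ← endRep_mul x₀ hyS, h.sq_J, endRep_neg, endRep_one x₀ hyS]

theorem isProjSymmetryOn {C : TractorEnd p} (hC : C.IsParallel) (hN : 2 ≤ N)
    (nabla : p.conns) : IsProjSymmetryOn nabla.1 C.proj univ := by
  intro y _
  have hy := mem_coreNhd (N := N) y
  have hyS := coreNhd_subset y hy
  have hT := p.torsionFree nabla.1 nabla.2
  obtain ⟨β, hβ⟩ := h.lieForm_proj hI hJ hK hC hN nabla hy
  refine ⟨β ∘L tcoord y y, fun Y η hY hη ↦ ?_⟩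
  rw [← tvec_tcoord y hyS (lieConn nabla.1 C.proj Y η y),
    tcoord_lieConn isOpen_univ hT (mem_univ y) hy (C.smoothNear_proj y)
      (hY.smoothNear isOpen_univ (mem_univ y)) (hη.smoothNear isOpen_univ (mem_univ y)), hβ,
    map_add, map_smul, map_smul, tvec_tcoord y hyS, tvec_tcoord y hyS]
  rfl

end IsHypercomplex

end TractorCoordinates

/-! ### Projective changes: Christoffel symbols, divergence, composition and restriction -/

section ProjectiveChange

open Filter Bundle Set

variable {N : ℕ} {M : Type*} [TopologicalSpace M]
  [ChartedSpace (EuclideanSpace ℝ (Fin N)) M] [IsManifold (𝓡 N) ∞ M] [T2Space M]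

local notation "𝔼" => EuclideanSpace ℝ (Fin N)

/-- A one-form in the coordinates at `x₀`. -/
def formRep (x₀ : M) (Υ : OneForm N M) (z : EuclideanSpace ℝ (Fin N)) :
    EuclideanSpace ℝ (Fin N) →L[ℝ] ℝ :=
  Υ ((chartAt (EuclideanSpace ℝ (Fin N)) x₀).symm z) ∘L
    tvec x₀ ((chartAt (EuclideanSpace ℝ (Fin N)) x₀).symm z)

variable {x₀ : M} {Υ : OneForm N M} {U : Set M} {y : M} {nabla nabla' : ConnOp N M}

lemma formRep_chart (hy : y ∈ (chartAt 𝔼 x₀).source) (v : 𝔼) :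
    formRep x₀ Υ (chartAt 𝔼 x₀ y) v = Υ y (tvec x₀ y v) := by
  rw [formRep, (chartAt 𝔼 x₀).left_inv hy]
  rfl

lemma formRep_rep (X : VField N M) {z : 𝔼} (hz : z ∈ (chartAt 𝔼 x₀).target) :
    formRep x₀ Υ z (rep x₀ X z) =
      Υ ((chartAt 𝔼 x₀).symm z) (X ((chartAt 𝔼 x₀).symm z)) := by
  rw [formRep, rep, ContinuousLinearMap.comp_apply, tvec_tcoord x₀ ((chartAt 𝔼 x₀).map_target hz)]

lemma SmoothFormOn.contDiffAt_formRep (h : SmoothFormOn Υ U) (hU : IsOpen U) (hyU : y ∈ U)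
    (hy : y ∈ coreNhd (N := N) x₀) :
    ContDiffAt ℝ ∞ (formRep x₀ Υ) (chartAt 𝔼 x₀ y) := by
  refine contDiffAt_clm_apply.2 fun v ↦ ?_
  have h1 := (h (cutoff (N := N) x₀ • cfield x₀ v)
    ((smoothFieldOn_cutoff_cfield x₀ v).mono (subset_univ U))).contDiffAt_chart x₀ hU hyU
      (coreNhd_subset x₀ hy)
  refine h1.congr_of_eventuallyEq (eventually_chart x₀ (coreNhd_subset x₀ hy) ?_)
  filter_upwards [cutoff_smul_eventually x₀ (cfield x₀ v) hy] with y' hy' hs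
  rw [formRep_chart hs, Function.comp_apply, (chartAt 𝔼 x₀).left_inv hs, hy']
  rfl

lemma smoothFormOn_of_formRep (hU : IsOpen U)
    (h : ∀ y ∈ U, ∃ x₀ : M, y ∈ (chartAt 𝔼 x₀).source ∧
      ContDiffAt ℝ ∞ (formRep x₀ Υ) (chartAt 𝔼 x₀ y)) : SmoothFormOn Υ U := by
  intro X hX
  rw [smoothFunOn_iff hU]
  intro y hy
  obtain ⟨x₀, hyS, h⟩ := h y hy
  rw [contMDiffAt_iff_chart x₀ hyS]
  refine (h.clm_apply (hX.contDiffAt_rep x₀ hU hy hyS)).congr_of_eventuallyEq ?_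
  filter_upwards [(chartAt 𝔼 x₀).open_target.mem_nhds ((chartAt 𝔼 x₀).map_source hyS)] with z hz
  exact (formRep_rep X hz).symm

lemma SmoothFormOn.add {Υ' : OneForm N M} (h : SmoothFormOn Υ U) (h' : SmoothFormOn Υ' U)
    (hU : IsOpen U) : SmoothFormOn (fun y ↦ Υ y + Υ' y) U := by
  intro X hX
  have h1 := (smoothFunOn_iff hU).1 (h X hX)
  have h2 := (smoothFunOn_iff hU).1 (h' X hX)
  exact (smoothFunOn_iff hU).2 fun y hy ↦ (h1 y hy).add (h2 y hy)

lemma formRep_dForm {f : M → ℝ} (hf : SmoothFunOn (N := N) f U) (hU : IsOpen U) (hyU : y ∈ U)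
    (hy : y ∈ (chartAt 𝔼 x₀).source) :
    formRep x₀ (dForm f) =ᶠ[𝓝 (chartAt 𝔼 x₀ y)] fderiv ℝ (f ∘ (chartAt 𝔼 x₀).symm) := by
  refine eventually_chart x₀ hy ?_
  filter_upwards [hU.mem_nhds hyU] with y' hy' hs
  ext1 v
  rw [formRep_chart hs, dForm_apply x₀ hs
    (((smoothFunOn_iff hU).1 hf y' hy').mdifferentiableAt (by simp)), tcoord_tvec x₀ hs]

lemma SmoothFunOn.smoothFormOn_dForm {f : M → ℝ} (hf : SmoothFunOn (N := N) f U)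
    (hU : IsOpen U) : SmoothFormOn (N := N) (dForm f) U := by
  refine smoothFormOn_of_formRep hU fun y hy ↦ ⟨y, mem_chart_source 𝔼 y, ?_⟩
  refine ContDiffAt.congr_of_eventuallyEq ?_ (formRep_dForm hf hU hy (mem_chart_source 𝔼 y))
  exact (hf.contDiffAt_chart y hU hy (mem_chart_source 𝔼 y)).fderiv_right (by simp)

/-- The Christoffel symbols of projectively related connections. -/
lemma IsProjChangeOn.christoffel (h : IsProjChangeOn nabla nabla' Υ U) (hyU : y ∈ U)
    (hy : y ∈ (chartAt 𝔼 x₀).source) (v u : 𝔼) :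
    christoffel x₀ nabla' (chartAt 𝔼 x₀ y) v u = christoffel x₀ nabla (chartAt 𝔼 x₀ y) v u +
      formRep x₀ Υ (chartAt 𝔼 x₀ y) v • u + formRep x₀ Υ (chartAt 𝔼 x₀ y) u • v := by
  have h1 (l : Fin N) : nabla' (cfield x₀ (EuclideanSpace.single l 1)) y (tvec x₀ y u) = _ :=
    h y hyU _ (diffFieldAt_cfield x₀ _ hy) (tvec x₀ y u)
  rw [christoffel_apply x₀ nabla' hy, christoffel_apply x₀ nabla hy, formRep_chart hy,
    formRep_chart hy]
  simp only [h1, map_add, map_smul, tcoord_tvec x₀ hy, cfield, smul_add, Finset.sum_add_distrib]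
  have h2 : ∑ l, v l • Υ y (tvec x₀ y u) • EuclideanSpace.single l (1 : ℝ) =
      Υ y (tvec x₀ y u) • v := by
    simp only [smul_comm (v _), ← Finset.smul_sum, sum_smul_single]
  have h3 : ∑ l, v l • Υ y (tvec x₀ y (EuclideanSpace.single l 1)) • u =
      Υ y (tvec x₀ y v) • u := by
    simp only [smul_smul, ← Finset.sum_smul]
    conv_rhs => rw [← sum_smul_single v, map_sum, map_sum]
    simp only [map_smul, smul_eq_mul]
  rw [h2, h3]
  abel

/-- The change of the Christoffel symbol in direction `v` is `Υ(v) id + Υ ⊗ v`, with trace `N Υ(v) +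
Υ(v)`; every later factor `N + 1` comes from here. -/
lemma IsProjChangeOn.traceForm (h : IsProjChangeOn nabla nabla' Υ U) (hyU : y ∈ U)
    (hy : y ∈ (chartAt 𝔼 x₀).source) (v : 𝔼) :
    traceForm (ProjTractor.christoffel x₀ nabla') (chartAt 𝔼 x₀ y) v =
      traceForm (ProjTractor.christoffel x₀ nabla) (chartAt 𝔼 x₀ y) v +
        ((N : ℝ) + 1) * formRep x₀ Υ (chartAt 𝔼 x₀ y) v := by
  have h1 : ProjTractor.christoffel x₀ nabla' (chartAt 𝔼 x₀ y) v =
      ProjTractor.christoffel x₀ nabla (chartAt 𝔼 x₀ y) v +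
        formRep x₀ Υ (chartAt 𝔼 x₀ y) v • ContinuousLinearMap.id ℝ 𝔼 +
          (formRep x₀ Υ (chartAt 𝔼 x₀ y)).smulRight v := by
    refine ContinuousLinearMap.ext fun u ↦ ?_
    exact h.christoffel hyU hy v u
  rw [traceForm_apply, h1, map_add, map_add, map_smul, traceCLM_id, traceCLM_smulRight,
    traceForm_apply, finrank_euclideanSpace_fin, smul_eq_mul]
  ring

/-- The divergence in coordinates. -/
lemma divergence_eq (hU : IsOpen U) (h : IsTorsionFreeConnOn nabla U) (hyU : y ∈ U)
    (hy : y ∈ (chartAt 𝔼 x₀).source) {ξ : VField N M} (hξ : DiffFieldAt ξ y) :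
    divergence nabla ξ y = traceCLM 𝔼 (fderiv ℝ (rep x₀ ξ) (chartAt 𝔼 x₀ y)) +
      traceForm (christoffel x₀ nabla) (chartAt 𝔼 x₀ y) (rep x₀ ξ (chartAt 𝔼 x₀ y)) := by
  have h1 : (tcoord x₀ y ∘L nabla ξ y) ∘L tvec x₀ y = fderiv ℝ (rep x₀ ξ) (chartAt 𝔼 x₀ y) +
      christoffel x₀ nabla (chartAt 𝔼 x₀ y) (rep x₀ ξ (chartAt 𝔼 x₀ y)) := by
    refine ContinuousLinearMap.ext fun u ↦ ?_
    have := tcoord_nabla x₀ hU h.isCov hyU hy hξ (tvec x₀ y u)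
    rw [tcoord_tvec x₀ hy] at this
    rw [add_apply, rep_chart x₀ hy, ← this]
    rfl
  rw [traceForm_apply, ← map_add, ← h1, divergence, traceCLM_apply]
  have h2 : nabla ξ y = tvec x₀ y ∘L (tcoord x₀ y ∘L nabla ξ y) := by
    refine ContinuousLinearMap.ext fun u ↦ ?_
    exact (tvec_tcoord x₀ hy (nabla ξ y u)).symm
  have : Module.Finite ℝ (TangentSpace (𝓡 N) y) := inferInstanceAs (Module.Finite ℝ 𝔼)
  conv_lhs => rw [h2]
  exact (LinearMap.trace_comp_comm' (tvec (N := N) x₀ y).toLinearMap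
    (tcoord x₀ y ∘L nabla ξ y : TangentSpace (𝓡 N) y →L[ℝ] 𝔼).toLinearMap).symm

lemma IsProjChangeOn.divergence (h : IsProjChangeOn nabla nabla' Υ U) (hU : IsOpen U)
    (hT : IsTorsionFreeConnOn nabla U) (hT' : IsTorsionFreeConnOn nabla' U) (hyU : y ∈ U)
    {ξ : VField N M} (hξ : DiffFieldAt ξ y) :
    divergence nabla' ξ y = divergence nabla ξ y + ((N : ℝ) + 1) * Υ y (ξ y) := by
  have hy := mem_chart_source 𝔼 y
  rw [divergence_eq hU hT hyU hy hξ, divergence_eq hU hT' hyU hy hξ, h.traceForm hyU hy,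
    formRep_chart hy, rep_chart y hy, tvec_tcoord y hy]
  ring

/-- Smoothness does not restrict formally, since a field smooth on `V` need not be smooth on `U`. It
is read off from the smooth Christoffel symbol instead. -/
lemma IsTorsionFreeConnOn.mono {V : Set M} (hT : IsTorsionFreeConnOn nabla U) (hU : IsOpen U)
    (hV : IsOpen V) (hVU : V ⊆ U) : IsTorsionFreeConnOn nabla V where
  isCov := hT.isCov.mono hVU
  smooth := by
    refine ⟨fun {X} hX y hy ↦ ?_⟩
    have hX' : SmoothFieldOn X V := hX
    have hs := mem_chart_source 𝔼 y
    refine ContMDiffAt.contMDiffWithinAt (contMDiffAt_hom y fun u ↦ ?_)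
    have h1 := (hX'.smoothNear hV hy).contDiffAt_rep hs
    have h2 := contDiffAt_christoffel y hU hT (hVU hy) (mem_coreNhd y)
    have h3 : ContDiffAt ℝ ∞ (rep y (cfield y u)) (chartAt 𝔼 y y) :=
      (contMDiffAt_iff_rep y hs).1 (contMDiffAt_cfield y u hs)
    exact (((h1.fderiv_right (m := ∞) (by simp)).clm_apply h3).add
      ((h2.clm_apply h1).clm_apply h3)).congr_of_eventuallyEq
        (rep_nabla_eventually hU hT (hVU hy) (mem_coreNhd y) (hX'.smoothNear hV hy))
  torsionFree := fun X Y x hx ↦ hT.torsionFree X Y x (hVU hx)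

/-- The connections that are projectively related to smooth torsion-free connections. -/
lemma IsProjChangeOn.isTorsionFreeConnOn (h : IsProjChangeOn nabla nabla' Υ U) (hU : IsOpen U)
    (hT : IsTorsionFreeConnOn nabla U) (hΥ : SmoothFormOn Υ U) :
    IsTorsionFreeConnOn nabla' U where
  isCov :=
    { add := by
        intro σ σ' x hσ hσ' hx
        refine ContinuousLinearMap.ext fun v ↦ ?_
        have hσσ' : DiffFieldAt (σ + σ') x := by
          have := (diffFieldAt_iff_rep x (mem_chart_source 𝔼 x)).1 hσ
          have := this.add ((diffFieldAt_iff_rep x (mem_chart_source 𝔼 x)).1 hσ')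
          refine (diffFieldAt_iff_rep x (mem_chart_source 𝔼 x)).2 (this.congr_of_eventuallyEq
            (Eventually.of_forall fun z ↦ ?_))
          exact map_add (tcoord x _) _ _
        rw [add_apply, h x hx _ hσσ', h x hx _ hσ, h x hx _ hσ', hT.isCov.add hσ hσ' hx]
        simp only [Pi.add_apply, add_apply, map_add]
        module
      leibniz := by
        intro σ g x hσ hg hx
        refine ContinuousLinearMap.ext fun v ↦ ?_
        have hgσ : DiffFieldAt (g • σ) x := by
          have h1 := (diffFieldAt_iff_rep x (mem_chart_source 𝔼 x)).1 hσ
          have h2 := (mdifferentiableAt_iff_chart x (mem_chart_source 𝔼 x)).1 hg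
          refine (diffFieldAt_iff_rep x (mem_chart_source 𝔼 x)).2 ((h2.smul h1).congr_of_eventuallyEq
            (Eventually.of_forall fun z ↦ ?_))
          exact map_smul (tcoord x _) _ _
        rw [add_apply, smul_apply, h x hx _ hgσ, h x hx _ hσ, hT.isCov.leibniz hσ hg hx]
        simp only [Pi.smul_apply', add_apply, smul_apply, map_smul,
          ContinuousLinearMap.smulRight_apply]
        module }
  smooth := by
    refine ⟨fun {X} hX y hy ↦ ?_⟩
    have hX' : SmoothFieldOn X U := hX
    refine ContMDiffAt.contMDiffWithinAt (contMDiffAt_hom y fun u ↦ ?_)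
    have hs := mem_chart_source 𝔼 y
    have h1 := (contMDiffAt_iff_rep y hs).1
      (hT.contMDiffAt_nabla hU hX' hy (contMDiffAt_cfield y u hs))
    have h2 := hΥ.contDiffAt_formRep hU hy (mem_coreNhd y)
    have h3 := hX'.contDiffAt_rep y hU hy hs
    refine ((h1.add ((h2.clm_apply (contDiffAt_const (c := u))).smul h3)).add
      ((h2.clm_apply h3).smul (contDiffAt_const (c := u)))).congr_of_eventuallyEq ?_
    refine eventually_chart y hs ?_
    filter_upwards [hU.mem_nhds hy] with y' hy' hs'
    change rep y _ _ = rep y _ _ + formRep y Υ (chartAt 𝔼 y y') u • rep y X (chartAt 𝔼 y y') +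
      formRep y Υ (chartAt 𝔼 y y') (rep y X (chartAt 𝔼 y y')) • u
    rw [rep_chart y hs', rep_chart y hs', rep_chart y hs', formRep_chart hs', formRep_chart hs',
      tvec_tcoord y hs', h y' hy' X (hX'.diffFieldAt hU hy'), map_add, map_add, map_smul, map_smul]
    simp only [cfield, tcoord_tvec y hs']
  torsionFree := by
    intro X Y x hx hX hY
    rw [h x hx _ hX, h x hx _ hY, ← hT.torsionFree X Y x hx hX hY]
    module

lemma IsProjChangeOn.trans {nabla'' : ConnOp N M} {Υ' : OneForm N M}
    (h : IsProjChangeOn nabla nabla' Υ U) (h' : IsProjChangeOn nabla' nabla'' Υ' U) :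
    IsProjChangeOn nabla nabla'' (fun y ↦ Υ y + Υ' y) U := by
  intro x hx ξ hξ v
  rw [h' x hx ξ hξ, h x hx ξ hξ, add_apply, add_apply]
  module

lemma IsProjChangeOn.symm (h : IsProjChangeOn nabla nabla' Υ U) :
    IsProjChangeOn nabla' nabla (fun y ↦ -Υ y) U := by
  intro x hx ξ hξ v
  rw [h x hx ξ hξ, neg_apply, neg_apply]
  module

lemma IsProjChangeOn.mono {V : Set M} (h : IsProjChangeOn nabla nabla' Υ U) (hV : V ⊆ U) :
    IsProjChangeOn nabla nabla' Υ V := fun x hx ↦ h x (hV hx)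

/-- Two local members are compared through their global representatives. Smoothness of `Υ` is not
recorded; for scales it follows from the potential. -/
lemma ProjStructure.MemOn.exists_isProjChangeOn {p : ProjStructure N M} (h : p.MemOn nabla U)
    (h' : p.MemOn nabla' U) : ∃ Υ : OneForm N M, IsProjChangeOn nabla nabla' Υ U := by
  obtain ⟨-, nabla₀, h₀, Υ, -, hΥ⟩ := h
  obtain ⟨-, nabla₀', h₀', Υ', -, hΥ'⟩ := h'
  obtain ⟨-, Υ'', -, hΥ''⟩ := (p.mem_iff nabla₀ h₀ nabla₀').1 h₀'
  exact ⟨_, hΥ.symm.trans ((hΥ''.mono (subset_univ U)).trans hΥ')⟩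

end ProjectiveChange

/-! ### Parallel densities, the freedom of scales, and affine symmetries -/

section Densities

open Filter Bundle Set

variable {N : ℕ} {M : Type*} [TopologicalSpace M]
  [ChartedSpace (EuclideanSpace ℝ (Fin N)) M] [IsManifold (𝓡 N) ∞ M] [T2Space M]

local notation "𝔼" => EuclideanSpace ℝ (Fin N)

variable {x₀ : M} {U V : Set M} {y : M} {nabla nabla' : ConnOp N M}

lemma sum_repr_eq_trace {ι W : Type*} [Fintype ι] [AddCommGroup W] [Module ℝ W]
    (B : Module.Basis ι ℝ W) (T : Module.End ℝ W) :
    ∑ l, B.repr (T (B l)) l = LinearMap.trace ℝ W T := by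
  classical
  rw [LinearMap.trace_eq_matrix_trace ℝ B, Matrix.trace]
  exact Finset.sum_congr rfl fun l _ ↦ by rw [Matrix.diag_apply, LinearMap.toMatrix_apply]

lemma coeff_eq_repr {X : Fin N → VField N M} (hX : IsLocalFrameOn (𝓡 N) 𝔼 ∞ X V) (hy : y ∈ V)
    (l : Fin N) (v : TangentSpace (𝓡 N) y) : hX.coeff l y v = (hX.toBasisAt hy).repr v l := by
  rw [IsLocalFrameOn.coeff, dif_pos hy]
  rfl

/-- The connection form of the determinant line in a frame. -/
lemma sum_coeff_nabla (hU : IsOpen U) (h : IsTorsionFreeConnOn nabla U) (hV : IsOpen V)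
    (hVU : V ⊆ U) {X : Fin N → VField N M} (hX : IsLocalFrameOn (𝓡 N) 𝔼 ∞ X V) (hyV : y ∈ V)
    (hy : y ∈ (chartAt 𝔼 x₀).source) (u : TangentSpace (𝓡 N) y) :
    ∑ l, hX.coeff l y (nabla (X l) y u) = ∑ l, hX.coeff l y (tvec x₀ y
      (fderiv ℝ (rep x₀ (X l)) (chartAt 𝔼 x₀ y) (tcoord x₀ y u))) +
        traceForm (christoffel x₀ nabla) (chartAt 𝔼 x₀ y) (tcoord x₀ y u) := by
  have hXs (l : Fin N) : SmoothFieldOn (X l) V := hX.contMDiffOn l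
  let C : 𝔼 →L[ℝ] 𝔼 := christoffel x₀ nabla (chartAt 𝔼 x₀ y) (tcoord x₀ y u)
  have h1 (l : Fin N) : nabla (X l) y u =
      tvec x₀ y (fderiv ℝ (rep x₀ (X l)) (chartAt 𝔼 x₀ y) (tcoord x₀ y u)) +
        (tvec x₀ y ∘L (C ∘L tcoord x₀ y)) (X l y) := by
    rw [← tvec_tcoord x₀ hy (nabla (X l) y u), tcoord_nabla x₀ hU h.isCov (hVU hyV) hy
      ((hXs l).diffFieldAt hV hyV), map_add, christoffel_symm x₀ hU h (hVU hyV) hy]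
    rfl
  simp only [h1, map_add, Finset.sum_add_distrib]
  congr 1
  have h2 := sum_repr_eq_trace (hX.toBasisAt hyV)
    (tvec x₀ y ∘L (C ∘L tcoord x₀ y) : TangentSpace (𝓡 N) y →L[ℝ] TangentSpace (𝓡 N) y).toLinearMap
  have h3 : ∑ l, hX.coeff l y ((tvec x₀ y ∘L (C ∘L tcoord x₀ y)) (X l y)) =
      LinearMap.trace ℝ (TangentSpace (𝓡 N) y)
        (tvec x₀ y ∘L (C ∘L tcoord x₀ y) :
          TangentSpace (𝓡 N) y →L[ℝ] TangentSpace (𝓡 N) y).toLinearMap := by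
    rw [← h2]
    refine Finset.sum_congr rfl fun l _ ↦ ?_
    rw [coeff_eq_repr hX hyV, IsLocalFrameOn.toBasisAt_coe]
    rfl
  rw [h3, traceForm_apply]
  have h4 : ((C ∘L tcoord x₀ y) ∘L tvec x₀ y : 𝔼 →L[ℝ] 𝔼) = C := by
    ext1 a
    simp only [ContinuousLinearMap.comp_apply, tcoord_tvec x₀ hy]
  have : Module.Finite ℝ (TangentSpace (𝓡 N) y) := inferInstanceAs (Module.Finite ℝ 𝔼)
  refine Eq.trans ?_ (congrArg (traceCLM 𝔼) h4)
  exact (LinearMap.trace_comp_comm' (tvec (N := N) x₀ y).toLinearMap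
    (C ∘L tcoord x₀ y : TangentSpace (𝓡 N) y →L[ℝ] 𝔼).toLinearMap).symm

/-- The coordinate frame of the chart at `x₀`. -/
def coordFrame (x₀ : M) (l : Fin N) : VField N M := cfield x₀ (EuclideanSpace.single l (1 : ℝ))

/-- The chart identifies tangent spaces with the model space. -/
def tcoordEquiv (x₀ : M) {y : M} (hy : y ∈ (chartAt 𝔼 x₀).source) :
    TangentSpace (𝓡 N) y ≃ₗ[ℝ] EuclideanSpace ℝ (Fin N) :=
  LinearEquiv.ofLinearMap (tcoord x₀ y).toLinearMap (tvec x₀ y).toLinearMap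
    (LinearMap.ext fun v ↦ tcoord_tvec x₀ hy v) (LinearMap.ext fun v ↦ tvec_tcoord x₀ hy v)

lemma coordFrame_eq (hy : y ∈ (chartAt 𝔼 x₀).source) (l : Fin N) : coordFrame x₀ l y =
    ((EuclideanSpace.basisFun (Fin N) ℝ).toBasis.map (tcoordEquiv x₀ hy).symm) l := by
  simp only [Module.Basis.map_apply, OrthonormalBasis.coe_toBasis, EuclideanSpace.basisFun_apply]
  rfl

lemma linearIndependent_coordFrame (hy : y ∈ (chartAt 𝔼 x₀).source) :
    LinearIndependent ℝ fun l : Fin N ↦ coordFrame x₀ l y := by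
  simp only [coordFrame_eq hy]
  exact Module.Basis.linearIndependent _

lemma isLocalFrameOn_coordFrame (hVs : V ⊆ (chartAt 𝔼 x₀).source) :
    IsLocalFrameOn (𝓡 N) 𝔼 ∞ (coordFrame (N := N) x₀) V where
  linearIndependent hy := linearIndependent_coordFrame (hVs hy)
  generating {y} hy := by
    have : (fun l : Fin N ↦ coordFrame x₀ l y) = fun l ↦
        ((EuclideanSpace.basisFun (Fin N) ℝ).toBasis.map (tcoordEquiv x₀ (hVs hy)).symm) l :=
      funext fun l ↦ coordFrame_eq (hVs hy) l
    rw [this]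
    exact (Module.Basis.span_eq _).ge
  contMDiffOn l := fun y hy ↦ (contMDiffAt_cfield x₀ _ (hVs hy)).contMDiffWithinAt

variable {w w' : ℝ} {s s' : (x : M) → (Fin N → TangentSpace (𝓡 N) x) → ℝ}

/-- The logarithmic derivative of a parallel density in the coordinate frame. -/
lemma fderiv_log_density (hU : IsOpen U) (h : IsTorsionFreeConnOn nabla U)
    (hs : IsDensityOn w s U)
    (hs0 : ∀ x ∈ U, ∀ b : Fin N → TangentSpace (𝓡 N) x, LinearIndependent ℝ b → s x b ≠ 0)
    (hpar : IsParallelDensityOn nabla w s U) (hyU : y ∈ U) (hy : y ∈ (chartAt 𝔼 x₀).source) :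
    ContDiffAt ℝ ∞ ((fun y ↦ Real.log (s y fun l ↦ coordFrame x₀ l y)) ∘ (chartAt 𝔼 x₀).symm)
      (chartAt 𝔼 x₀ y) ∧
    fderiv ℝ ((fun y ↦ Real.log (s y fun l ↦ coordFrame x₀ l y)) ∘ (chartAt 𝔼 x₀).symm)
      (chartAt 𝔼 x₀ y) =
        (-(w / ((N : ℝ) + 1))) • traceForm (christoffel x₀ nabla) (chartAt 𝔼 x₀ y) := by
  set W := U ∩ (chartAt 𝔼 x₀).source with hW
  have hWo : IsOpen W := hU.inter (chartAt 𝔼 x₀).open_source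
  have hX : IsLocalFrameOn (𝓡 N) 𝔼 ∞ (coordFrame (N := N) x₀) W :=
    isLocalFrameOn_coordFrame inter_subset_right
  set g : M → ℝ := fun y ↦ s y fun l ↦ coordFrame x₀ l y with hg
  have hgs : SmoothFunOn (N := N) g W := hs.smooth W hWo inter_subset_left _ hX
  have h1 := hgs.contDiffAt_chart x₀ hWo ⟨hyU, hy⟩ hy
  have h0 : g y ≠ 0 := hs0 y hyU _ (linearIndependent_coordFrame hy)
  have h0' : (g ∘ (chartAt 𝔼 x₀).symm) (chartAt 𝔼 x₀ y) = g y := by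
    rw [Function.comp_apply, (chartAt 𝔼 x₀).left_inv hy]
  refine ⟨h1.log (by rwa [h0']), ?_⟩
  have h2 : fderiv ℝ (fun z ↦ Real.log ((g ∘ (chartAt 𝔼 x₀).symm) z)) (chartAt 𝔼 x₀ y) = _ :=
    ((h1.differentiableAt (by simp)).hasFDerivAt.log (by rwa [h0'])).fderiv
  refine Eq.trans h2 (ContinuousLinearMap.ext fun u ↦ ?_)
  have h3 := hpar W hWo inter_subset_left _ hX y ⟨hyU, hy⟩ (tvec x₀ y u)
  have h4 : dForm (N := N) g y (tvec x₀ y u) = _ := dForm_apply x₀ hy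
    (((smoothFunOn_iff hWo).1 hgs y ⟨hyU, hy⟩).mdifferentiableAt (by simp)) (tvec x₀ y u)
  have h5 (l : Fin N) : fderiv ℝ (rep x₀ (coordFrame x₀ l)) (chartAt 𝔼 x₀ y) = 0 := by
    have : rep x₀ (coordFrame x₀ l) =ᶠ[𝓝 (chartAt 𝔼 x₀ y)]
        fun _ ↦ EuclideanSpace.single l (1 : ℝ) := by
      filter_upwards [(chartAt 𝔼 x₀).open_target.mem_nhds ((chartAt 𝔼 x₀).map_source hy)] with z hz
      exact rep_cfield x₀ _ hz
    rw [this.fderiv_eq]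
    simp
  rw [sum_coeff_nabla hU h hWo inter_subset_left hX ⟨hyU, hy⟩ hy] at h3
  change dForm (N := N) g y (tvec x₀ y u) + _ * g y = 0 at h3
  rw [h4, tcoord_tvec x₀ hy] at h3
  simp only [h5, zero_apply, map_zero, Finset.sum_const_zero, zero_add] at h3
  rw [h0', smul_apply, smul_apply, smul_eq_mul, smul_eq_mul]
  have hN : (N : ℝ) + 1 ≠ 0 := by positivity
  field_simp
  field_simp at h3
  linear_combination h3

/-- A connection that preserves a density has symmetric Ricci tensor. -/
lemma fderiv_traceForm_symm (hU : IsOpen U) (h : IsTorsionFreeConnOn nabla U) (hw : w ≠ 0)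
    (hs : IsDensityOn w s U)
    (hs0 : ∀ x ∈ U, ∀ b : Fin N → TangentSpace (𝓡 N) x, LinearIndependent ℝ b → s x b ≠ 0)
    (hpar : IsParallelDensityOn nabla w s U) (hyU : y ∈ U) (hy : y ∈ (chartAt 𝔼 x₀).source)
    (u v : 𝔼) : fderiv ℝ (traceForm (christoffel x₀ nabla)) (chartAt 𝔼 x₀ y) u v =
      fderiv ℝ (traceForm (christoffel x₀ nabla)) (chartAt 𝔼 x₀ y) v u := by
  set q := (fun y ↦ Real.log (s y fun l ↦ coordFrame x₀ l y)) ∘ (chartAt 𝔼 x₀).symm with hq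
  have h1 := (fderiv_log_density hU h hs hs0 hpar hyU hy).1
  have hN : (N : ℝ) + 1 ≠ 0 := by positivity
  -- A parallel density makes the trace of the Christoffel symbol locally exact, hence closed.
  have h2 : traceForm (christoffel x₀ nabla) =ᶠ[𝓝 (chartAt 𝔼 x₀ y)]
      fun z ↦ (-(((N : ℝ) + 1) / w)) • fderiv ℝ q z := by
    refine eventually_chart x₀ hy ?_
    filter_upwards [hU.mem_nhds hyU] with y' hy' hs'
    rw [(fderiv_log_density hU h hs hs0 hpar hy' hs').2, smul_smul]
    field_simp
    simp
  have h3 := (h1.fderiv_right (m := ∞) (by simp)).differentiableAt (by simp)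
  rw [h2.fderiv_eq, fderiv_fun_const_smul h3, smul_apply, smul_apply, smul_apply, smul_apply]
  congr 1
  exact h1.isSymmSndFDerivAt (by simpa using ENat.LEInfty.out) u v

lemma exists_linearEquiv_of_linearIndependent {b b' : Fin N → TangentSpace (𝓡 N) y}
    (hb : LinearIndependent ℝ b) (hb' : LinearIndependent ℝ b') :
    ∃ A : TangentSpace (𝓡 N) y ≃ₗ[ℝ] TangentSpace (𝓡 N) y, ∀ l, A (b l) = b' l := by
  have hc : Fintype.card (Fin N) = Module.finrank ℝ (TangentSpace (𝓡 N) y) :=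
    (Fintype.card_fin N).trans (finrank_euclideanSpace_fin (𝕜 := ℝ) (n := N)).symm
  have : Module.Finite ℝ (TangentSpace (𝓡 N) y) := inferInstanceAs (Module.Finite ℝ 𝔼)
  rcases isEmpty_or_nonempty (Fin N) with hN | hN
  · exact ⟨LinearEquiv.refl _ _, fun l ↦ hN.elim l⟩
  refine ⟨(basisOfLinearIndependentOfCardEqFinrank hb hc).equiv
    (basisOfLinearIndependentOfCardEqFinrank hb' hc) (Equiv.refl _), fun l ↦ ?_⟩
  have := (basisOfLinearIndependentOfCardEqFinrank hb hc).equiv_apply l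
    (basisOfLinearIndependentOfCardEqFinrank hb' hc) (Equiv.refl _)
  simpa using this

/-- Dividing by `w` makes the correction term under a change of frame independent of the weight. It
therefore drops out of differences, also between densities of different weights. -/
lemma log_density_comp (hs : IsDensityOn w s U)
    (hs0 : ∀ x ∈ U, ∀ b : Fin N → TangentSpace (𝓡 N) x, LinearIndependent ℝ b → s x b ≠ 0)
    (hw : w ≠ 0) (hyU : y ∈ U) {b : Fin N → TangentSpace (𝓡 N) y} (hb : LinearIndependent ℝ b)
    (A : TangentSpace (𝓡 N) y ≃ₗ[ℝ] TangentSpace (𝓡 N) y) :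
    Real.log (s y fun l ↦ A (b l)) / w = Real.log (s y b) / w - Real.log
      |LinearMap.det (A : TangentSpace (𝓡 N) y →ₗ[ℝ] TangentSpace (𝓡 N) y)| / ((N : ℝ) + 1) := by
  have h1 : 0 < |LinearMap.det (A : TangentSpace (𝓡 N) y →ₗ[ℝ] TangentSpace (𝓡 N) y)| :=
    abs_pos.2 A.isUnit_det'.ne_zero
  have hN : (N : ℝ) + 1 ≠ 0 := by positivity
  rw [hs.equivariant y hyU b hb A, Real.log_mul (Real.rpow_pos_of_pos h1 _).ne' (hs0 y hyU b hb),
    Real.log_rpow h1]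
  field_simp
  ring

/-- The quotient of suitable powers of two densities is a function. -/
lemma log_density_sub_log_density (hs : IsDensityOn w s U)
    (hs0 : ∀ x ∈ U, ∀ b : Fin N → TangentSpace (𝓡 N) x, LinearIndependent ℝ b → s x b ≠ 0)
    (hw : w ≠ 0) (hs' : IsDensityOn w' s' U)
    (hs0' : ∀ x ∈ U, ∀ b : Fin N → TangentSpace (𝓡 N) x, LinearIndependent ℝ b → s' x b ≠ 0)
    (hw' : w' ≠ 0) (hyU : y ∈ U) {b b' : Fin N → TangentSpace (𝓡 N) y}
    (hb : LinearIndependent ℝ b) (hb' : LinearIndependent ℝ b') :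
    Real.log (s y b) / w - Real.log (s' y b) / w' =
      Real.log (s y b') / w - Real.log (s' y b') / w' := by
  obtain ⟨A, hA⟩ := exists_linearEquiv_of_linearIndependent hb hb'
  have hA' : b' = fun l ↦ A (b l) := (funext hA).symm
  rw [hA', log_density_comp hs hs0 hw hyU hb, log_density_comp hs' hs0' hw' hyU hb]
  ring

/-- Two scales differ by an exact form. -/
theorem ProjStructure.IsScaleOn.exists_potential {p : ProjStructure N M} (hU : IsOpen U)
    (h : p.IsScaleOn nabla U) (h' : p.IsScaleOn nabla' U) :
    ∃ f : M → ℝ, SmoothFunOn (N := N) f U ∧ IsProjChangeOn nabla nabla' (dForm f) U := by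
  obtain ⟨hm, w, hw, s, hs, hs0, hpar⟩ := h
  obtain ⟨hm', w', hw', s', hs', hs0', hpar'⟩ := h'
  obtain ⟨Υ, hΥ⟩ := hm.exists_isProjChangeOn hm'
  -- The frame here changes with `y`, but `log_density_sub_log_density` allows a fixed coordinate
  -- frame nearby, where smoothness is visible. As `d(log s / w) = -tr Γ / (N+1)`, the derivative of
  -- `f` is `(tr Γ' - tr Γ)/(N+1) = Υ`.
  let f : M → ℝ := fun y ↦ Real.log (s y fun l ↦ coordFrame y l y) / w -
    Real.log (s' y fun l ↦ coordFrame y l y) / w'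
  have hN : (N : ℝ) + 1 ≠ 0 := by positivity
  have key (x : M) (hx : x ∈ U) : ContDiffAt ℝ ∞ (f ∘ (chartAt 𝔼 x).symm) (chartAt 𝔼 x x) ∧
      fderiv ℝ (f ∘ (chartAt 𝔼 x).symm) (chartAt 𝔼 x x) = formRep x Υ (chartAt 𝔼 x x) := by
    have hxs := mem_chart_source 𝔼 x
    have h1 := fderiv_log_density hU hm.1 hs hs0 hpar hx hxs
    have h2 := fderiv_log_density hU hm'.1 hs' hs0' hpar' hx hxs
    have h3 : f ∘ (chartAt 𝔼 x).symm =ᶠ[𝓝 (chartAt 𝔼 x x)] fun z ↦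
        w⁻¹ * ((fun y ↦ Real.log (s y fun l ↦ coordFrame x l y)) ∘ (chartAt 𝔼 x).symm) z -
        w'⁻¹ * ((fun y ↦ Real.log (s' y fun l ↦ coordFrame x l y)) ∘ (chartAt 𝔼 x).symm) z := by
      refine eventually_chart x hxs ?_
      filter_upwards [hU.mem_nhds hx] with y hy hys
      have e (F : M → ℝ) : (F ∘ (chartAt 𝔼 x).symm) (chartAt 𝔼 x y) = F y :=
        congrArg F ((chartAt 𝔼 x).left_inv hys)
      simp only [e]
      simp only [f]
      rw [log_density_sub_log_density hs hs0 hw hs' hs0' hw' hy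
        (linearIndependent_coordFrame (mem_chart_source 𝔼 y)) (linearIndependent_coordFrame hys)]
      ring
    refine ⟨((contDiffAt_const.mul h1.1).sub (contDiffAt_const.mul h2.1)).congr_of_eventuallyEq h3,
      ?_⟩
    have h4 := ((h1.1.differentiableAt (by simp)).hasFDerivAt.const_mul w⁻¹).sub
      ((h2.1.differentiableAt (by simp)).hasFDerivAt.const_mul w'⁻¹)
    refine h3.fderiv_eq.trans (Eq.trans h4.fderiv ?_)
    rw [h1.2, h2.2]
    ext1 v
    simp only [sub_apply, smul_apply, smul_eq_mul, hΥ.traceForm hx hxs]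
    field_simp
    ring
  have hf : SmoothFunOn (N := N) f U := (smoothFunOn_iff hU).2 fun x hx ↦
    (contMDiffAt_iff_chart x (mem_chart_source 𝔼 x)).2 (key x hx).1
  refine ⟨f, hf, fun x hx ξ hξ v ↦ ?_⟩
  have hxs := mem_chart_source 𝔼 x
  have hd (v : TangentSpace (𝓡 N) x) : dForm (N := N) f x v = Υ x v := by
    rw [dForm_apply x hxs (((smoothFunOn_iff hU).1 hf x hx).mdifferentiableAt (by simp)),
      (key x hx).2, formRep_chart hxs, tvec_tcoord x hxs]
  rw [hΥ x hx ξ hξ v, hd, hd]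

lemma IsDensityOn.exp_mul {f : M → ℝ} (hs : IsDensityOn w s U) (hf : SmoothFunOn (N := N) f U)
    (c : ℝ) : IsDensityOn w (fun y b ↦ Real.exp (c * f y) * s y b) U where
  equivariant y hy b hb A := by
    rw [hs.equivariant y hy b hb A]
    ring
  smooth V hV hVU X hX := by
    have h1 := (smoothFunOn_iff hV).1 (hf.mono hVU)
    have h2 := (smoothFunOn_iff hV).1 (hs.smooth V hV hVU X hX)
    refine (smoothFunOn_iff hV).2 fun y hy ↦ ?_
    have hys := mem_chart_source 𝔼 y
    rw [contMDiffAt_iff_chart y hys]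
    exact (contDiffAt_const.mul ((contMDiffAt_iff_chart y hys).1 (h1 y hy))).exp.mul
      ((contMDiffAt_iff_chart y hys).1 (h2 y hy))

lemma sum_coeff_eq_of_isProjChangeOn {Υ : OneForm N M} (h : IsProjChangeOn nabla nabla' Υ U)
    (hV : IsOpen V) (hVU : V ⊆ U) {X : Fin N → VField N M}
    (hX : IsLocalFrameOn (𝓡 N) 𝔼 ∞ X V) (hyV : y ∈ V) (u : TangentSpace (𝓡 N) y) :
    ∑ l, hX.coeff l y (nabla' (X l) y u) =
      ∑ l, hX.coeff l y (nabla (X l) y u) + ((N : ℝ) + 1) * Υ y u := by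
  have hXs (l : Fin N) : SmoothFieldOn (X l) V := hX.contMDiffOn l
  have h1 (l : Fin N) : hX.coeff l y (X l y) = 1 := by
    rw [coeff_eq_repr hX hyV]
    have := IsLocalFrameOn.toBasisAt_coe hX hyV l
    rw [← this, Module.Basis.repr_self, Finsupp.single_eq_same]
  have h2 : ∑ l, Υ y (X l y) * hX.coeff l y u = Υ y u := by
    conv_rhs => rw [← (hX.toBasisAt hyV).sum_repr u, map_sum]
    refine Finset.sum_congr rfl fun l _ ↦ ?_
    rw [coeff_eq_repr hX hyV, map_smul, smul_eq_mul, IsLocalFrameOn.toBasisAt_coe, mul_comm]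
  simp only [fun l ↦ h y (hVU hyV) (X l) ((hXs l).diffFieldAt hV hyV) u, map_add, map_smul, h1,
    Finset.sum_add_distrib, smul_eq_mul, h2, mul_one, Finset.sum_const, Finset.card_univ,
    Fintype.card_fin, nsmul_eq_mul]
  ring

/-- The trace of the connection form grows by `(N+1) df`, so the connection on weight `w` densities
grows by `w df`, which `exp(-w f)` compensates. -/
lemma IsParallelDensityOn.exp_mul {f : M → ℝ} (hpar : IsParallelDensityOn nabla w s U)
    (hs : IsDensityOn w s U) (hf : SmoothFunOn (N := N) f U)
    (h : IsProjChangeOn nabla nabla' (dForm f) U) :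
    IsParallelDensityOn nabla' w (fun y b ↦ Real.exp (-w * f y) * s y b) U := by
  intro V hV hVU X hX y hy u
  have hys := mem_chart_source 𝔼 y
  have h1 := (smoothFunOn_iff hV).1 (hf.mono hVU) y hy
  have h2 := (smoothFunOn_iff hV).1 (hs.smooth V hV hVU X hX) y hy
  have h3 := (smoothFunOn_iff hV).1 ((hs.exp_mul hf (-w)).smooth V hV hVU X hX) y hy
  have h4 := hpar V hV hVU X hX y hy u
  have h1' := (((contMDiffAt_iff_chart y hys).1 h1).differentiableAt (by simp)).hasFDerivAt
  have h2' := (((contMDiffAt_iff_chart y hys).1 h2).differentiableAt (by simp)).hasFDerivAt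
  have h5 : HasFDerivAt ((fun y ↦ Real.exp (-w * f y) * s y fun l ↦ X l y) ∘ (chartAt 𝔼 y).symm)
      _ (chartAt 𝔼 y y) := (h1'.const_mul (-w)).exp.mul h2'
  have h6 : (s ((chartAt 𝔼 y).symm (chartAt 𝔼 y y))
      fun l ↦ X l ((chartAt 𝔼 y).symm (chartAt 𝔼 y y))) = s y fun l ↦ X l y :=
    congrArg (fun y ↦ s y fun l ↦ X l y) ((chartAt 𝔼 y).left_inv hys)
  have hN : (N : ℝ) + 1 ≠ 0 := by positivity
  rw [sum_coeff_eq_of_isProjChangeOn h hV hVU hX hy, dForm_apply y hys (h3.mdifferentiableAt (by simp)),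
    dForm_apply y hys (h1.mdifferentiableAt (by simp)), h5.fderiv]
  rw [dForm_apply y hys (h2.mdifferentiableAt (by simp))] at h4
  simp only [Function.comp_apply, (chartAt 𝔼 y).left_inv hys, add_apply, smul_apply, smul_eq_mul]
  rw [h6]
  field_simp
  field_simp at h4
  linear_combination (Real.exp (-(w * f y))) * h4

/-- Exact projective changes preserve scales. -/
theorem ProjStructure.IsScaleOn.of_isProjChangeOn {p : ProjStructure N M} (hU : IsOpen U)
    (h : p.IsScaleOn nabla U) {f : M → ℝ} (hf : SmoothFunOn (N := N) f U)
    (hc : IsProjChangeOn nabla nabla' (dForm f) U) : p.IsScaleOn nabla' U := by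
  obtain ⟨⟨hT, nabla₀, h₀, Υ, hΥ, hc₀⟩, w, hw, s, hs, hs0, hpar⟩ := h
  have hdf := hf.smoothFormOn_dForm hU
  exact ⟨⟨hc.isTorsionFreeConnOn hU hT hdf, nabla₀, h₀, _, hΥ.add hdf hU, hc₀.trans hc⟩,
    w, hw, _, hs.exp_mul hf (-w), fun x hx b hb ↦ mul_ne_zero (Real.exp_ne_zero _) (hs0 x hx b hb),
    hpar.exp_mul hs hf hc⟩

/-- The freedom in the choice of an adapted scale. -/
theorem isAdaptedScaleOn_iff {p : ProjStructure N M} {i j k : VField N M} (hU : IsOpen U)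
    (hi : SmoothFieldOn i U) (hj : SmoothFieldOn j U) (hk : SmoothFieldOn k U)
    (h : IsAdaptedScaleOn p i j k nabla U) :
    IsAdaptedScaleOn p i j k nabla' U ↔ ∃ f : M → ℝ, SmoothFunOn (N := N) f U ∧
      IsProjChangeOn nabla nabla' (dForm f) U ∧ ∀ x ∈ U, dForm (N := N) f x (i x) = 0 ∧
        dForm (N := N) f x (j x) = 0 ∧ dForm (N := N) f x (k x) = 0 := by
  have hN : (N : ℝ) + 1 ≠ 0 := by positivity
  constructor
  · intro h'
    obtain ⟨f, hf, hc⟩ := h.1.exists_potential hU h'.1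
    refine ⟨f, hf, hc, fun x hx ↦ ?_⟩
    have key {ξ : VField N M} (hξ : SmoothFieldOn ξ U) (h1 : divergence nabla ξ x = 0)
        (h2 : divergence nabla' ξ x = 0) : dForm (N := N) f x (ξ x) = 0 := by
      have := hc.divergence hU h.1.1.1 h'.1.1.1 hx (hξ.diffFieldAt hU hx)
      rw [h1, h2, zero_add] at this
      exact (mul_eq_zero.1 this.symm).resolve_left hN
    exact ⟨key hi (h.2 x hx).1 (h'.2 x hx).1, key hj (h.2 x hx).2.1 (h'.2 x hx).2.1,
      key hk (h.2 x hx).2.2 (h'.2 x hx).2.2⟩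
  · rintro ⟨f, hf, hc, h0⟩
    have hsc := h.1.of_isProjChangeOn hU hf hc
    refine ⟨hsc, fun x hx ↦ ?_⟩
    have key {ξ : VField N M} (hξ : SmoothFieldOn ξ U) (h1 : divergence nabla ξ x = 0)
        (h2 : dForm (N := N) f x (ξ x) = 0) : divergence nabla' ξ x = 0 := by
      rw [hc.divergence hU h.1.1.1 hsc.1.1 hx (hξ.diffFieldAt hU hx), h1, h2]
      simp
    exact ⟨key hi (h.2 x hx).1 (h0 x hx).1, key hj (h.2 x hx).2.1 (h0 x hx).2.1,
      key hk (h.2 x hx).2.2 (h0 x hx).2.2⟩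

/-- The fields of a parallel hypercomplex structure are affine symmetries of the scales for which
they are divergence-free. -/
theorem IsHypercomplex.isAffineSymmetryOn {p : ProjStructure N M} {I J K : TractorEnd p}
    (h : IsHypercomplex I J K) (hI : I.IsParallel) (hJ : J.IsParallel) (hK : K.IsParallel)
    {C : TractorEnd p} (hC : C.IsParallel) (hN : 2 ≤ N) (hU : IsOpen U)
    (hsc : p.IsScaleOn nabla U) (hdiv : ∀ x ∈ U, divergence nabla C.proj x = 0) :
    IsAffineSymmetryOn nabla C.proj U := by
  intro Y η hY hη y hyU
  obtain ⟨⟨hT, nabla₀, h₀, Υ, hΥ, hc⟩, w, hw, s, hs, hs0, hpar⟩ := hsc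
  have hy := mem_coreNhd (N := N) y
  have hys := mem_chart_source 𝔼 y
  -- The pure-trace statement is available for the connections of the class on all of `M`. Passing
  -- to the local scale changes the Lie derivative only by a further trace.
  obtain ⟨β, hβ⟩ := h.lieForm_proj hI hJ hK hC hN ⟨nabla₀, h₀⟩ hy
  have hΓ₀ := contDiffAt_christoffel y isOpen_univ (p.torsionFree nabla₀ h₀) (mem_univ y) hy
  have hΓ := contDiffAt_christoffel y hU hT hyU hy
  have hξ := (C.smoothNear_proj y).contDiffAt_rep hys
  have hadd := lieForm_add (ξ := rep y C.proj) (Γ' := christoffel y nabla) hΓ₀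
    (hΥ.contDiffAt_formRep hU hyU hy) (by
      refine eventually_chart y hys ?_
      filter_upwards [hU.mem_nhds hyU] with y' hy' hs' u v
      exact hc.christoffel hy' hs' u v)
  -- The two traces are collected in one form. It vanishes because the scale preserves a density,
  -- which makes `traceForm` closed, and because `C.proj` is divergence-free.
  have hzero := lieForm_eq_zero (β := β + (fderiv ℝ (formRep y Υ) (chartAt 𝔼 y y)
      (rep y C.proj (chartAt 𝔼 y y)) + formRep y Υ (chartAt 𝔼 y y) ∘L
        fderiv ℝ (rep y C.proj) (chartAt 𝔼 y y))) hΓ hξ (fun u v ↦ by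
      rw [hadd, hβ]
      simp only [add_apply, ContinuousLinearMap.comp_apply]
      module)
    (fun u v ↦ fderiv_traceForm_symm hU hT hw hs hs0 hpar hyU hys u v) (by
      refine eventually_chart y hys ?_
      filter_upwards [hU.mem_nhds hyU] with y' hy' hs'
      rw [← divergence_eq hU hT hy' hs'
        (C.smoothFieldOn_proj.diffFieldAt isOpen_univ (mem_univ y')), hdiv y' hy'])
  rw [← tvec_tcoord y hys (lieConn nabla C.proj Y η y), tcoord_lieConn hU hT hyU hy
    (C.smoothNear_proj y) (hY.smoothNear hU hyU) (hη.smoothNear hU hyU), hzero, map_zero]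

end Densities

/-! ### Densities with a prescribed value in a coordinate frame -/

section CoordinateDensity

open Filter Bundle Set

variable {N : ℕ}

local notation "𝔼" => EuclideanSpace ℝ (Fin N)

/-- The determinant in the standard basis. -/
def stdDet (N : ℕ) : ContinuousMultilinearMap ℝ (fun _ : Fin N ↦ EuclideanSpace ℝ (Fin N)) ℝ where
  toMultilinearMap := (EuclideanSpace.basisFun (Fin N) ℝ).toBasis.det.toMultilinearMap
  cont := by
    change Continuous fun v ↦ (EuclideanSpace.basisFun (Fin N) ℝ).toBasis.det v
    simp only [Module.Basis.det_apply]
    refine Continuous.matrix_det (continuous_matrix fun a b ↦ ?_)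
    exact ((EuclideanSpace.proj (𝕜 := ℝ) a).continuous.comp (continuous_apply b) :
      Continuous fun v : Fin N → EuclideanSpace ℝ (Fin N) ↦ v b a)

lemma stdDet_apply (v : Fin N → 𝔼) :
    stdDet N v = (EuclideanSpace.basisFun (Fin N) ℝ).toBasis.det v := rfl

/-- Cramer's rule: the derivative of the determinant of a frame becomes the trace of the derivative
of the frame, expressed in the frame itself. -/
lemma stdDet_update (B : Module.Basis (Fin N) ℝ 𝔼) (l : Fin N) (v : 𝔼) :
    stdDet N (Function.update B l v) = B.repr v l * stdDet N B := by
  conv_lhs => rw [← B.sum_repr v]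
  simp only [stdDet_apply]
  rw [AlternatingMap.map_update_sum, Finset.sum_eq_single l]
  · rw [AlternatingMap.map_update_smul, Function.update_eq_self, smul_eq_mul]
  · intro m _ hm
    rw [AlternatingMap.map_update_smul, AlternatingMap.map_update_self _ _ hm.symm, smul_zero]
  · simp

/-- The derivative of the determinant of a frame. -/
lemma hasFDerivAt_abs_stdDet {X : Fin N → 𝔼 → 𝔼} {L : Fin N → 𝔼 →L[ℝ] 𝔼} {z : 𝔼}
    (hX : ∀ l, HasFDerivAt (X l) (L l) z) (B : Module.Basis (Fin N) ℝ 𝔼) (hB : ∀ l, B l = X l z) :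
    ∃ D : 𝔼 →L[ℝ] ℝ, HasFDerivAt (fun z ↦ |stdDet N fun l ↦ X l z|) D z ∧
      ∀ u, D u = (∑ l, B.repr (L l u) l) * |stdDet N fun l ↦ X l z| := by
  have hB' : (fun l ↦ X l z) = B := funext fun l ↦ (hB l).symm
  have h0 : stdDet N (fun l ↦ X l z) ≠ 0 := by
    rw [hB', stdDet_apply]
    exact ((EuclideanSpace.basisFun (Fin N) ℝ).toBasis.isUnit_det B).ne_zero
  refine ⟨_, (HasFDerivAt.multilinear_comp (f := stdDet N) hX).abs h0, fun u ↦ ?_⟩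
  have h1 : (∑ l, (stdDet N).toContinuousLinearMap (fun j ↦ X j z) l ∘L L l) u =
      (∑ l, B.repr (L l u) l) * stdDet N fun l ↦ X l z := by
    rw [sum_apply, Finset.sum_mul]
    refine Finset.sum_congr rfl fun l _ ↦ ?_
    rw [hB', ← stdDet_update]
    rfl
  rw [smul_apply, h1, smul_eq_mul, mul_left_comm, sign_mul_self]

variable {M : Type*} [TopologicalSpace M]
  [ChartedSpace (EuclideanSpace ℝ (Fin N)) M] [IsManifold (𝓡 N) ∞ M] [T2Space M]
  {x₀ : M} {U V : Set M} {y : M} {nabla nabla' : ConnOp N M}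

/-- The density of weight `-(N+1)` that is `exp ∘ f` in the coordinate frame at `x₀`. -/
def coordDensity (x₀ : M) (f : M → ℝ) (y : M) (b : Fin N → TangentSpace (𝓡 N) y) : ℝ :=
  |stdDet N fun l ↦ tcoord x₀ y (b l)| * Real.exp (f y)

lemma stdDet_tcoord (hy : y ∈ (chartAt 𝔼 x₀).source) (b : Fin N → TangentSpace (𝓡 N) y) :
    (stdDet N fun l ↦ tcoord x₀ y (b l)) =
      ((EuclideanSpace.basisFun (Fin N) ℝ).toBasis.map (tcoordEquiv x₀ hy).symm).det b := by
  rw [Module.Basis.det_map]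
  rfl

lemma coordDensity_ne_zero (f : M → ℝ) (hy : y ∈ (chartAt 𝔼 x₀).source)
    {b : Fin N → TangentSpace (𝓡 N) y} (hb : LinearIndependent ℝ b) :
    coordDensity x₀ f y b ≠ 0 := by
  have hc : Fintype.card (Fin N) = Module.finrank ℝ (TangentSpace (𝓡 N) y) :=
    (Fintype.card_fin N).trans (finrank_euclideanSpace_fin (𝕜 := ℝ) (n := N)).symm
  have : Module.Finite ℝ (TangentSpace (𝓡 N) y) := inferInstanceAs (Module.Finite ℝ 𝔼)
  refine mul_ne_zero (abs_ne_zero.2 ?_) (Real.exp_ne_zero _)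
  rw [stdDet_tcoord hy]
  exact ((Module.Basis.is_basis_iff_det _).1
    ⟨hb, hb.span_eq_top_of_card_eq_finrank' hc⟩).ne_zero

/-- A local frame in coordinates. -/
def frameBasis {X : Fin N → VField N M} (hX : IsLocalFrameOn (𝓡 N) 𝔼 ∞ X V) (hyV : y ∈ V)
    (hy : y ∈ (chartAt 𝔼 x₀).source) :
    Module.Basis (Fin N) ℝ (EuclideanSpace ℝ (Fin N)) :=
  (hX.toBasisAt hyV).map (tcoordEquiv x₀ hy)

lemma frameBasis_apply {X : Fin N → VField N M} (hX : IsLocalFrameOn (𝓡 N) 𝔼 ∞ X V)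
    (hyV : y ∈ V) (hy : y ∈ (chartAt 𝔼 x₀).source) (l : Fin N) :
    frameBasis hX hyV hy l = rep x₀ (X l) (chartAt 𝔼 x₀ y) := by
  rw [frameBasis, Module.Basis.map_apply, IsLocalFrameOn.toBasisAt_coe, rep_chart x₀ hy]
  rfl

lemma frameBasis_repr {X : Fin N → VField N M} (hX : IsLocalFrameOn (𝓡 N) 𝔼 ∞ X V)
    (hyV : y ∈ V) (hy : y ∈ (chartAt 𝔼 x₀).source) (v : 𝔼) (l : Fin N) :
    (frameBasis hX hyV hy).repr v l = hX.coeff l y (tvec x₀ y v) := by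
  rw [coeff_eq_repr hX hyV]
  rfl

lemma contMDiffAt_coordDensity {f : M → ℝ} (hV : IsOpen V) {X : Fin N → VField N M}
    (hX : IsLocalFrameOn (𝓡 N) 𝔼 ∞ X V) (hyV : y ∈ V) (hy : y ∈ (chartAt 𝔼 x₀).source)
    (hf : ContDiffAt ℝ ∞ (f ∘ (chartAt 𝔼 x₀).symm) (chartAt 𝔼 x₀ y)) :
    ContMDiffAt (𝓡 N) 𝓘(ℝ, ℝ) ∞ (fun y ↦ coordDensity x₀ f y fun l ↦ X l y) y := by
  have hXs (l : Fin N) : SmoothFieldOn (X l) V := hX.contMDiffOn l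
  rw [contMDiffAt_iff_chart x₀ hy]
  have h1 : ContDiffAt ℝ ∞ (fun z ↦ stdDet N fun l ↦ rep x₀ (X l) z) (chartAt 𝔼 x₀ y) :=
    (stdDet N).contDiff.contDiffAt.comp _
      (contDiffAt_pi.2 fun l ↦ (hXs l).contDiffAt_rep x₀ hV hyV hy)
  have h0 : (stdDet N fun l ↦ rep x₀ (X l) (chartAt 𝔼 x₀ y)) ≠ 0 := by
    simp only [← frameBasis_apply hX hyV hy]
    exact ((EuclideanSpace.basisFun (Fin N) ℝ).toBasis.isUnit_det _).ne_zero
  exact (h1.abs h0).mul hf.exp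

lemma isDensityOn_coordDensity {f : M → ℝ} (hUs : U ⊆ (chartAt 𝔼 x₀).source)
    (hf : ∀ y ∈ U, ContDiffAt ℝ ∞ (f ∘ (chartAt 𝔼 x₀).symm) (chartAt 𝔼 x₀ y)) :
    IsDensityOn (-((N : ℝ) + 1)) (coordDensity (N := N) x₀ f) U where
  equivariant y hy b _ A := by
    have hN : (N : ℝ) + 1 ≠ 0 := by positivity
    have h1 := Module.Basis.det_comp
      ((EuclideanSpace.basisFun (Fin N) ℝ).toBasis.map (tcoordEquiv x₀ (hUs hy)).symm)
      (A : TangentSpace (𝓡 N) y →ₗ[ℝ] TangentSpace (𝓡 N) y) b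
    -- For weight `-(N+1)` the exponent `-w/(N+1)` is `1`, and the absolute value of the determinant
    -- has this equivariance.
    rw [neg_neg, div_self hN, Real.rpow_one, coordDensity, coordDensity, stdDet_tcoord (hUs hy),
      stdDet_tcoord (hUs hy), ← mul_assoc, ← abs_mul]
    exact congrArg (fun a ↦ |a| * Real.exp (f y)) h1
  smooth V hV hVU X hX := (smoothFunOn_iff hV).2 fun y hy ↦
    contMDiffAt_coordDensity hV hX hy (hUs (hVU hy)) (hf y (hVU hy))

/-- The density `coordDensity x₀ f` is parallel if the trace of the Christoffel symbol is `df`. -/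
lemma isParallelDensityOn_coordDensity {f : M → ℝ} (hU : IsOpen U)
    (hUs : U ⊆ (chartAt 𝔼 x₀).source) (h : IsTorsionFreeConnOn nabla U)
    (hf : ∀ y ∈ U, ContDiffAt ℝ ∞ (f ∘ (chartAt 𝔼 x₀).symm) (chartAt 𝔼 x₀ y))
    (htr : ∀ y ∈ U, traceForm (christoffel x₀ nabla) (chartAt 𝔼 x₀ y) =
      fderiv ℝ (f ∘ (chartAt 𝔼 x₀).symm) (chartAt 𝔼 x₀ y)) :
    IsParallelDensityOn nabla (-((N : ℝ) + 1)) (coordDensity (N := N) x₀ f) U := by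
  intro V hV hVU X hX y hyV u
  have hy := hUs (hVU hyV)
  have hXs (l : Fin N) : SmoothFieldOn (X l) V := hX.contMDiffOn l
  have hN : (N : ℝ) + 1 ≠ 0 := by positivity
  -- The logarithmic derivative of the determinant of the frame is the first summand of
  -- `sum_coeff_nabla`, and that of `exp ∘ f` is `df = traceForm`. Since `w/(N+1) = -1`, both
  -- cancel.
  obtain ⟨D, hD, hDu⟩ := hasFDerivAt_abs_stdDet (X := fun l ↦ rep x₀ (X l))
    (fun l ↦ (((hXs l).contDiffAt_rep x₀ hV hyV hy).differentiableAt (by simp)).hasFDerivAt)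
    (frameBasis hX hyV hy) (frameBasis_apply hX hyV hy)
  have h1 := hD.mul ((hf y (hVU hyV)).differentiableAt (by simp)).hasFDerivAt.exp
  have h2 : HasFDerivAt ((fun y ↦ coordDensity x₀ f y fun l ↦ X l y) ∘ (chartAt 𝔼 x₀).symm) _
    (chartAt 𝔼 x₀ y) := h1
  rw [dForm_apply x₀ hy ((contMDiffAt_coordDensity hV hX hyV hy (hf y (hVU hyV))).mdifferentiableAt
    (by simp)), h2.fderiv, sum_coeff_nabla hU h hV hVU hX hyV hy, htr y (hVU hyV), coordDensity]
  simp only [add_apply, smul_apply, smul_eq_mul, hDu, frameBasis_repr, rep_chart x₀ hy]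
  have h3 : (f ∘ (chartAt 𝔼 x₀).symm) (chartAt 𝔼 x₀ y) = f y :=
    congrArg f ((chartAt 𝔼 x₀).left_inv hy)
  rw [h3]
  field_simp
  ring

end CoordinateDensity

/-! ### Local existence of adapted scales -/

section Existence

open Filter Bundle Set

variable {N : ℕ}

local notation "𝔼" => EuclideanSpace ℝ (Fin N)

/-- The divergences of fields that span a Lie algebra form a cocycle. -/
lemma divergence_cocycle {ι : Type*} [Fintype ι] {Ω : Set 𝔼} (hΩ : IsOpen Ω) {ξ : ι → 𝔼 → 𝔼}
    (hξ : ∀ l, ContDiffOn ℝ ∞ (ξ l) Ω) (c : ι → ι → ι → ℝ)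
    (hcξ : ∀ z ∈ Ω, ∀ l m, fderiv ℝ (ξ m) z (ξ l z) - fderiv ℝ (ξ l) z (ξ m z) =
      ∑ n, c l m n • ξ n z) (a : ℝ) {z : 𝔼} (hz : z ∈ Ω) (l m : ι) :
    fderiv ℝ (fun z ↦ a * traceCLM 𝔼 (fderiv ℝ (ξ m) z)) z (ξ l z) -
      fderiv ℝ (fun z ↦ a * traceCLM 𝔼 (fderiv ℝ (ξ l) z)) z (ξ m z) =
        ∑ n, c l m n • (a * traceCLM 𝔼 (fderiv ℝ (ξ n) z)) := by
  have hat (l : ι) : ContDiffAt ℝ ∞ (ξ l) z := (hξ l).contDiffAt (hΩ.mem_nhds hz)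
  have hd (l : ι) : DifferentiableAt ℝ (fun z ↦ traceCLM 𝔼 (fderiv ℝ (ξ l) z)) z :=
    (traceCLM 𝔼).differentiableAt.comp z
      (((hat l).fderiv_right (m := ∞) (by simp)).differentiableAt (by simp))
  have h1 : (fun z ↦ fderiv ℝ (ξ m) z (ξ l z) - fderiv ℝ (ξ l) z (ξ m z)) =ᶠ[𝓝 z]
      fun z ↦ ∑ n, c l m n • ξ n z := by
    filter_upwards [hΩ.mem_nhds hz] with z' hz' using hcξ z' hz' l m
  have h2 : HasFDerivAt (fun z ↦ ∑ n, c l m n • ξ n z) (∑ n, c l m n • fderiv ℝ (ξ n) z) z :=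
    HasFDerivAt.fun_sum fun n _ ↦ ((hat n).differentiableAt (by simp)).hasFDerivAt.const_smul (c l m n)
  -- The divergence of `[ξ l, ξ m]` is computed twice: by the general formula, and from the constant
  -- structure constants, which pass through the derivative.
  have h3 := trace_fderiv_bracket (hat l) (hat m)
  rw [h1.fderiv_eq, h2.fderiv, map_sum] at h3
  rw [fderiv_const_mul (hd m), fderiv_const_mul (hd l), smul_apply, smul_apply, ← smul_sub, ← h3,
    Finset.smul_sum]
  exact Finset.sum_congr rfl fun n _ ↦ by
    rw [map_smul, smul_eq_mul, smul_eq_mul, smul_eq_mul]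
    ring

variable {M : Type*} [TopologicalSpace M]
  [ChartedSpace (EuclideanSpace ℝ (Fin N)) M] [IsManifold (𝓡 N) ∞ M] [T2Space M]

/-- The projective change of a connection by a one-form. -/
def projChange (nabla : ConnOp N M) (Υ : OneForm N M) : ConnOp N M := fun ξ y ↦
  nabla ξ y + (Υ y).smulRight (ξ y) + Υ y (ξ y) • ContinuousLinearMap.id ℝ (TangentSpace (𝓡 N) y)

lemma isProjChangeOn_projChange (nabla : ConnOp N M) (Υ : OneForm N M) (U : Set M) :
    IsProjChangeOn nabla (projChange nabla Υ) Υ U := fun _ _ _ _ _ ↦ rfl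

namespace IsHypercomplex

variable {p : ProjStructure N M} {I J K : TractorEnd p} (h : IsHypercomplex I J K)
  (hI : I.IsParallel) (hJ : J.IsParallel) (hK : K.IsParallel)
include h hI hJ hK

/-- The three brackets and their antisymmetry, in the uniform form required by
`exists_straightening`; the coefficients are the same at every point. -/
lemma exists_structureConstants : ∃ c : Fin 3 → Fin 3 → Fin 3 → ℝ, ∀ l m y,
    VectorField.mlieBracket (𝓡 N) ((![I, J, K] l).proj) ((![I, J, K] m).proj) y =
      ∑ n, c l m n • (![I, J, K] n).proj y := by
  have key (l m : Fin 3) : ∃ c : Fin 3 → ℝ, ∀ y,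
      VectorField.mlieBracket (𝓡 N) ((![I, J, K] l).proj) ((![I, J, K] m).proj) y =
        ∑ n, c n • (![I, J, K] n).proj y := by
    have hIJ := h.mlieBracket_IJ hI hJ hK
    have hJK := h.mlieBracket_JK hI hJ hK
    have hKI := h.mlieBracket_KI hI hJ hK
    have hs (X Y : VField N M) (y : M) : VectorField.mlieBracket (𝓡 N) X Y y =
      -VectorField.mlieBracket (𝓡 N) Y X y := VectorField.mlieBracket_swap_apply
    have h0 (X : VField N M) (y : M) : VectorField.mlieBracket (𝓡 N) X X y = 0 := by simp
    have hc (a b c : ℝ) (y : M) : ∑ n, ![a, b, c] n • (![I, J, K] n).proj y =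
        a • I.proj y + b • J.proj y + c • K.proj y := Fin.sum_univ_three _
    fin_cases l <;> fin_cases m
    · exact ⟨![0, 0, 0], fun y ↦ by rw [hc, h0]; module⟩
    · exact ⟨![0, 0, -2], fun y ↦ by rw [hc]; exact (hIJ y).trans (by module)⟩
    · exact ⟨![0, 2, 0], fun y ↦ by rw [hc, hs]; exact (congrArg Neg.neg (hKI y)).trans (by module)⟩
    · exact ⟨![0, 0, 2], fun y ↦ by rw [hc, hs]; exact (congrArg Neg.neg (hIJ y)).trans (by module)⟩
    · exact ⟨![0, 0, 0], fun y ↦ by rw [hc, h0]; module⟩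
    · exact ⟨![-2, 0, 0], fun y ↦ by rw [hc]; exact (hJK y).trans (by module)⟩
    · exact ⟨![0, -2, 0], fun y ↦ by rw [hc]; exact (hKI y).trans (by module)⟩
    · exact ⟨![2, 0, 0], fun y ↦ by rw [hc, hs]; exact (congrArg Neg.neg (hJK y)).trans (by module)⟩
    · exact ⟨![0, 0, 0], fun y ↦ by rw [hc, h0]; module⟩
  choose c hc using key
  exact ⟨c, fun l m y ↦ hc l m y⟩

/-- Coordinates adapted to the distribution spanned by `i`, `j`, `k`, and a function whose
derivatives along `i`, `j`, `k` are proportional to their coordinate divergences. -/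
lemma exists_adapted_coordinates (hN : 3 ≤ N) (x : M) :
    ∃ Φ : OpenPartialHomeomorph 𝔼 𝔼, chartAt 𝔼 x x ∈ Φ.target ∧
      Φ.target ⊆ (chartAt 𝔼 x).target ∩ (chartAt 𝔼 x).symm ⁻¹' coreNhd (N := N) x ∧
      ContDiffOn ℝ ∞ Φ Φ.source ∧ ContDiffOn ℝ ∞ Φ.symm Φ.target ∧
      (∀ z ∈ Φ.source, Submodule.span ℝ (Set.range fun l : Fin 3 ↦
        fderiv ℝ Φ z (EuclideanSpace.single (Fin.castLE hN l) 1)) =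
          Submodule.span ℝ (Set.range fun l ↦ rep x (![I, J, K] l).proj (Φ z))) ∧
      ∃ f : 𝔼 → ℝ, ContDiffOn ℝ ∞ f Φ.target ∧ ∀ z ∈ Φ.target, ∀ l,
        fderiv ℝ f z (rep x (![I, J, K] l).proj z) =
          -1 / ((N : ℝ) + 1) * traceCLM 𝔼 (fderiv ℝ (rep x (![I, J, K] l).proj) z) := by
  obtain ⟨c, hc⟩ := h.exists_structureConstants hI hJ hK
  have nabla : p.conns := ⟨p.nonempty.some, p.nonempty.some_mem⟩
  have hT := p.torsionFree nabla.1 nabla.2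
  have hxs := mem_chart_source 𝔼 x
  set Ω := (chartAt 𝔼 x).target ∩ (chartAt 𝔼 x).symm ⁻¹' coreNhd (N := N) x with hΩ
  have hΩo : IsOpen Ω := (chartAt 𝔼 x).isOpen_inter_preimage_symm (isOpen_coreNhd x)
  have hxΩ : chartAt 𝔼 x x ∈ Ω := ⟨(chartAt 𝔼 x).map_source hxs, by
    rw [mem_preimage, (chartAt 𝔼 x).left_inv hxs]
    exact mem_coreNhd x⟩
  have hξ (l : Fin 3) : ContDiffOn ℝ ∞ (rep x (![I, J, K] l).proj) Ω := fun z hz ↦ by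
    have := ((![I, J, K] l).smoothNear_proj ((chartAt 𝔼 x).symm z)).contDiffAt_rep
      (coreNhd_subset x hz.2)
    rw [(chartAt 𝔼 x).right_inv hz.1] at this
    exact this.contDiffWithinAt
  have hcξ : ∀ z ∈ Ω, ∀ l m, fderiv ℝ (rep x (![I, J, K] m).proj) z (rep x (![I, J, K] l).proj z) -
      fderiv ℝ (rep x (![I, J, K] l).proj) z (rep x (![I, J, K] m).proj z) =
        ∑ n, c l m n • rep x (![I, J, K] n).proj z := fun z hz l m ↦ by
    have h1 := (rep_mlieBracket_eventually isOpen_univ hT (mem_univ ((chartAt 𝔼 x).symm z)) hz.2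
      ((![I, J, K] l).smoothNear_proj _) ((![I, J, K] m).smoothNear_proj _)).self_of_nhds
    rw [(chartAt 𝔼 x).right_inv hz.1] at h1
    refine Eq.trans h1.symm ?_
    rw [rep, hc, map_sum]
    exact Finset.sum_congr rfl fun n _ ↦ map_smul _ _ _
  have hli : LinearIndependent ℝ fun l ↦ rep x (![I, J, K] l).proj (chartAt 𝔼 x x) := by
    have h1 := (h.linearIndependent x).map' (tcoordEquiv x hxs).toLinearMap (LinearEquiv.ker _)
    have h2 : (fun l ↦ rep x (![I, J, K] l).proj (chartAt 𝔼 x x)) =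
        (tcoordEquiv x hxs).toLinearMap ∘ ![I.proj x, J.proj x, K.proj x] := by
      funext l
      rw [rep_chart x hxs]
      fin_cases l <;> rfl
    rw [h2]
    exact h1
  refine exists_straightening hN hΩo hxΩ hξ
    -- A connection with `tr Γ = (N+1) df` has `div ξ = tr(Dξ) + (N+1) df(ξ)`. This prescription of
    -- `df(ξ)` makes it vanish.
    (h := fun l z ↦ -1 / ((N : ℝ) + 1) * traceCLM 𝔼 (fderiv ℝ (rep x (![I, J, K] l).proj) z))
    (fun l ↦ contDiffOn_const.mul ?_) c hcξ
    (fun z hz l m ↦ divergence_cocycle hΩo hξ c hcξ _ hz l m) hli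
  exact (traceCLM 𝔼).contDiff.comp_contDiffOn ((hξ l).fderiv_of_isOpen hΩo (by simp))

/-- Adapted scales exist locally. -/
theorem exists_isAdaptedScaleOn (hN : 3 ≤ N) (x : M) : ∃ U : Set M, IsOpen U ∧ x ∈ U ∧
    ∃ nabla : ConnOp N M, IsAdaptedScaleOn p I.proj J.proj K.proj nabla U := by
  obtain ⟨Φ, hxΦ, hΦΩ, -, -, -, f, hf, hfξ⟩ := h.exists_adapted_coordinates hI hJ hK hN x
  obtain ⟨nabla₀, h₀⟩ := p.nonempty
  have hT₀ := p.torsionFree nabla₀ h₀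
  have hN' : (N : ℝ) + 1 ≠ 0 := by positivity
  set U := (chartAt 𝔼 x).source ∩ chartAt 𝔼 x ⁻¹' Φ.target with hU
  have hUo : IsOpen U := (chartAt 𝔼 x).isOpen_inter_preimage Φ.open_target
  have hUs : U ⊆ (chartAt 𝔼 x).source := inter_subset_left
  have hUc : U ⊆ coreNhd (N := N) x := fun y hy ↦ by
    have := (hΦΩ hy.2).2
    rwa [mem_preimage, (chartAt 𝔼 x).left_inv hy.1] at this
  have hfat {y : M} (hy : y ∈ U) : ContDiffAt ℝ ∞ f (chartAt 𝔼 x y) :=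
    hf.contDiffAt (Φ.open_target.mem_nhds hy.2)
  -- A change by `υ` adds `(N+1) υ` to the trace of the Christoffel symbol. The first summand
  -- removes the old trace and the second installs `(N+1) df`.
  let υ : 𝔼 → 𝔼 →L[ℝ] ℝ := fun z ↦
    (-1 / ((N : ℝ) + 1)) • traceForm (christoffel x nabla₀) z + fderiv ℝ f z
  let Υ : OneForm N M := fun y ↦ υ (chartAt 𝔼 x y) ∘L tcoord x y
  have hΥ {y : M} (hy : y ∈ U) : formRep x Υ (chartAt 𝔼 x y) = υ (chartAt 𝔼 x y) := by
    ext1 v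
    rw [formRep_chart (hUs hy)]
    exact congrArg (υ (chartAt 𝔼 x y)) (tcoord_tvec x (hUs hy) v)
  have hΥs : SmoothFormOn Υ U := by
    refine smoothFormOn_of_formRep hUo fun y hy ↦ ⟨x, hUs hy, ?_⟩
    have h1 : ContDiffAt ℝ ∞ υ (chartAt 𝔼 x y) :=
      ((contDiffAt_traceForm (contDiffAt_christoffel x isOpen_univ hT₀ (mem_univ y)
        (hUc hy))).const_smul _).add ((hfat hy).fderiv_right (by simp))
    refine h1.congr_of_eventuallyEq (eventually_chart x (hUs hy) ?_)
    filter_upwards [hUo.mem_nhds hy] with y' hy' _ using hΥ hy'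
  have hc : IsProjChangeOn nabla₀ (projChange nabla₀ Υ) Υ U := isProjChangeOn_projChange _ _ _
  have hT₀U := hT₀.mono isOpen_univ hUo (subset_univ U)
  have hT := hc.isTorsionFreeConnOn hUo hT₀U hΥs
  have htr {y : M} (hy : y ∈ U) : traceForm (christoffel x (projChange nabla₀ Υ)) (chartAt 𝔼 x y) =
      ((N : ℝ) + 1) • fderiv ℝ f (chartAt 𝔼 x y) := by
    ext1 v
    rw [hc.traceForm hy (hUs hy), hΥ hy]
    simp only [υ, add_apply, smul_apply, smul_eq_mul]
    field_simp
    ring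
  -- The new trace is `dg`, which is what makes `coordDensity x g` parallel.
  let g : M → ℝ := fun y ↦ ((N : ℝ) + 1) * f (chartAt 𝔼 x y)
  have hg {y : M} (hy : y ∈ U) : g ∘ (chartAt 𝔼 x).symm =ᶠ[𝓝 (chartAt 𝔼 x y)]
      fun z ↦ ((N : ℝ) + 1) * f z := by
    refine eventually_chart x (hUs hy) (Eventually.of_forall fun y' hy' ↦ ?_)
    simp only [Function.comp_apply, g, (chartAt 𝔼 x).left_inv hy']
  have hgs : ∀ y ∈ U, ContDiffAt ℝ ∞ (g ∘ (chartAt 𝔼 x).symm) (chartAt 𝔼 x y) := fun y hy ↦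
    (contDiffAt_const.mul (hfat hy)).congr_of_eventuallyEq (hg hy)
  have hdiv (l : Fin 3) {y : M} (hy : y ∈ U) :
      divergence (projChange nabla₀ Υ) (![I, J, K] l).proj y = 0 := by
    rw [divergence_eq hUo hT hy (hUs hy)
      ((![I, J, K] l).smoothFieldOn_proj.diffFieldAt isOpen_univ (mem_univ y)), htr hy, smul_apply,
      hfξ _ hy.2 l, smul_eq_mul]
    field_simp
    ring
  refine ⟨U, hUo, ⟨mem_chart_source 𝔼 x, hxΦ⟩, projChange nabla₀ Υ, ⟨⟨hT, nabla₀, h₀, Υ, hΥs, hc⟩,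
    -((N : ℝ) + 1), neg_ne_zero.2 hN', coordDensity x g, isDensityOn_coordDensity hUs hgs,
    fun y hy b hb ↦ coordDensity_ne_zero g (hUs hy) hb,
    isParallelDensityOn_coordDensity hUo hUs hT hgs fun y hy ↦ ?_⟩,
    fun y hy ↦ ⟨hdiv 0 hy, hdiv 1 hy, hdiv 2 hy⟩⟩
  rw [htr hy, (hg hy).fderiv_eq, fderiv_const_mul ((hfat hy).differentiableAt (by simp))]

end IsHypercomplex

end Existence

/-! ### Integrability of the span of `i, j, k` -/

section Integrability

open Filter Bundle Set

variable {N : ℕ}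

local notation "𝔼" => EuclideanSpace ℝ (Fin N)

lemma mem_span_single_castLE_iff {r : ℕ} (hr : r ≤ N) (u : 𝔼) :
    u ∈ Submodule.span ℝ (Set.range fun l : Fin r ↦
      (EuclideanSpace.single (Fin.castLE hr l) 1 : 𝔼)) ↔ ∀ l : Fin N, r ≤ (l : ℕ) → u l = 0 := by
  constructor
  · intro hu l hl
    have h1 : Submodule.span ℝ (Set.range fun l : Fin r ↦
        (EuclideanSpace.single (Fin.castLE hr l) 1 : 𝔼)) ≤
          LinearMap.ker (EuclideanSpace.proj (𝕜 := ℝ) l : 𝔼 →L[ℝ] ℝ).toLinearMap := by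
      rw [Submodule.span_le]
      rintro _ ⟨m, rfl⟩
      have : l ≠ Fin.castLE hr m := by
        rintro rfl
        exact absurd m.2 (not_lt.2 hl)
      simp [this]
    exact h1 hu
  · intro hu
    rw [← sum_smul_single u]
    refine Submodule.sum_mem _ fun l _ ↦ ?_
    by_cases hl : r ≤ (l : ℕ)
    · rw [hu l hl, zero_smul]
      exact Submodule.zero_mem _
    · exact Submodule.smul_mem _ _ (Submodule.subset_span ⟨⟨l, not_le.1 hl⟩, rfl⟩)

lemma mem_contDiffGroupoid_of_contDiffOn {Φ : OpenPartialHomeomorph 𝔼 𝔼}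
    (h : ContDiffOn ℝ ∞ Φ Φ.source) (h' : ContDiffOn ℝ ∞ Φ.symm Φ.target) :
    Φ ∈ contDiffGroupoid ∞ (𝓡 N) := by
  rw [contDiffGroupoid, mem_groupoid_of_pregroupoid]
  simpa [contDiffPregroupoid] using ⟨h, h'⟩

variable {M : Type*} [TopologicalSpace M]
  [ChartedSpace (EuclideanSpace ℝ (Fin N)) M] [IsManifold (𝓡 N) ∞ M]

lemma trans_mem_maximalAtlas {H X : Type*} [TopologicalSpace H] [TopologicalSpace X]
    [ChartedSpace H X] {G : StructureGroupoid H} [HasGroupoid X G] {c : OpenPartialHomeomorph X H}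
    (hc : c ∈ atlas H X) {Φ : OpenPartialHomeomorph H H} (hΦ : Φ ∈ G) :
    c.trans Φ ∈ G.maximalAtlas X := by
  rw [mem_maximalAtlas_iff]
  intro e' he'
  constructor
  · rw [OpenPartialHomeomorph.trans_symm_eq_symm_trans_symm, OpenPartialHomeomorph.trans_assoc]
    exact G.trans (G.symm hΦ) (HasGroupoid.compatible hc he')
  · rw [← OpenPartialHomeomorph.trans_assoc]
    exact G.trans (HasGroupoid.compatible he' hc) hΦ

variable [T2Space M]

namespace IsHypercomplex

variable {p : ProjStructure N M} {I J K : TractorEnd p} (h : IsHypercomplex I J K)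
  (hI : I.IsParallel) (hJ : J.IsParallel) (hK : K.IsParallel)
include h hI hJ hK

/-- The distribution spanned by `i`, `j`, `k` is integrable. -/
theorem isIntegrable (hN : 3 ≤ N) :
    IsIntegrable 3 fun x : M ↦ Submodule.span ℝ {I.proj x, J.proj x, K.proj x} := by
  have hrange (x : M) : ({I.proj x, J.proj x, K.proj x} : Set (TangentSpace (𝓡 N) x)) =
      Set.range fun l ↦ (![I, J, K] l).proj x := by
    ext v
    simp only [mem_insert_iff, mem_singleton_iff, mem_range, Fin.exists_fin_succ, eq_comm (a := v)]
    simp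
  have hli (x : M) : LinearIndependent ℝ fun l ↦ (![I, J, K] l).proj x := by
    have : (fun l ↦ (![I, J, K] l).proj x) = ![I.proj x, J.proj x, K.proj x] := by
      funext l
      fin_cases l <;> rfl
    rw [this]
    exact h.linearIndependent x
  refine ⟨fun x ↦ ?_, fun x ↦ ?_⟩
  · change Module.finrank ℝ (Submodule.span ℝ {I.proj x, J.proj x, K.proj x}) = 3
    rw [hrange, finrank_span_eq_card (hli x)]
    rfl
  obtain ⟨Φ, hxΦ, hΦΩ, hΦ, hΦ', hspan, -⟩ := h.exists_adapted_coordinates hI hJ hK hN x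
  -- `Φ` carries the span of the first three coordinate directions to the distribution, so the
  -- adapted chart uses its inverse.
  refine ⟨(chartAt 𝔼 x).trans Φ.symm, trans_mem_maximalAtlas (chart_mem_atlas 𝔼 x)
    (StructureGroupoid.symm _ (mem_contDiffGroupoid_of_contDiffOn hΦ hΦ')), ?_, ?_⟩
  · rw [OpenPartialHomeomorph.trans_source]
    exact ⟨mem_chart_source 𝔼 x, hxΦ⟩
  intro y hy v
  rw [OpenPartialHomeomorph.trans_source] at hy
  obtain ⟨hys, hyΦ⟩ := hy
  set z := chartAt 𝔼 x y with hz
  change z ∈ Φ.target at hyΦ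
  have hq : Φ.symm z ∈ Φ.source := Φ.map_target hyΦ
  have hA := ((hΦ.contDiffAt (Φ.open_source.mem_nhds hq)).differentiableAt (by simp)).hasFDerivAt
  have hB := ((hΦ'.contDiffAt (Φ.open_target.mem_nhds hyΦ)).differentiableAt (by simp)).hasFDerivAt
  set A := fderiv ℝ Φ (Φ.symm z) with hAdef
  set B := fderiv ℝ Φ.symm z with hBdef
  have hAB : A ∘L B = ContinuousLinearMap.id ℝ 𝔼 := by
    refine (hA.comp z hB).unique ((hasFDerivAt_id z).congr_of_eventuallyEq ?_)
    filter_upwards [Φ.open_target.mem_nhds hyΦ] with z' hz' using Φ.right_inv hz'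
  have hBA : B ∘L A = ContinuousLinearMap.id ℝ 𝔼 := by
    have hB' : HasFDerivAt Φ.symm B (Φ (Φ.symm z)) := by rwa [Φ.right_inv hyΦ]
    refine (hB'.comp (Φ.symm z) hA).unique ((hasFDerivAt_id _).congr_of_eventuallyEq ?_)
    filter_upwards [Φ.open_source.mem_nhds hq] with z' hz' using Φ.left_inv hz'
  have hmf : mfderiv (𝓡 N) (𝓡 N) ((chartAt 𝔼 x).trans Φ.symm) y v = B (tcoord x y v) := by
    have h1 : MDifferentiableAt (𝓡 N) (𝓡 N) (chartAt 𝔼 x) y :=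
      mdifferentiableAt_atlas (chart_mem_atlas _ _) hys
    have h2 : MDifferentiableAt (𝓡 N) (𝓡 N) Φ.symm (chartAt 𝔼 x y) :=
      hB.differentiableAt.mdifferentiableAt
    rw [OpenPartialHomeomorph.coe_trans, mfderiv_comp y h2 h1, mfderiv_eq_fderiv,
      ← tcoord_eq_mfderiv x hys]
    rfl
  rw [hmf]
  have hs := hspan (Φ.symm z) hq
  rw [Φ.right_inv hyΦ] at hs
  have h1 : v ∈ Submodule.span ℝ {I.proj y, J.proj y, K.proj y} ↔ tcoord x y v ∈
      Submodule.span ℝ (Set.range fun l ↦ rep x (![I, J, K] l).proj z) := by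
    have h2 : (Set.range fun l ↦ rep x (![I, J, K] l).proj z) =
        (tcoordEquiv x hys).toLinearMap '' Set.range fun l ↦ (![I, J, K] l).proj y := by
      rw [← Set.range_comp]
      refine congrArg Set.range (funext fun l ↦ ?_)
      rw [hz, rep_chart x hys]
      rfl
    rw [hrange, h2, Submodule.span_image]
    exact ((tcoordEquiv x hys).injective.mem_set_image
      (s := (Submodule.span ℝ (Set.range fun l ↦ (![I, J, K] l).proj y) : Set _))).symm
  have h3 : tcoord x y v ∈ Submodule.span ℝ (Set.range fun l : Fin 3 ↦
      A (EuclideanSpace.single (Fin.castLE hN l) 1)) ↔ B (tcoord x y v) ∈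
        Submodule.span ℝ (Set.range fun l : Fin 3 ↦
          (EuclideanSpace.single (Fin.castLE hN l) 1 : 𝔼)) := by
    have h4 : (Set.range fun l : Fin 3 ↦ A (EuclideanSpace.single (Fin.castLE hN l) 1)) =
        A.toLinearMap '' Set.range fun l : Fin 3 ↦
          (EuclideanSpace.single (Fin.castLE hN l) 1 : 𝔼) := by
      rw [← Set.range_comp]
      rfl
    rw [h4, Submodule.span_image]
    constructor
    · rintro ⟨u, hu, huv⟩
      rw [← huv]
      have : B (A u) = u := DFunLike.congr_fun hBA u
      exact (congrArg (· ∈ Submodule.span ℝ _) this).mpr hu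
    · intro hu
      exact ⟨_, hu, DFunLike.congr_fun hAB (tcoord x y v)⟩
  rw [h1, ← hs, h3, mem_span_single_castLE_iff]
  rfl

end IsHypercomplex

end Integrability

end ProjTractor

end

/-! ### Assembly of (a), (b) and (c) in dimension `4m + 3` -/

theorem proposition3p6 (m : ℕ) (hm : 1 ≤ m) {M : Type*} [TopologicalSpace M] [T2Space M]
    [SecondCountableTopology M] [ChartedSpace (EuclideanSpace ℝ (Fin (4 * m + 3))) M]
    [IsManifold (𝓡 (4 * m + 3)) ∞ M] (p : ProjTractor.ProjStructure (4 * m + 3) M)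
    (I J K : ProjTractor.TractorEnd p) (hIJK : ProjTractor.IsHypercomplex I J K)
    (hI : I.IsParallel) (hJ : J.IsParallel) (hK : K.IsParallel) :
    -- the distribution spanned by `i, j, k` has rank 3 and is integrable; brackets
    ((∀ x : M, LinearIndependent ℝ ![I.proj x, J.proj x, K.proj x]) ∧
      ProjTractor.IsIntegrable 3
        (fun x : M ↦ Submodule.span ℝ {I.proj x, J.proj x, K.proj x}) ∧
      (∀ x : M, VectorField.mlieBracket (𝓡 (4 * m + 3)) I.proj J.proj x
        = (-2 : ℝ) • K.proj x) ∧
      (∀ x : M, VectorField.mlieBracket (𝓡 (4 * m + 3)) J.proj K.proj x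
        = (-2 : ℝ) • I.proj x) ∧
      (∀ x : M, VectorField.mlieBracket (𝓡 (4 * m + 3)) K.proj I.proj x
        = (-2 : ℝ) • J.proj x)) ∧
    -- adapted scales exist locally
    ((∀ x : M, ∃ U : Set M, IsOpen U ∧ x ∈ U ∧ ∃ nabla : ProjTractor.ConnOp (4 * m + 3) M,
        ProjTractor.IsAdaptedScaleOn p I.proj J.proj K.proj nabla U) ∧
      -- and the freedom is an exact 1-form that annihilates `i, j, k`
      (∀ (U : Set M) (nabla nabla' : ProjTractor.ConnOp (4 * m + 3) M), IsOpen U →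
        ProjTractor.IsAdaptedScaleOn p I.proj J.proj K.proj nabla U →
        (ProjTractor.IsAdaptedScaleOn p I.proj J.proj K.proj nabla' U ↔
          ∃ f : M → ℝ, ProjTractor.SmoothFunOn (N := 4 * m + 3) f U ∧
            ProjTractor.IsProjChangeOn nabla nabla' (ProjTractor.dForm f) U ∧
            ∀ x ∈ U, ProjTractor.dForm (N := 4 * m + 3) f x (I.proj x) = 0 ∧
              ProjTractor.dForm (N := 4 * m + 3) f x (J.proj x) = 0 ∧
              ProjTractor.dForm (N := 4 * m + 3) f x (K.proj x) = 0))) ∧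
    -- `i, j, k` are affine symmetries of every adapted scale, and projective symmetries
    ((∀ (U : Set M) (nabla : ProjTractor.ConnOp (4 * m + 3) M), IsOpen U →
        ProjTractor.IsAdaptedScaleOn p I.proj J.proj K.proj nabla U →
        ProjTractor.IsAffineSymmetryOn nabla I.proj U ∧
        ProjTractor.IsAffineSymmetryOn nabla J.proj U ∧
        ProjTractor.IsAffineSymmetryOn nabla K.proj U) ∧
      (∀ nabla ∈ p.conns,
        ProjTractor.IsProjSymmetryOn nabla I.proj Set.univ ∧
        ProjTractor.IsProjSymmetryOn nabla J.proj Set.univ ∧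
        ProjTractor.IsProjSymmetryOn nabla K.proj Set.univ)) := by
  have hN : 3 ≤ 4 * m + 3 := by omega
  have hN' : 2 ≤ 4 * m + 3 := by omega
  refine ⟨⟨hIJK.linearIndependent, hIJK.isIntegrable hI hJ hK hN, hIJK.mlieBracket_IJ hI hJ hK,
    hIJK.mlieBracket_JK hI hJ hK, hIJK.mlieBracket_KI hI hJ hK⟩,
    ⟨hIJK.exists_isAdaptedScaleOn hI hJ hK hN, fun U nabla nabla' hU h ↦
      ProjTractor.isAdaptedScaleOn_iff hU (I.smoothFieldOn_proj.mono (Set.subset_univ U))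
        (J.smoothFieldOn_proj.mono (Set.subset_univ U))
        (K.smoothFieldOn_proj.mono (Set.subset_univ U)) h⟩,
    ⟨fun U nabla hU h ↦ ⟨?_, ?_, ?_⟩, fun nabla h ↦
      ⟨hIJK.isProjSymmetryOn hI hJ hK hI hN' ⟨nabla, h⟩,
        hIJK.isProjSymmetryOn hI hJ hK hJ hN' ⟨nabla, h⟩,
        hIJK.isProjSymmetryOn hI hJ hK hK hN' ⟨nabla, h⟩⟩⟩⟩
  · exact hIJK.isAffineSymmetryOn hI hJ hK hI hN' hU h.1 fun x hx ↦ (h.2 x hx).1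
  · exact hIJK.isAffineSymmetryOn hI hJ hK hJ hN' hU h.1 fun x hx ↦ (h.2 x hx).2.1
  · exact hIJK.isAffineSymmetryOn hI hJ hK hK hN' hU h.1 fun x hx ↦ (h.2 x hx).2.2
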